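/- A characteristic subgroup functor $\mathcal S$ assigns to every finite group $G$ a subgroup $\mathcal S(G)\le G$ such that every isomorphism $G_1\to G_2$ maps $\mathcal S(G_1)$ onto $\mathcal S(G_2)$; it is Abelian if $\mathcal S(G)$ is Abelian for every $G$. For such an $\mathcal S$, let $\theta_G\colon G/\mathcal S(G)\to\mathrm{Aut}(\mathcal S(G))$ be the conjugation action $\theta_G(g\mathcal S(G))(a)=gag^{-1}$, and let $H^2(G/\mathcal S(G),\mathcal S(G),\theta_G)$ be the group of 2-cocycles modulo 2-coboundaries for this action. Given finite groups $G_1,G_2$, write $A_i=\mathcal S(G_i)$, $Q_i=G_i/A_i$, $\theta_i=\theta_{G_i}$. An action compatibility from $\theta_1$ to $\theta_2$ is a pair of isomorphisms $\alpha\colon A_1\to A_2$, $\beta\colon Q_1\to Q_2$ with $\alpha(\theta_1(q)(a))=\theta_2(\beta(q))(\alpha(a))$ for all $q\in Q_1$, $a\in A_1$. The action compatibilities form the empty set or a coset $\Gamma\cdot(\alpha,\beta)$ with $\Gamma\le\mathrm{Aut}(A_2)\times\mathrm{Aut}(Q_2)$, acting by composition. A coset is specified by one representative together with a list of generators of the subgroup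 (or by a flag saying that it is empty); likewise for the coset $\mathrm{Iso}(G_1,G_2)=\mathrm{Aut}(G_2)\cdot\varphi$ of all isomorphisms. Theorem. There are a deterministic algorithm and a polynomial $p$ such that the following holds for every Abelian characteristic subgroup functor $\mathcal S$ and all finite groups $G_1,G_2$. Given the Cayley tables of $G_1,G_2$, the tables of the inclusions $A_i\to G_i$ and of the projections $G_i\to Q_i$ (with respect to arbitrary enumerations of the elements), and the coset of action compatibilities from $\theta_1$ to $\theta_2$, specified with $k$ generators, the algorithm outputs the coset $\mathrm{Iso}(G_1,G_2)$, that is, it reports that there is no isomorphism, or outputs one isomorphism $G_1\to G_2$ together with generators of $\mathrm{Aut}(G_2)$. For each $i\in\{1,2\}$ its running time is at most $$p\bigl(|G_1|+|G_2|+k+|H^2(Q_i,A_i,\theta_i)|\bigr).$$ -/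

import Mathlib

universe u

open scoped IsMulCommutative

/-! ### Characteristic subgroup functors -/

/-- A characteristic subgroup functor: it assigns to every finite group `G` a subgroup of `G`, in
such a way that every isomorphism `G₁ ≃* G₂` restricts to an isomorphism of the assigned
subgroups. -/
structure CharSubgroupFunctor where
  obj : ∀ (G : Type u) [Group G] [Finite G], Subgroup G
  map_obj : ∀ (G₁ G₂ : Type u) [Group G₁] [Finite G₁] [Group G₂] [Finite G₂] (φ : G₁ ≃* G₂),
    (obj G₁).map φ.toMonoidHom = obj G₂

/-- A characteristic subgroup functor all of whose values are Abelian. -/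
structure AbelianCharSubgroupFunctor extends CharSubgroupFunctor.{u} where
  abelian : ∀ (G : Type u) [Group G] [Finite G], IsMulCommutative (obj G)

instance AbelianCharSubgroupFunctor.instIsMulCommutative (S : AbelianCharSubgroupFunctor.{u})
    (G : Type u) [Group G] [Finite G] : IsMulCommutative (S.obj G) :=
  S.abelian G

instance AbelianCharSubgroupFunctor.instNormal (S : AbelianCharSubgroupFunctor.{u})
    (G : Type u) [Group G] [Finite G] : (S.obj G).Normal :=
  haveI : (S.obj G).Characteristic :=
    Subgroup.characteristic_iff_map_eq.2 fun φ => S.map_obj G G φ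
  inferInstance

/-! ### Second cohomology, written multiplicatively -/

section Cohomology

variable {Q A : Type*} [Group Q] [CommGroup A]

/-- The group `Z²(Q, A, θ)` of 2-cocycles. -/
def twoCocycles (θ : Q →* MulAut A) : Subgroup (Q → Q → A) where
  carrier := {f | ∀ p q r : Q, f p q * f (p * q) r = θ p (f q r) * f p (q * r)}
  one_mem' := by intro p q r; simp
  mul_mem' := by
    intro f g hf hg p q r
    simp only [Pi.mul_apply, map_mul]
    rw [mul_mul_mul_comm, hf p q r, hg p q r, mul_mul_mul_comm]
  inv_mem' := by
    intro f hf p q r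
    simp only [Pi.inv_apply, map_inv]
    rw [← mul_inv, hf p q r, mul_inv]

/-- The group `B²(Q, A, θ)` of 2-coboundaries. -/
def twoCoboundaries (θ : Q →* MulAut A) : Subgroup (Q → Q → A) where
  carrier := {f | ∃ v : Q → A, ∀ q r : Q, f q r = v q * θ q (v r) * (v (q * r))⁻¹}
  one_mem' := ⟨1, by intro q r; simp⟩
  mul_mem' := by
    rintro f g ⟨v, hv⟩ ⟨w, hw⟩
    refine ⟨v * w, fun q r => ?_⟩
    simp only [Pi.mul_apply, map_mul, hv, hw, mul_inv]
    rw [mul_mul_mul_comm, mul_mul_mul_comm (v q)]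
  inv_mem' := by
    rintro f ⟨v, hv⟩
    refine ⟨v⁻¹, fun q r => ?_⟩
    simp only [Pi.inv_apply, map_inv, hv, mul_inv]

theorem twoCoboundaries_le_twoCocycles (θ : Q →* MulAut A) :
    twoCoboundaries θ ≤ twoCocycles θ := by
  rintro f ⟨v, hv⟩ p q r
  simp only [hv, map_mul, map_inv, mul_assoc p q r, MulAut.mul_apply]
  apply Additive.ofMul.injective
  simp only [ofMul_mul, ofMul_inv]
  abel

/-- `H²(Q, A, θ) = Z²(Q, A, θ) / B²(Q, A, θ)`. -/
abbrev secondCohomology (θ : Q →* MulAut A) : Type _ :=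
  twoCocycles θ ⧸ (twoCoboundaries θ).subgroupOf (twoCocycles θ)

end Cohomology

/-- The conjugation action of `G ⧸ A` on an Abelian normal subgroup `A`, sending the coset of `g`
to `a ↦ g * a * g⁻¹`. -/
def conjAction {G : Type*} [Group G] (A : Subgroup G) [A.Normal] [IsMulCommutative A] :
    G ⧸ A →* MulAut A :=
  QuotientGroup.lift A MulAut.conjNormal (by
    intro g hg
    ext a
    have h : g * (a : G) = a * g := congrArg Subtype.val (mul_comm (⟨g, hg⟩ : A) a)
    simp [MulAut.conjNormal_apply, h])

/-- The action `θ` of `G ⧸ S(G)` on `S(G)`. -/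
abbrev AbelianCharSubgroupFunctor.action (S : AbelianCharSubgroupFunctor.{u})
    (G : Type u) [Group G] [Finite G] : G ⧸ S.obj G →* MulAut (S.obj G) :=
  conjAction (S.obj G)

/-! ### Cosets and action compatibilities -/

/-- Coset data: `none` stands for the empty coset; `some (x, l)` consists of a representative `x`
and a list `l` of group elements generating the subgroup. -/
abbrev CosetData (X Γ : Type*) := Option (X × List Γ)

/-- The coset data `c` represent the set `C`, where `act` is the left action of `Γ` on `X`:
`some (x, l)` represents `C` if `C = ⟨l⟩ • x`. -/
def CosetData.Represents {X Γ : Type*} [Group Γ] (act : Γ → X → X) (C : Set X) :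
    CosetData X Γ → Prop
  | none => C = ∅
  | some (x, l) => C = (fun γ => act γ x) '' (Subgroup.closure {γ | γ ∈ l} : Subgroup Γ)

/-- The number of generators in the coset data. -/
def CosetData.numGens {X Γ : Type*} : CosetData X Γ → ℕ
  | none => 0
  | some (_, l) => l.length

/-- The set of action compatibilities: pairs of isomorphisms `(α, β)` carrying `θ₁` to `θ₂`. -/
def actionCompatibilities {Q₁ A₁ Q₂ A₂ : Type*} [Group Q₁] [Group A₁] [Group Q₂] [Group A₂]
    (θ₁ : Q₁ →* MulAut A₁) (θ₂ : Q₂ →* MulAut A₂) : Set ((A₁ ≃* A₂) × (Q₁ ≃* Q₂)) :=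
  {x | ∀ (q : Q₁) (a : A₁), x.1 (θ₁ q a) = θ₂ (x.2 q) (x.1 a)}

/-- `c` represents the coset of action compatibilities from `θ₁` to `θ₂`. Here `Aut A₂ × Aut Q₂`
acts on `Iso(A₁, A₂) × Iso(Q₁, Q₂)` by composition. -/
def RepresentsCompat {Q₁ A₁ Q₂ A₂ : Type*} [Group Q₁] [Group A₁] [Group Q₂] [Group A₂]
    (θ₁ : Q₁ →* MulAut A₁) (θ₂ : Q₂ →* MulAut A₂)
    (c : CosetData ((A₁ ≃* A₂) × (Q₁ ≃* Q₂)) (MulAut A₂ × MulAut Q₂)) : Prop :=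
  c.Represents (fun γ x => (x.1.trans γ.1, x.2.trans γ.2)) (actionCompatibilities θ₁ θ₂)

/-- `c` represents the coset `Iso(G₁, G₂)` of all isomorphisms, on which `Aut G₂` acts by
composition. -/
def RepresentsIso {G₁ G₂ : Type*} [Group G₁] [Group G₂]
    (c : CosetData (G₁ ≃* G₂) (MulAut G₂)) : Prop :=
  c.Represents (fun γ φ => φ.trans γ) Set.univ

/-! ### A machine model with a running time

Programs act on finite binary trees. The running time charges each elementary step at least the
total size of the trees that it reads and writes, so no data are copied or discarded for free; the
output is never larger than the running time. The model is Turing complete, and running times in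
it agree with running times of multi-tape Turing machines up to polynomials. -/

/-- Finite binary trees, the data of the programs. -/
inductive Val where
  | nil : Val
  | cons : Val → Val → Val

namespace Val

/-- The number of nodes, leaves included. -/
def size : Val → ℕ
  | nil => 1
  | cons a b => a.size + b.size + 1

def head : Val → Val
  | nil => nil
  | cons a _ => a

def tail : Val → Val
  | nil => nil
  | cons _ b => b

/-- Natural numbers in unary. -/
def ofNat : ℕ → Val
  | 0 => nil
  | n + 1 => cons nil (ofNat n)

def ofList : List Val → Val
  | [] => nil
  | a :: l => cons a (ofList l)

end Val

/-- Programs, each computing a partial function from trees to trees. -/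
inductive Prog where
  /-- return the argument -/
  | id : Prog
  /-- return `nil` -/
  | nil : Prog
  /-- return the left subtree -/
  | head : Prog
  /-- return the right subtree -/
  | tail : Prog
  /-- run both programs on the argument and join the results to a tree -/
  | cons : Prog → Prog → Prog
  /-- `comp g f`: first run `f`, then run `g` on the result -/
  | comp : Prog → Prog → Prog
  /-- `cond c f g`: run `c` as a test, then run `g` if the result is `nil` and `f` if not; `f` and
  `g` are run on the original argument -/
  | cond : Prog → Prog → Prog → Prog
  /-- `loop c f`: as long as the result of `c` is not `nil`, replace the argument by the result
  of `f` -/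
  | loop : Prog → Prog → Prog

/-- `Runs P x y t`: started on `x`, the program `P` halts with output `y` after time `t`. -/
inductive Runs : Prog → Val → Val → ℕ → Prop where
  | id (x : Val) : Runs .id x x (x.size + x.size)
  | nil (x : Val) : Runs .nil x .nil (x.size + 1)
  | head (x : Val) : Runs .head x x.head (x.size + x.head.size)
  | tail (x : Val) : Runs .tail x x.tail (x.size + x.tail.size)
  | cons {f g : Prog} {x y z : Val} {s t : ℕ} (hf : Runs f x y s) (hg : Runs g x z t) :
      Runs (.cons f g) x (.cons y z) (s + t + x.size + (Val.cons y z).size)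
  | comp {f g : Prog} {x y z : Val} {s t : ℕ} (hf : Runs f x y s) (hg : Runs g y z t) :
      Runs (.comp g f) x z (s + t + 1)
  | cond_nil {c f g : Prog} {x y : Val} {s t : ℕ} (hc : Runs c x .nil s) (hg : Runs g x y t) :
      Runs (.cond c f g) x y (s + t + x.size)
  | cond_cons {c f g : Prog} {x y a b : Val} {s t : ℕ} (hc : Runs c x (.cons a b) s)
      (hf : Runs f x y t) : Runs (.cond c f g) x y (s + t + x.size)
  | loop_nil {c f : Prog} {x : Val} {s : ℕ} (hc : Runs c x .nil s) :
      Runs (.loop c f) x x (s + x.size)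
  | loop_cons {c f : Prog} {x y z a b : Val} {s t r : ℕ} (hc : Runs c x (.cons a b) s)
      (hf : Runs f x y t) (hl : Runs (.loop c f) y z r) :
      Runs (.loop c f) x z (s + t + r + x.size)

/-! ### Encoding of inputs and outputs -/

/-- The table of values of a map between enumerated sets. -/
def encodeMap {X Y : Type*} {m n : ℕ} (eX : X ≃ Fin m) (eY : Y ≃ Fin n) (f : X → Y) : Val :=
  Val.ofList (List.ofFn fun i : Fin m => Val.ofNat (eY (f (eX.symm i))))

/-- Coset data as a tree, given encodings of the representative and of the generators. -/
def encodeCoset {X Γ : Type*} (encX : X → Val) (encΓ : Γ → Val) : CosetData X Γ → Val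
  | none => .nil
  | some (x, l) => .cons (encX x) (Val.ofList (l.map encΓ))

/-- Enumerations, in arbitrary order, of a finite group `G`, of a normal subgroup `A` and of the
quotient `G ⧸ A`. -/
structure Enumeration (G : Type*) [Group G] (A : Subgroup G) where
  grp : G ≃ Fin (Nat.card G)
  sub : A ≃ Fin (Nat.card A)
  quo : G ⧸ A ≃ Fin (Nat.card (G ⧸ A))

namespace Enumeration

variable {G : Type*} [Group G] {A : Subgroup G}

/-- The Cayley table of `G`, the table of the inclusion `A → G` and the table of the projection
`G → G ⧸ A`. -/
noncomputable def encode (E : Enumeration G A) : Val :=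
  .cons (Val.ofList (List.ofFn fun i => encodeMap E.grp E.grp fun g => E.grp.symm i * g))
    (.cons (encodeMap E.sub E.grp fun a => (a : G))
      (encodeMap E.grp E.quo fun g => (g : G ⧸ A)))

end Enumeration

section Encodings

variable {G₁ G₂ : Type*} [Group G₁] [Group G₂] {A₁ : Subgroup G₁} {A₂ : Subgroup G₂}
  [A₁.Normal] [A₂.Normal]

/-- Coset data for action compatibilities as a tree: every map is given by its table. -/
noncomputable def encodeCompat (E₁ : Enumeration G₁ A₁) (E₂ : Enumeration G₂ A₂)
    (c : CosetData ((A₁ ≃* A₂) × (G₁ ⧸ A₁ ≃* G₂ ⧸ A₂)) (MulAut A₂ × MulAut (G₂ ⧸ A₂))) : Val :=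
  encodeCoset
    (fun x => .cons (encodeMap E₁.sub E₂.sub x.1) (encodeMap E₁.quo E₂.quo x.2))
    (fun γ => .cons (encodeMap E₂.sub E₂.sub γ.1) (encodeMap E₂.quo E₂.quo γ.2)) c

/-- Coset data for isomorphisms as a tree: every map is given by its table. -/
noncomputable def encodeIso (E₁ : Enumeration G₁ A₁) (E₂ : Enumeration G₂ A₂)
    (c : CosetData (G₁ ≃* G₂) (MulAut G₂)) : Val :=
  encodeCoset (fun φ : G₁ ≃* G₂ => encodeMap E₁.grp E₂.grp φ)
    (fun γ : MulAut G₂ => encodeMap E₂.grp E₂.grp γ) c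

/-- The complete input: both groups with their subgroups and quotients, and the coset data of
action compatibilities. -/
noncomputable def encodeInput (E₁ : Enumeration G₁ A₁) (E₂ : Enumeration G₂ A₂)
    (c : CosetData ((A₁ ≃* A₂) × (G₁ ⧸ A₁ ≃* G₂ ⧸ A₂)) (MulAut A₂ × MulAut (G₂ ⧸ A₂))) : Val :=
  .cons E₁.encode (.cons E₂.encode (encodeCompat E₁ E₂ c))

end Encodings

/-! ### Functions computable in polynomial time -/

/-! Every isomorphism `G₁ ≃* G₂` induces an action compatibility
(`AbelianCharSubgroupFunctor.exists_isOver`), so the question is which members of the given coset of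
compatibilities lift to isomorphisms, and in how many ways.

For a single compatibility `x = (α, β)` take any map `z : G₁ → G₂` that is equivariant along `α` and
induces `β` (`IsOver`); it need not be multiplicative. The other such maps are the products `f * z`
with `f : G₁ → A₂` constant on the cosets of `A₁`. Multiplicativity of `f * z` at a pair of elements
is one equation for `f` whose left side is a homomorphism into the Abelian group `A₂`
(`boundaryAt_eq_target_iff`). Such a system is solved one equation at a time: the solutions of the
previous homogeneous equations are given by generators, and Schreier's lemma for the homomorphism to
the small group `A₂` produces generators of its kernel together with elements attaining all its
values (`ElimInv.closure_eq`, `SolveInv`). Each equation adds a bounded number of generators, so all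
lifts of `x` are obtained, up to generation, in polynomial time (`GroupTables.lift`).

The group of compatibilities of `θ₂` with itself may be far too large to be searched. Those that
lift to automorphisms of `G₂` form a subgroup, and its index is at most the order of `H²`: if two
compatibilities transport the factor set of `G₂` to the same cohomology class, their quotient lifts
(`exists_isOver_of_mk_eq`, `length_le_card_secondCohomology`). The cosets of this subgroup can
therefore be enumerated, and the lifts of the Schreier generators met on the way generate `Aut G₂`
(`OrbitInv.mem_of_mem`). An isomorphism exists if and only if `x` followed by one of the coset
representatives lifts (`GroupTables.exists_isomorphisms`).

Running times are handled for whole families of instances: `PolyTime` speaks of one program for a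
family, and the body of a loop is a statement about the larger family of pairs of an instance and a
loop state. `Extends` transfers results from the outer family to the inner one. -/

theorem Val.size_pos (x : Val) : 0 < x.size := by
  cases x <;> simp [Val.size]

theorem Runs.size_input_le {P : Prog} {x y : Val} {t : ℕ} (h : Runs P x y t) : x.size ≤ t := by
  induction h <;> omega

theorem Runs.size_output_le {P : Prog} {x y : Val} {t : ℕ} (h : Runs P x y t) : y.size ≤ t := by
  induction h <;> try simp only [Val.size] at *
  all_goals omega

/-- `f` is bounded by a polynomial in `n`. -/
def PolyBdd {ι : Type*} (n f : ι → ℕ) : Prop :=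
  ∃ p : Polynomial ℕ, ∀ i, f i ≤ p.eval (n i)

namespace PolyBdd

variable {ι κ : Type*} {n f g : ι → ℕ}

theorem const (n : ι → ℕ) (a : ℕ) : PolyBdd n fun _ => a :=
  ⟨Polynomial.C a, by simp⟩

theorem self (n : ι → ℕ) : PolyBdd n n :=
  ⟨Polynomial.X, by simp⟩

theorem mono (hg : PolyBdd n g) (h : ∀ i, f i ≤ g i) : PolyBdd n f :=
  let ⟨p, hp⟩ := hg
  ⟨p, fun i => (h i).trans (hp i)⟩

theorem add (hf : PolyBdd n f) (hg : PolyBdd n g) : PolyBdd n fun i => f i + g i :=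
  let ⟨p, hp⟩ := hf
  let ⟨q, hq⟩ := hg
  ⟨p + q, fun i => by simpa using add_le_add (hp i) (hq i)⟩

theorem mul (hf : PolyBdd n f) (hg : PolyBdd n g) : PolyBdd n fun i => f i * g i :=
  let ⟨p, hp⟩ := hf
  let ⟨q, hq⟩ := hg
  ⟨p * q, fun i => by simpa using Nat.mul_le_mul (hp i) (hq i)⟩

theorem comap (hf : PolyBdd n f) (e : κ → ι) : PolyBdd (fun k => n (e k)) fun k => f (e k) :=
  let ⟨p, hp⟩ := hf
  ⟨p, fun k => hp (e k)⟩

end PolyBdd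

/-- A single program computes `F i` from `D i`, for all `i`, in time polynomial in `n i`. -/
def PolyTime {ι : Type*} (n : ι → ℕ) (D F : ι → Val) : Prop :=
  ∃ (P : Prog) (t : ι → ℕ), PolyBdd n t ∧ ∀ i, Runs P (D i) (F i) (t i)

/-- Whatever can be computed from `D` can be computed from `D'`, for instances reindexed along
`e`. -/
def Extends {ι κ : Type*} (n : ι → ℕ) (D : ι → Val) (e : κ → ι) (D' : κ → Val) : Prop :=
  ∀ ⦃F : ι → Val⦄, PolyTime n D F → PolyTime (fun k => n (e k)) D' fun k => F (e k)

/-! ### Closure properties of polynomial time computation -/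

namespace PolyTime

variable {ι κ : Type*} {n : ι → ℕ} {D F F' H : ι → Val}

theorem bdd_input (h : PolyTime n D F) : PolyBdd n fun i => (D i).size :=
  let ⟨_, _, ht, hr⟩ := h
  ht.mono fun i => (hr i).size_input_le

theorem bdd (h : PolyTime n D F) : PolyBdd n fun i => (F i).size :=
  let ⟨_, _, ht, hr⟩ := h
  ht.mono fun i => (hr i).size_output_le

theorem refl (h : PolyBdd n fun i => (D i).size) : PolyTime n D D :=
  ⟨.id, _, h.add h, fun i => .id (D i)⟩

theorem comap (h : PolyTime n D F) (e : κ → ι) :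
    PolyTime (fun k => n (e k)) (fun k => D (e k)) fun k => F (e k) :=
  let ⟨P, _, ht, hr⟩ := h
  ⟨P, _, ht.comap e, fun k => hr (e k)⟩

theorem trans (hf : PolyTime n D F) (hg : PolyTime n F H) : PolyTime n D H :=
  let ⟨P, _, ht, hr⟩ := hf
  let ⟨Q, _, hs, hq⟩ := hg
  ⟨.comp Q P, _, (ht.add hs).add (.const n 1), fun i => .comp (hr i) (hq i)⟩

theorem id_of (h : PolyTime n D F) : PolyTime n D D := refl h.bdd_input

theorem nil (h : PolyTime n D F) : PolyTime n D fun _ => .nil :=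
  ⟨.nil, _, h.bdd_input.add (.const n 1), fun i => .nil (D i)⟩

theorem cons (hf : PolyTime n D F) (hg : PolyTime n D H) :
    PolyTime n D fun i => .cons (F i) (H i) :=
  let ⟨P, _, ht, hr⟩ := hf
  let ⟨Q, _, hs, hq⟩ := hg
  ⟨.cons P Q, _, ((ht.add hs).add hf.bdd_input).add ((hf.bdd.add hg.bdd).add (.const n 1)),
    fun i => .cons (hr i) (hq i)⟩

theorem head (h : PolyTime n D F) : PolyTime n D fun i => (F i).head :=
  h.trans ⟨.head, _, (h.bdd.add h.bdd).mono fun i => Nat.add_le_add_left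
    (by cases F i <;> simp only [Val.head, Val.size] <;> omega) _, fun i => .head (F i)⟩

theorem tail (h : PolyTime n D F) : PolyTime n D fun i => (F i).tail :=
  h.trans ⟨.tail, _, (h.bdd.add h.bdd).mono fun i => Nat.add_le_add_left
    (by cases F i <;> simp only [Val.tail, Val.size] <;> omega) _, fun i => .tail (F i)⟩

theorem fst (h : PolyTime n D fun i => .cons (F i) (H i)) : PolyTime n D F := h.head

theorem snd (h : PolyTime n D fun i => .cons (F i) (H i)) : PolyTime n D H := h.tail

theorem cond {c : ι → Val} (hc : PolyTime n D c)
    (h₁ : PolyTime (ι := {i // c i ≠ .nil}) (fun i => n i) (fun i => D i) fun i => F i)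
    (h₂ : PolyTime (ι := {i // c i = .nil}) (fun i => n i) (fun i => D i) fun i => F i) :
    PolyTime n D F := by
  classical
  have hD := hc.bdd_input
  obtain ⟨C, s, hs, hC⟩ := hc
  obtain ⟨P, t, ⟨p, ht⟩, hP⟩ := h₁
  obtain ⟨Q, r, ⟨q, hr⟩, hQ⟩ := h₂
  -- The branches are bounded on disjoint sets of instances; the sum of the two polynomials bounds
  -- both.
  have h3 : PolyBdd n fun i => if h : c i = .nil then r ⟨i, h⟩ else t ⟨i, h⟩ := by
    refine ⟨p + q, fun i => ?_⟩
    rw [Polynomial.eval_add]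
    dsimp only
    split_ifs with h
    · exact (hr ⟨i, h⟩).trans (Nat.le_add_left _ _)
    · exact (ht ⟨i, h⟩).trans (Nat.le_add_right _ _)
  refine ⟨.cond C P Q, _, (hs.add h3).add hD, fun i => ?_⟩
  have hi := hC i
  by_cases h : c i = .nil
  · rw [dif_pos h]
    rw [h] at hi
    exact .cond_nil hi (hQ ⟨i, h⟩)
  · rw [dif_neg h]
    have hp := hP ⟨i, h⟩
    match hv : c i with
    | .nil => exact absurd hv h
    | .cons a b => rw [hv] at hi; exact .cond_cons hi hp

/-- The truth value of `p`. -/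
noncomputable def _root_.Val.ofProp (p : Prop) : Val :=
  open Classical in if p then .cons .nil .nil else .nil

theorem _root_.Val.ofProp_eq_nil {p : Prop} : Val.ofProp p = .nil ↔ ¬p := by
  unfold Val.ofProp; split_ifs <;> simp [*]

theorem congr (h : PolyTime n D F) (e : ∀ i, F i = F' i) : PolyTime n D F' :=
  (funext e : F = F') ▸ h

/-- Case distinction, for results described by a specification. -/
theorem cases {S : ι → Type*} {enc : ∀ i, S i → Val} {P : ∀ i, S i → Prop} {p : ι → Prop}
    (hp : PolyTime n D fun i => .ofProp (p i))
    (h₁ : ∀ D' : {i // p i} → Val, Extends n D Subtype.val D' → ∃ f : ∀ i : {i // p i}, S i.1,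
      PolyTime (fun i => n i.1) D' (fun i => enc i.1 (f i)) ∧ ∀ i, P i.1 (f i))
    (h₂ : ∀ D' : {i // ¬p i} → Val, Extends n D Subtype.val D' → ∃ f : ∀ i : {i // ¬p i}, S i.1,
      PolyTime (fun i => n i.1) D' (fun i => enc i.1 (f i)) ∧ ∀ i, P i.1 (f i)) :
    ∃ f : ∀ i, S i, PolyTime n D (fun i => enc i (f i)) ∧ ∀ i, P i (f i) := by
  classical
  obtain ⟨f, hf, hf'⟩ := h₁ _ fun F hF => hF.comap Subtype.val
  obtain ⟨g, hg, hg'⟩ := h₂ _ fun F hF => hF.comap Subtype.val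
  refine ⟨fun i => if h : p i then f ⟨i, h⟩ else g ⟨i, h⟩, hp.cond ?_ ?_, fun i => ?_⟩
  · have h (i : {i // Val.ofProp (p i) ≠ .nil}) : p i.1 := by
      by_contra h; exact i.2 (Val.ofProp_eq_nil.2 h)
    exact (hf.comap fun i : {i // Val.ofProp (p i) ≠ .nil} => ⟨i.1, h i⟩).congr
      fun i => by simp [h i]
  · have h (i : {i // Val.ofProp (p i) = .nil}) : ¬p i.1 := Val.ofProp_eq_nil.1 i.2
    exact (hg.comap fun i : {i // Val.ofProp (p i) = .nil} => ⟨i.1, h i⟩).congr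
      fun i => by simp [h i]
  · dsimp only
    split_ifs with h
    exacts [hf' ⟨i, h⟩, hg' ⟨i, h⟩]

open Classical in
theorem ite {p : ι → Prop} (hp : PolyTime n D fun i => .ofProp (p i)) (hF : PolyTime n D F)
    (hH : PolyTime n D H) : PolyTime n D fun i => if p i then F i else H i := by
  refine hp.cond ((hF.comap Subtype.val).congr fun i => ?_)
    ((hH.comap Subtype.val).congr fun i => ?_)
  · rw [if_pos]; by_contra h; exact i.2 (Val.ofProp_eq_nil.2 h)
  · rw [if_neg (Val.ofProp_eq_nil.1 i.2)]

theorem and {p q : ι → Prop} (hp : PolyTime n D fun i => .ofProp (p i))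
    (hq : PolyTime n D fun i => .ofProp (q i)) : PolyTime n D fun i => .ofProp (p i ∧ q i) := by
  refine (hp.ite hq hp.nil).congr fun i => ?_
  by_cases h : p i <;> by_cases h' : q i <;> simp [h, h', Val.ofProp]

/-- The instances of the body of a loop that runs as long as `c` is not `nil`. -/
structure _root_.LoopIndex {ι : Type*} {S : ι → Type*} (c : ∀ i, S i → Val) where
  i : ι
  s : S i
  ne_nil : c i s ≠ .nil

/-- Loops. The states carry their invariant; `μ` bounds the number of iterations. -/
theorem while_loop {S : ι → Type*} (enc c : ∀ i, S i → Val) (μ : ∀ i, S i → ℕ) (s₀ : ∀ i, S i)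
    (h₀ : PolyTime n D fun i => enc i (s₀ i))
    {B M : ι → ℕ} (hB : PolyBdd n B) (hb : ∀ i s, (enc i s).size ≤ B i)
    (hM : PolyBdd n M) (hμ : ∀ i s, μ i s ≤ M i)
    (hc : ∀ D' : (Σ i, S i) → Val, Extends n D Sigma.fst D' →
      PolyTime (fun j => n j.1) D' (fun j => enc j.1 j.2) →
        PolyTime (fun j => n j.1) D' fun j => c j.1 j.2)
    (hf : ∀ D' : LoopIndex c → Val, Extends n D LoopIndex.i D' →
      PolyTime (fun j => n j.i) D' (fun j => enc j.i j.s) →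
        ∃ f : ∀ j : LoopIndex c, S j.i, PolyTime (fun j => n j.i) D' (fun j => enc j.i (f j)) ∧
          ∀ j, μ j.i (f j) < μ j.i j.s) :
    ∃ r : ∀ i, S i, PolyTime n D (fun i => enc i (r i)) ∧ ∀ i, c i (r i) = .nil := by
  have hD := h₀.bdd_input
  have hb : PolyBdd (fun j : Σ i, S i => n j.1) fun j => (enc j.1 j.2).size :=
    (hB.comap Sigma.fst).mono fun j => hb j.1 j.2
  have hμ : PolyBdd (fun j : Σ i, S i => n j.1) fun j => μ j.1 j.2 :=
    (hM.comap Sigma.fst).mono fun j => hμ j.1 j.2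
  have hX := (hb.add (hD.comap fun j : Σ i, S i => j.1)).add (.const _ 1)
  -- The loop runs on the pair of the state and the original input, so that the test and the body
  -- have access to everything computable from the instance.
  have hX' : PolyTime (fun j : Σ i, S i => n j.1) (fun j => .cons (enc j.1 j.2) (D j.1))
      (fun j => .cons (enc j.1 j.2) (D j.1)) := refl hX
  have hY' := hX'.comap fun j : LoopIndex c => ⟨j.i, j.s⟩
  obtain ⟨C, tc, ⟨pc, htc⟩, hC⟩ := hc _ (fun F hF =>
    hX'.snd.trans (hF.comap (fun j : Σ i, S i => j.1))) hX'.fst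
  obtain ⟨f, hf, hfμ⟩ := hf _ (fun F hF =>
    hY'.snd.trans (hF.comap LoopIndex.i)) hY'.fst
  obtain ⟨Q, tb, ⟨pb, htb⟩, hQ⟩ := hf.cons hY'.snd
  obtain ⟨px, hpx⟩ := hX
  obtain ⟨pμ, hpμ⟩ := hμ
  -- One round costs at most `pc + pb + px` at `n i`, for the test, the body and the size of the
  -- argument; the `1` in `m + 1` pays for the last, failing test.
  have key (m : ℕ) : ∀ i (s : S i), μ i s ≤ m → ∃ (r : S i) (t : ℕ), c i r = .nil ∧
      Runs (.loop C Q) (.cons (enc i s) (D i)) (.cons (enc i r) (D i)) t ∧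
      t ≤ (m + 1) * (pc + pb + px).eval (n i) := by
    induction m with
    | zero =>
      intro i s hs
      have h : c i s = .nil := by
        by_contra h
        have := hfμ ⟨i, s, h⟩
        simp only at this
        omega
      have h1 := hC ⟨i, s⟩
      simp only [h] at h1
      refine ⟨s, _, h, .loop_nil h1, ?_⟩
      have h2 := htc ⟨i, s⟩
      have h3 := hpx ⟨i, s⟩
      simp only [Polynomial.eval_add, Val.size] at *
      omega
    | succ m ih =>
      intro i s hs
      have h1 := hC ⟨i, s⟩
      have h2 := htc ⟨i, s⟩
      have h3 := hpx ⟨i, s⟩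
      by_cases h : c i s = .nil
      · simp only [h] at h1
        refine ⟨s, _, h, .loop_nil h1, ?_⟩
        simp only [Polynomial.eval_add, Val.size, add_mul, one_mul] at *
        omega
      · obtain ⟨r, t, hr, hrun, ht⟩ := ih i (f ⟨i, s, h⟩) (by
          have := hfμ ⟨i, s, h⟩
          simp only at this
          omega)
        have h4 := hQ ⟨i, s, h⟩
        have h5 := htb ⟨i, s, h⟩
        match hv : c i s with
        | .nil => exact absurd hv h
        | .cons a b =>
          simp only [hv] at h1
          refine ⟨r, _, hr, .loop_cons h1 h4 hrun, ?_⟩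
          simp only [Polynomial.eval_add, Val.size, add_mul, one_mul] at *
          omega
  choose r t hr hrun ht using fun i => key (μ i (s₀ i)) i (s₀ i) le_rfl
  refine ⟨r, ?_, hr⟩
  have : PolyTime n (fun i => .cons (enc i (s₀ i)) (D i)) fun i => .cons (enc i (r i)) (D i) := by
    refine ⟨.loop C Q, t, ⟨(pμ + 1) * (pc + pb + px), fun i => (ht i).trans ?_⟩, hrun⟩
    rw [Polynomial.eval_mul]
    refine Nat.mul_le_mul_right _ ?_
    simpa using hpμ ⟨i, s₀ i⟩
  exact ((h₀.cons h₀.id_of).trans this).fst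

end PolyTime

/-! ### Natural numbers and lists -/

namespace Val

theorem size_ofNat (k : ℕ) : (ofNat k).size = 2 * k + 1 := by
  induction k with
  | zero => rfl
  | succ k ih => simp only [ofNat, size, ih]; omega

theorem ofNat_eq_nil {k : ℕ} : ofNat k = nil ↔ k = 0 := by
  cases k <;> simp [ofNat]

theorem tail_ofNat (k : ℕ) : (ofNat k).tail = ofNat (k - 1) := by
  cases k <;> rfl

theorem size_ofList_append (l m : List Val) :
    (ofList (l ++ m)).size + 1 = (ofList l).size + (ofList m).size := by
  induction l with
  | nil => simp only [ofList, size, List.nil_append]; omega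
  | cons a l ih => simp only [ofList, size, List.cons_append]; omega

theorem size_ofList_le {l : List Val} {B : ℕ} (h : ∀ x ∈ l, x.size ≤ B) :
    (ofList l).size ≤ 1 + l.length * (B + 1) := by
  induction l with
  | nil => simp [ofList, size]
  | cons a l ih =>
    have h1 := ih fun x hx => h x (List.mem_cons_of_mem _ hx)
    have h2 := h a List.mem_cons_self
    simp only [ofList, size, List.length_cons, add_mul, one_mul] at *
    omega

theorem length_le_size_ofList (l : List Val) : l.length ≤ (ofList l).size := by
  induction l with
  | nil => simp
  | cons a l ih => simp only [ofList, size, List.length_cons]; omega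

theorem ofList_eq_nil {l : List Val} : ofList l = nil ↔ l = [] := by
  cases l <;> simp [ofList]

theorem tail_ofList (l : List Val) : (ofList l).tail = ofList l.tail := by
  cases l <;> rfl

theorem head_ofList (l : List Val) : (ofList l).head = l[0]?.getD nil := by
  cases l <;> rfl

theorem size_ofList_le_of_mem {l : List Val} {x : Val} (h : x ∈ l) : x.size ≤ (ofList l).size := by
  obtain ⟨a, b, rfl⟩ := List.append_of_mem h
  have h1 := size_ofList_append a (x :: b)
  have h2 := size_pos (ofList a)
  simp only [ofList, size] at h1
  omega

end Val

/-- Options as trees. -/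
def encodeOption {Y : Type*} (e : Y → Val) : Option Y → Val
  | none => .nil
  | some y => .cons (e y) .nil

namespace PolyTime

variable {ι κ : Type*} {n : ι → ℕ} {D F H : ι → Val}

open Classical in
theorem ite_nil {c : ι → Val} (hc : PolyTime n D c) (hF : PolyTime n D F) (hH : PolyTime n D H) :
    PolyTime n D fun i => if c i = .nil then F i else H i :=
  hc.cond ((hH.comap Subtype.val).congr fun i => by rw [if_neg i.2])
    ((hF.comap Subtype.val).congr fun i => by rw [if_pos i.2])

theorem eq_nil {c : ι → Val} (hc : PolyTime n D c) :
    PolyTime n D fun i => .ofProp (c i = .nil) :=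
  (hc.ite_nil (hc.nil.cons hc.nil) hc.nil).congr fun i => by simp [Val.ofProp]

theorem not {p : ι → Prop} (hp : PolyTime n D fun i => .ofProp (p i)) :
    PolyTime n D fun i => .ofProp (¬p i) :=
  hp.eq_nil.congr fun i => by rw [Val.ofProp_eq_nil]

/-- Both unary numbers are decremented together until one of them vanishes. This does not affect
whether they are equal, and at the end they are equal exactly if both vanish. -/
theorem nat_eq {a b : ι → ℕ} (ha : PolyTime n D fun i => .ofNat (a i))
    (hb : PolyTime n D fun i => .ofNat (b i)) : PolyTime n D fun i => .ofProp (a i = b i) := by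
  obtain ⟨r, hr, hr'⟩ := while_loop (n := n) (D := D)
    (S := fun i => {s : ℕ × ℕ // s.1 ≤ a i ∧ s.2 ≤ b i ∧ (s.1 = s.2 ↔ a i = b i)})
    (fun i s => .cons (.ofNat s.1.1) (.ofNat s.1.2))
    (fun i s => .ofProp (¬Val.ofNat s.1.1 = Val.nil ∧ ¬Val.ofNat s.1.2 = Val.nil)) (fun i s => s.1.1)
    (fun i => ⟨(a i, b i), le_rfl, le_rfl, Iff.rfl⟩) (ha.cons hb)
    (B := fun i => (Val.cons (.ofNat (a i)) (.ofNat (b i))).size) (ha.cons hb).bdd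
    (fun i s => by
      have := s.2.1
      have := s.2.2.1
      simp only [Val.size, Val.size_ofNat]; omega)
    (M := a) (ha.bdd.mono fun i => by rw [Val.size_ofNat]; omega) (fun i s => s.2.1)
    (fun D' w h => h.fst.eq_nil.not.and h.snd.eq_nil.not)
    (fun D' w h => by
      have key (j : LoopIndex fun i (s : {s : ℕ × ℕ // s.1 ≤ a i ∧ s.2 ≤ b i ∧
          (s.1 = s.2 ↔ a i = b i)}) => .ofProp (¬Val.ofNat s.1.1 = Val.nil ∧
          ¬Val.ofNat s.1.2 = Val.nil)) : j.s.1.1 ≠ 0 ∧ j.s.1.2 ≠ 0 := by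
        obtain ⟨i, ⟨s, hs⟩, hj⟩ := j
        simpa [Val.ofNat_eq_nil, Val.ofProp_eq_nil] using hj
      refine ⟨fun j => ⟨(j.s.1.1 - 1, j.s.1.2 - 1), ?_⟩,
        (h.fst.tail.cons h.snd.tail).congr fun j => by simp only [Val.tail_ofNat], fun j => ?_⟩
      · have := key j
        have := j.s.2
        dsimp only
        omega
      · have := (key j).1
        dsimp only
        omega)
  refine ((hr.fst.eq_nil).and (hr.snd.eq_nil)).congr fun i => ?_
  have h1 := hr' i
  have h2 := (r i).2.2.2
  congr 1
  simp only [Val.ofProp_eq_nil, Val.ofNat_eq_nil] at h1 ⊢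
  rw [eq_iff_iff]
  omega

/-- Tails are taken while the index is counted down. An index out of range yields `nil` because head
and tail of `nil` are `nil`. -/
theorem getElem {l : ι → List Val} {k : ι → ℕ} (hl : PolyTime n D fun i => .ofList (l i))
    (hk : PolyTime n D fun i => .ofNat (k i)) :
    PolyTime n D fun i => (l i)[k i]?.getD .nil := by
  obtain ⟨r, hr, hr'⟩ := while_loop (n := n) (D := D)
    (S := fun i => {s : ℕ // s ≤ k i})
    (fun i s => .cons (.ofNat s.1) (.ofList ((l i).drop (k i - s.1))))
    (fun i s => .ofNat s.1) (fun i s => s.1)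
    (fun i => ⟨k i, le_rfl⟩) ((hk.cons hl).congr fun i => by simp)
    (B := fun i => (Val.cons (.ofNat (k i)) (.ofList (l i))).size) (hk.cons hl).bdd
    (fun i s => by
      have := s.2
      have h1 := Val.size_ofList_append ((l i).take (k i - s.1)) ((l i).drop (k i - s.1))
      have h2 := Val.size_pos (.ofList ((l i).take (k i - s.1)))
      rw [List.take_append_drop] at h1
      simp only [Val.size, Val.size_ofNat]; omega)
    (M := k) (hk.bdd.mono fun i => by rw [Val.size_ofNat]; omega) (fun i s => s.2)
    (fun D' w h => h.fst)
    (fun D' w h => by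
      have key (j : LoopIndex fun i (s : {s : ℕ // s ≤ k i}) => Val.ofNat s.1) : j.s.1 ≠ 0 :=
        fun h => j.ne_nil (Val.ofNat_eq_nil.2 h)
      refine ⟨fun j => ⟨j.s.1 - 1, (Nat.sub_le _ _).trans j.s.2⟩,
        (h.fst.tail.cons h.snd.tail).congr fun j => ?_, fun j => ?_⟩
      · have := key j
        have := j.s.2
        rw [Val.tail_ofNat, Val.tail_ofList, List.tail_drop]
        congr 3
        dsimp only
        omega
      · have := key j
        dsimp only
        omega)
  refine hr.snd.head.congr fun i => ?_
  rw [Val.head_ofList, Val.ofNat_eq_nil.1 (hr' i)]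
  simp

/-- Case distinction on an option, for results described by a specification. -/
theorem option_cases {Y S : ι → Type*} {eY : ∀ i, Y i → Val} {eS : ∀ i, S i → Val}
    {P : ∀ i, S i → Prop} {o : ∀ i, Option (Y i)}
    (ho : PolyTime n D fun i => encodeOption (eY i) (o i))
    (h₁ : ∀ D' : {i // o i = none} → Val, Extends n D Subtype.val D' →
      ∃ f : ∀ i : {i // o i = none}, S i.1,
        PolyTime (fun i => n i.1) D' (fun i => eS i.1 (f i)) ∧ ∀ i, P i.1 (f i))
    (h₂ : ∀ D' : (Σ i, {y // o i = some y}) → Val, Extends n D Sigma.fst D' →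
      PolyTime (fun j => n j.1) D' (fun j => eY j.1 j.2.1) →
      ∃ f : ∀ j : Σ i, {y // o i = some y}, S j.1,
        PolyTime (fun j => n j.1) D' (fun j => eS j.1 (f j)) ∧ ∀ j, P j.1 (f j)) :
    ∃ f : ∀ i, S i, PolyTime n D (fun i => eS i (f i)) ∧ ∀ i, P i (f i) := by
  have e (i : ι) : (encodeOption (eY i) (o i) = .nil) = (o i = none) := by
    cases o i <;> simp [encodeOption]
  have h := ho.eq_nil.congr fun i => congrArg Val.ofProp (e i)
  refine h.cases h₁ fun D' w => ?_
  have hy (i : {i // ¬o i = none}) : ∃ y, o i.1 = some y := Option.ne_none_iff_exists'.1 i.2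
  choose y hy using hy
  obtain ⟨f, hf, hf'⟩ := h₂ (fun j => D j.1 |>.cons (eY j.1 j.2.1)) (fun F hF => by
      refine PolyTime.trans (F := fun j => D j.1) ?_ (hF.comap Sigma.fst)
      exact (refl (((ho.bdd_input.comap Sigma.fst).add (ho.bdd.comap Sigma.fst)).mono fun j => by
        obtain ⟨i, y, hy⟩ := j
        simp only [hy, encodeOption, Val.size]; omega)).fst)
    (refl (((ho.bdd_input.comap Sigma.fst).add (ho.bdd.comap Sigma.fst)).mono fun j => by
      obtain ⟨i, y, hy⟩ := j
      simp only [hy, encodeOption, Val.size]; omega)).snd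
  refine ⟨fun i => f ⟨i.1, y i, hy i⟩, ?_, fun i => hf' ⟨i.1, y i, hy i⟩⟩
  refine PolyTime.trans (F := fun i => (D i.1).cons (eY i.1 (y i))) ?_
    (hf.comap fun i => ⟨i.1, y i, hy i⟩)
  exact (w ho.id_of).cons ((w ho).head.congr fun i => by rw [hy i]; rfl)

/-- The instances of the body of a loop over the list `l`. -/
structure _root_.FoldIndex {ι : Type*} {X S : ι → Type*} (l : ∀ i, List (X i))
    (Inv : ∀ i, List (X i) → S i → Prop) where
  i : ι
  pre : List (X i)
  x : X i
  s : S i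
  prefix_l : pre ++ [x] <+: l i
  inv : Inv i pre s

/-- Loops over a list. -/
theorem fold {X S : ι → Type*} {eX : ∀ i, X i → Val} {eS : ∀ i, S i → Val}
    {l : ∀ i, List (X i)} (hl : PolyTime n D fun i => .ofList ((l i).map (eX i)))
    (Inv : ∀ i, List (X i) → S i → Prop) {s₀ : ∀ i, S i}
    (h₀ : PolyTime n D fun i => eS i (s₀ i)) (hs₀ : ∀ i, Inv i [] (s₀ i))
    {B : ι → ℕ} (hB : PolyBdd n B)
    (hb : ∀ i pre s, pre <+: l i → Inv i pre s → (eS i s).size ≤ B i)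
    (step : ∀ D' : FoldIndex l Inv → Val, Extends n D FoldIndex.i D' →
      PolyTime (fun j => n j.i) D' (fun j => eX j.i j.x) →
      PolyTime (fun j => n j.i) D' (fun j => eS j.i j.s) →
        ∃ f : ∀ j : FoldIndex l Inv, S j.i, PolyTime (fun j => n j.i) D' (fun j => eS j.i (f j)) ∧
          ∀ j, Inv j.i (j.pre ++ [j.x]) (f j)) :
    ∃ f : ∀ i, S i, PolyTime n D (fun i => eS i (f i)) ∧ ∀ i, Inv i (l i) (f i) := by
  obtain ⟨r, hr, hr'⟩ := while_loop (n := n) (D := D)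
    -- A state consists of the part of the list already read, the part still unread and the
    -- accumulator. Only the last two are encoded; the first serves the invariant.
    (S := fun i => {s : List (X i) × List (X i) × S i // s.1 ++ s.2.1 = l i ∧ Inv i s.1 s.2.2})
    (fun i s => .cons (.ofList (s.1.2.1.map (eX i))) (eS i s.1.2.2))
    (fun i s => .ofList (s.1.2.1.map (eX i))) (fun i s => s.1.2.1.length)
    (fun i => ⟨([], l i, s₀ i), rfl, hs₀ i⟩) (hl.cons h₀) ((hl.bdd.add hB).add (.const n 1))
    (fun i s => by
      have h1 := Val.size_ofList_append (s.1.1.map (eX i)) (s.1.2.1.map (eX i))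
      have h2 := Val.size_pos (.ofList (s.1.1.map (eX i)))
      have h3 := hb i s.1.1 s.1.2.2 ⟨_, s.2.1⟩ s.2.2
      rw [← List.map_append, s.2.1] at h1
      simp only [Val.size]; omega)
    (M := fun i => (l i).length)
    (hl.bdd.mono fun i => by simpa using Val.length_le_size_ofList ((l i).map (eX i)))
    (fun i s => by
      have := congrArg List.length s.2.1
      rw [List.length_append] at this; omega)
    (fun D' w h => h.fst)
    (fun D' w h => by
      have key (j : LoopIndex fun i (s : {s : List (X i) × List (X i) × S i //
          s.1 ++ s.2.1 = l i ∧ Inv i s.1 s.2.2}) => .ofList (s.1.2.1.map (eX i))) :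
          ∃ x m, j.s.1.2.1 = x :: m := by
        apply List.exists_cons_of_ne_nil
        intro h
        exact j.ne_nil (by rw [h]; rfl)
      choose x m hxm using key
      have hp j : (j.s.1.1 ++ [x j]) ++ m j = l j.i := by
        refine Eq.trans ?_ j.s.2.1
        rw [hxm]; simp
      let e (j : LoopIndex fun i (s : {s : List (X i) × List (X i) × S i //
          s.1 ++ s.2.1 = l i ∧ Inv i s.1 s.2.2}) => .ofList (s.1.2.1.map (eX i))) :
          FoldIndex l Inv :=
        ⟨j.i, j.s.1.1, x j, j.s.1.2.2, ⟨_, hp j⟩, j.s.2.2⟩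
      have hbdd : PolyBdd (fun j : FoldIndex l Inv => n j.i)
          fun j => (Val.cons (eX j.i j.x) (.cons (eS j.i j.s) (D j.i))).size := by
        refine (((hl.bdd.add hB).add h₀.bdd_input).add (.const n 2)).comap
          FoldIndex.i |>.mono fun j => ?_
        have h3 := hb j.i j.pre j.s ((List.prefix_append _ _).trans j.prefix_l) j.inv
        have h4 : (eX j.i j.x).size ≤ (Val.ofList ((l j.i).map (eX j.i))).size :=
          Val.size_ofList_le_of_mem (List.mem_map_of_mem (j.prefix_l.subset (by simp)))
        simp only [Val.size]
        omega
      have hI := refl hbdd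
      obtain ⟨f, hf, hf'⟩ := step _ (fun F hF => hI.snd.snd.trans (hF.comap FoldIndex.i))
        hI.fst hI.snd.fst
      refine ⟨fun j => ⟨(j.s.1.1 ++ [x j], m j, f (e j)), hp j, hf' (e j)⟩,
        (PolyTime.cons (F := fun j => .ofList ((m j).map (eX j.i))) ?_ ?_), fun j => ?_⟩
      · exact h.fst.tail.congr fun j => by rw [hxm j]; rfl
      · refine PolyTime.trans (F := fun j => .cons (eX j.i (x j))
          (.cons (eS j.i j.s.1.2.2) (D j.i))) ?_ (hf.comap e)
        refine PolyTime.cons ?_ (h.snd.cons (w h₀.id_of))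
        exact h.fst.head.congr fun j => by rw [hxm j]; rfl
      · dsimp only
        rw [hxm j]; simp)
  refine ⟨fun i => (r i).1.2.2, hr.snd, fun i => ?_⟩
  have h1 := (r i).2
  have h2 := hr' i
  rw [Val.ofList_eq_nil, List.map_eq_nil_iff] at h2
  rw [h2, List.append_nil] at h1
  exact h1.1 ▸ h1.2

end PolyTime

/-- The members of the lists `l i`. -/
structure MemIndex {ι : Type*} {X : ι → Type*} (l : ∀ i, List (X i)) where
  i : ι
  x : X i
  mem : x ∈ l i

/-- The member of `l` that the body of a loop deals with. -/
def FoldIndex.toMemIndex {ι : Type*} {X S : ι → Type*} {l : ∀ i, List (X i)}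
    {Inv : ∀ i, List (X i) → S i → Prop} (j : FoldIndex l Inv) : MemIndex l :=
  ⟨j.i, j.x, j.prefix_l.subset (by simp)⟩

namespace PolyTime

variable {ι κ : Type*} {n : ι → ℕ} {D F H : ι → Val} {X Y : ι → Type*}
  {eX : ∀ i, X i → Val} {eY : ∀ i, Y i → Val} {l : ∀ i, List (X i)}

theorem mem_context (hl : PolyTime n D fun i => .ofList ((l i).map (eX i))) :
    PolyTime (fun j : MemIndex l => n j.i) (fun j => .cons (eX j.i j.x) (D j.i))
      fun j => .cons (eX j.i j.x) (D j.i) := by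
  refine refl (((hl.bdd.add hl.bdd_input).add (.const n 1)).comap MemIndex.i |>.mono fun j => ?_)
  have h4 : (eX j.i j.x).size ≤ (Val.ofList ((l j.i).map (eX j.i))).size :=
    Val.size_ofList_le_of_mem (List.mem_map_of_mem j.mem)
  simp only [Val.size]
  omega

theorem mem_extends (hl : PolyTime n D fun i => .ofList ((l i).map (eX i))) :
    Extends n D MemIndex.i (fun j : MemIndex l => .cons (eX j.i j.x) (D j.i)) :=
  fun _ hF => hl.mem_context.snd.trans (hF.comap MemIndex.i)

theorem of_mem_context {S : ι → Type*} {Inv : ∀ i, List (X i) → S i → Prop}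
    {D' : FoldIndex l Inv → Val} {F : MemIndex l → Val} (h : PolyTime n D H)
    (w : Extends n D FoldIndex.i D')
    (hx : PolyTime (fun j => n j.i) D' (fun j => eX j.i j.x))
    (hF : PolyTime (fun j : MemIndex l => n j.i) (fun j => .cons (eX j.i j.x) (D j.i)) F) :
    PolyTime (fun j => n j.i) D' (fun j => F j.toMemIndex) :=
  (hx.cons (w h.id_of)).trans (hF.comap FoldIndex.toMemIndex)

/-- Accumulating by `cons` turns the list around. For lists used as sets of elements this is
harmless, and for tables it is compensated by the reversal in `Equiv.elems`. -/
theorem rev_map (hl : PolyTime n D fun i => .ofList ((l i).map (eX i))) {g : ∀ i, X i → Val}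
    (hg : ∀ D' : MemIndex l → Val, Extends n D MemIndex.i D' →
      PolyTime (fun j => n j.i) D' (fun j => eX j.i j.x) →
        PolyTime (fun j => n j.i) D' (fun j => g j.i j.x)) :
    PolyTime n D fun i => .ofList ((l i).map (g i)).reverse := by
  have hg' := hg _ hl.mem_extends hl.mem_context.fst
  obtain ⟨p, hp⟩ := hg'.bdd
  obtain ⟨f, hf, hf'⟩ := hl.fold (S := fun i => List (X i))
    (eS := fun i s => .ofList (s.map (g i)).reverse) (fun i pre s => s = pre) (s₀ := fun _ => [])
    hl.nil (fun _ => rfl) (B := fun i => 1 + (l i).length * (p.eval (n i) + 1))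
    ((PolyBdd.const n 1).add (.mul (hl.bdd.mono fun i => by
      simpa using Val.length_le_size_ofList ((l i).map (eX i)))
        (.add ⟨p, fun _ => le_rfl⟩ (.const n 1))))
    (by
      rintro i pre s hpre rfl
      refine (Val.size_ofList_le (B := p.eval (n i)) ?_).trans ?_
      · intro v hv
        simp only [List.mem_reverse, List.mem_map] at hv
        obtain ⟨x, hx, rfl⟩ := hv
        exact hp ⟨i, x, hpre.subset hx⟩
      · have := hpre.length_le
        rw [List.length_reverse, List.length_map]
        gcongr)
    (fun D' w hx hs => ⟨fun j => j.pre ++ [j.x],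
      ((hl.of_mem_context w hx hg').cons hs).congr fun j => by
        simp [j.inv, Val.ofList, FoldIndex.toMemIndex], fun j => rfl⟩)
  exact hf.congr fun i => by rw [hf']

theorem rev_append {l m : ι → List Val} (hl : PolyTime n D fun i => .ofList (l i))
    (hm : PolyTime n D fun i => .ofList (m i)) :
    PolyTime n D fun i => .ofList ((l i).reverse ++ m i) := by
  have hl' : PolyTime n D fun i => .ofList ((l i).map fun v => v) := hl.congr fun i => by simp
  obtain ⟨f, hf, hf'⟩ := hl'.fold (S := fun i => List Val)
    (eS := fun i s => .ofList s) (fun i pre s => s = pre.reverse ++ m i) (s₀ := m)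
    hm (fun _ => rfl) (hl.bdd.add hm.bdd)
    (by
      rintro i pre s ⟨r, hr⟩ rfl
      have h1 := Val.size_ofList_append pre r
      have h2 := Val.size_ofList_append pre.reverse (m i)
      have h3 (v : List Val) : (Val.ofList v.reverse).size = (Val.ofList v).size := by
        induction v with
        | nil => rfl
        | cons a v ih =>
          have := Val.size_ofList_append v.reverse [a]
          simp only [List.reverse_cons, Val.ofList, Val.size] at *
          omega
      rw [hr] at h1
      rw [h3] at h2
      have := Val.size_pos (.ofList r)
      omega)
    (fun D' w hx hs => ⟨_, (hx.cons hs : PolyTime _ _ fun j => .ofList (j.x :: j.s)),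
      fun j => by simp [j.inv]⟩)
  exact hf.congr fun i => by rw [hf']

theorem flat_map (hl : PolyTime n D fun i => .ofList ((l i).map (eX i))) {g : ∀ i, X i → List (Y i)}
    (hg : ∀ D' : MemIndex l → Val, Extends n D MemIndex.i D' →
      PolyTime (fun j => n j.i) D' (fun j => eX j.i j.x) →
        PolyTime (fun j => n j.i) D' (fun j => .ofList ((g j.i j.x).map (eY j.i)))) :
    PolyTime n D fun i => .ofList (((l i).flatMap (g i)).reverse.map (eY i)) := by
  have hg' := hg _ hl.mem_extends hl.mem_context.fst
  obtain ⟨p, hp⟩ := hg'.bdd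
  have hp' i x (hx : x ∈ l i) := hp ⟨i, x, hx⟩
  dsimp only at hp'
  obtain ⟨f, hf, hf'⟩ := hl.fold (S := fun i => List (X i))
    (eS := fun i s => .ofList ((s.flatMap (g i)).reverse.map (eY i))) (fun i pre s => s = pre)
    (s₀ := fun _ => []) hl.nil (fun _ => rfl)
    (B := fun i => 1 + (l i).length * p.eval (n i) * (p.eval (n i) + 1))
    ((PolyBdd.const n 1).add (.mul (.mul (hl.bdd.mono fun i => by
      simpa using Val.length_le_size_ofList ((l i).map (eX i))) ⟨p, fun _ => le_rfl⟩)
        (.add ⟨p, fun _ => le_rfl⟩ (.const n 1))))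
    (by
      rintro i pre s hpre rfl
      refine (Val.size_ofList_le (B := p.eval (n i)) ?_).trans ?_
      · intro v hv
        simp only [List.mem_map, List.mem_reverse, List.mem_flatMap] at hv
        obtain ⟨y, ⟨x, hx, hy⟩, rfl⟩ := hv
        exact (Val.size_ofList_le_of_mem (List.mem_map_of_mem hy)).trans (hp' i x (hpre.subset hx))
      · have h1 := hpre.length_le
        have h2 : (s.flatMap (g i)).length ≤ s.length * p.eval (n i) := by
          rw [List.length_flatMap]
          refine (List.sum_le_card_nsmul _ (p.eval (n i)) ?_).trans (by simp)
          intro k hk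
          obtain ⟨x, hx, rfl⟩ := List.mem_map.1 hk
          refine le_trans ?_ (hp' i x (hpre.subset hx))
          simpa using Val.length_le_size_ofList ((g i x).map (eY i))
        rw [List.length_map, List.length_reverse]
        have h3 := Nat.mul_le_mul_right (p.eval (n i)) h1
        exact Nat.add_le_add_left (Nat.mul_le_mul_right _ (h2.trans h3)) _)
    (fun D' w hx hs => ⟨fun j => j.pre ++ [j.x],
      ((hl.of_mem_context w hx hg').rev_append hs).congr fun j => by
        simp [j.inv, FoldIndex.toMemIndex], fun j => rfl⟩)
  exact hf.congr fun i => by rw [hf']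

/-- Searching a list. -/
theorem find_some (hl : PolyTime n D fun i => .ofList ((l i).map (eX i)))
    {P : ∀ i, X i → Y i → Prop} {N : ∀ i, X i → Prop}
    (hg : ∀ D' : MemIndex l → Val, Extends n D MemIndex.i D' →
      PolyTime (fun j => n j.i) D' (fun j => eX j.i j.x) →
        ∃ g : ∀ j : MemIndex l, Option (Y j.i),
          PolyTime (fun j => n j.i) D' (fun j => encodeOption (eY j.i) (g j)) ∧
            ∀ j, (g j).elim (N j.i j.x) (P j.i j.x)) :
    ∃ f : ∀ i, Option (Y i), PolyTime n D (fun i => encodeOption (eY i) (f i)) ∧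
      ∀ i, (f i).elim (∀ x ∈ l i, N i x) fun y => ∃ x ∈ l i, P i x y := by
  obtain ⟨g, hg, hg'⟩ := hg _ hl.mem_extends hl.mem_context.fst
  obtain ⟨p, hp⟩ := hg.bdd
  obtain ⟨f, hf, hf'⟩ := hl.fold (S := fun i => Option (Y i)) (eS := fun i => encodeOption (eY i))
    -- The accumulator ranges over all states that satisfy the invariant, so its size bound has to
    -- be part of the invariant. The `+ 1` covers the initial value `none`.
    (fun i pre s => (encodeOption (eY i) s).size ≤ p.eval (n i) + 1 ∧
      s.elim (∀ x ∈ pre, N i x) fun y => ∃ x ∈ l i, P i x y)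
    (s₀ := fun _ => none) hl.nil (fun i => by simp [encodeOption, Val.size])
    (.add ⟨p, fun _ => le_rfl⟩ (.const n 1)) (fun i pre s _ h => h.1)
    (fun D' w hx hs => hs.option_cases
      (P := fun (i : FoldIndex _ _) (s : Option (Y i.i)) =>
        (encodeOption (eY i.i) s).size ≤ p.eval (n i.i) + 1 ∧
        s.elim (∀ x ∈ i.pre ++ [i.x], N i.i x) fun y => ∃ x ∈ l i.i, P i.i x y)
      (fun D'' w' => ⟨fun j => g j.1.toMemIndex, w' (hl.of_mem_context w hx hg), fun j =>
        ⟨(hp j.1.toMemIndex).trans (Nat.le_succ _), by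
          have h1 := hg' j.1.toMemIndex
          have h2 := j.1.inv.2
          rw [j.2] at h2
          dsimp only
          generalize g j.1.toMemIndex = o at h1 ⊢
          cases o with
          | none =>
            simp only [Option.elim_none, List.mem_append, List.mem_singleton] at *
            rintro x (hx | rfl)
            exacts [h2 x hx, h1]
          | some y => exact ⟨_, j.1.toMemIndex.mem, h1⟩⟩⟩)
      (fun D'' w' hy => ⟨fun j => some j.2.1, hy.cons hy.nil, fun j => by
        have := j.1.inv
        rw [j.2.2] at this
        exact this⟩))
  exact ⟨f, hf, fun i => (hf' i).2⟩

/-! ### Enumerated sets and tables of maps -/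

/-- An element of an enumerated set as a tree. -/
def _root_.Val.ofElem {X : Type*} {m : ℕ} (e : X ≃ Fin m) (x : X) : Val :=
  .ofNat (e x)

theorem _root_.Val.size_ofElem_le {X : Type*} {m : ℕ} (e : X ≃ Fin m) (x : X) :
    (Val.ofElem e x).size ≤ 2 * m + 1 := by
  rw [Val.ofElem, Val.size_ofNat]; omega

/-- All elements of an enumerated set. -/
def _root_.Equiv.elems {X : Type*} {m : ℕ} (e : X ≃ Fin m) : List X :=
  (List.ofFn e.symm).reverse

theorem _root_.Equiv.mem_elems {X : Type*} {m : ℕ} (e : X ≃ Fin m) (x : X) : x ∈ e.elems := by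
  simp only [Equiv.elems, List.mem_reverse, List.mem_ofFn]
  exact ⟨e x, by simp⟩

theorem _root_.Equiv.length_elems {X : Type*} {m : ℕ} (e : X ≃ Fin m) : e.elems.length = m := by
  simp [Equiv.elems]

/-- All elements of an enumerated set, as a tree. -/
def _root_.Val.ofElems {X : Type*} {m : ℕ} (e : X ≃ Fin m) : Val :=
  .ofList (e.elems.map (.ofElem e))

variable {a b : ι → ℕ} {uX : ∀ i, X i ≃ Fin (a i)} {uY : ∀ i, Y i ≃ Fin (b i)}

theorem elem_eq {x y : ∀ i, X i} (hx : PolyTime n D fun i => .ofElem (uX i) (x i))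
    (hy : PolyTime n D fun i => .ofElem (uX i) (y i)) :
    PolyTime n D fun i => .ofProp (x i = y i) :=
  (nat_eq hx hy).congr fun i => by
    congr 1
    simp only [Fin.val_inj, EmbeddingLike.apply_eq_iff_eq]

theorem apply {f : ∀ i, X i → Y i} {x : ∀ i, X i}
    (hf : PolyTime n D fun i => encodeMap (uX i) (uY i) (f i))
    (hx : PolyTime n D fun i => .ofElem (uX i) (x i)) :
    PolyTime n D fun i => .ofElem (uY i) (f i (x i)) :=
  (getElem hf hx).congr fun i => by simp [Val.ofElem]

/-- Only the length of the list matters: any table indexed by the set reveals its size, and the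
elements are encoded by the numbers below it. -/
theorem elems {l : ι → List Val} (hl : PolyTime n D fun i => .ofList (l i))
    (h : ∀ i, (l i).length = a i) : PolyTime n D fun i => .ofElems (uX i) := by
  have hl' : PolyTime n D fun i => .ofList ((l i).map fun v => v) := hl.congr fun i => by simp
  -- The counter is kept next to the list of smaller numbers because it is the next entry to be
  -- prepended.
  let e (k : ℕ) : Val := .cons (.ofNat k) (.ofList ((List.range k).reverse.map .ofNat))
  obtain ⟨f, hf, hf'⟩ := hl'.fold (S := fun i => ℕ) (eS := fun _ => e)
    (fun i pre s => s = pre.length) (s₀ := fun _ => 0) (hl.nil.cons hl.nil) (fun _ => rfl)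
    (B := fun i => (2 * (l i).length + 1) + (1 + (l i).length * (2 * (l i).length + 1 + 1)) + 1)
    (by
      have h : PolyBdd n fun i => (l i).length := hl.bdd.mono fun i => Val.length_le_size_ofList _
      have h' := ((PolyBdd.const n 2).mul h).add (.const n 1)
      exact (h'.add ((PolyBdd.const n 1).add (h.mul (h'.add (.const n 1))))).add (.const n 1))
    (by
      rintro i pre s hpre rfl
      have := hpre.length_le
      simp only [e, Val.size, Val.size_ofNat]
      gcongr
      refine (Val.size_ofList_le (B := 2 * (l i).length + 1) ?_).trans ?_
      · intro v hv
        simp only [List.mem_map, List.mem_reverse, List.mem_range] at hv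
        obtain ⟨k, hk, rfl⟩ := hv
        rw [Val.size_ofNat]
        omega
      · simp only [List.length_map, List.length_reverse, List.length_range]
        gcongr)
    (fun D' w hx hs => ⟨fun j => j.s + 1, ((hs.nil.cons hs.fst).cons (hs.fst.cons hs.snd)).congr
      fun j => by simp [e, List.range_succ, Val.ofList, Val.ofNat], fun j => by simp [j.inv]⟩)
  refine hf.snd.congr fun i => ?_
  rw [hf', h, Val.ofElems, Equiv.elems]
  congr 1
  rw [List.map_reverse, List.map_reverse, List.map_ofFn, ← List.map_coe_finRange_eq_range,
    List.map_map, ← List.ofFn_eq_map]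
  congr 2
  funext k
  simp [Val.ofElem]

/-- Tables of maps described by a specification. -/
theorem build_map (hX : PolyTime n D fun i => .ofElems (uX i))
    {P : ∀ i, X i → Y i → Prop}
    (hg : ∀ D' : MemIndex (fun i => (uX i).elems) → Val, Extends n D MemIndex.i D' →
      PolyTime (fun j => n j.i) D' (fun j => .ofElem (uX j.i) j.x) →
        ∃ g : ∀ j : MemIndex (fun i => (uX i).elems), Y j.i,
          PolyTime (fun j => n j.i) D' (fun j => .ofElem (uY j.i) (g j)) ∧
            ∀ j, P j.i j.x (g j)) :
    ∃ f : ∀ i, X i → Y i, PolyTime n D (fun i => encodeMap (uX i) (uY i) (f i)) ∧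
      ∀ i x, P i x (f i x) := by
  obtain ⟨g, hg, hg'⟩ := hg _ hX.mem_extends hX.mem_context.fst
  refine ⟨fun i x => g ⟨i, x, (uX i).mem_elems x⟩, ?_, fun i x => hg' ⟨i, x, _⟩⟩
  refine (hX.rev_map (g := fun i x => .ofElem (uY i) (g ⟨i, x, (uX i).mem_elems x⟩))
    fun D' w hx => ?_).congr fun i => ?_
  · exact ((hx.cons (w hX.id_of)).trans hg)
  · rw [Equiv.elems, List.map_reverse, List.reverse_reverse, List.map_ofFn]
    rfl

theorem map_of (hX : PolyTime n D fun i => .ofElems (uX i)) {f : ∀ i, X i → Y i}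
    (hg : ∀ D' : MemIndex (fun i => (uX i).elems) → Val, Extends n D MemIndex.i D' →
      PolyTime (fun j => n j.i) D' (fun j => .ofElem (uX j.i) j.x) →
        PolyTime (fun j => n j.i) D' (fun j => .ofElem (uY j.i) (f j.i j.x))) :
    PolyTime n D (fun i => encodeMap (uX i) (uY i) (f i)) := by
  refine (hX.rev_map (g := fun i x => .ofElem (uY i) (f i x)) hg).congr fun i => ?_
  rw [Equiv.elems, List.map_reverse, List.reverse_reverse, List.map_ofFn]
  rfl

theorem find_elem (hX : PolyTime n D fun i => .ofElems (uX i)) {P : ∀ i, X i → Prop}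
    (hP : ∀ D' : MemIndex (fun i => (uX i).elems) → Val, Extends n D MemIndex.i D' →
      PolyTime (fun j => n j.i) D' (fun j => .ofElem (uX j.i) j.x) →
        PolyTime (fun j => n j.i) D' (fun j => .ofProp (P j.i j.x)))
    (hex : ∀ i, ∃ x, P i x) :
    ∃ f : ∀ i, X i, PolyTime n D (fun i => .ofElem (uX i) (f i)) ∧ ∀ i, P i (f i) := by
  classical
  obtain ⟨f, hf, hf'⟩ := hX.find_some (Y := X) (eY := fun i => .ofElem (uX i))
    (P := fun i x y => P i y) (N := fun i x => ¬P i x) fun D' w hx =>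
    ⟨fun j => if P j.i j.x then some j.x else none,
      ((hP D' w hx).ite (hx.cons hx.nil) hx.nil).congr fun j => by dsimp only; split_ifs <;> rfl,
      fun j => by dsimp only; split_ifs with h <;> exact h⟩
  have h i : ∃ y, f i = some y ∧ P i y := by
    have h := hf' i
    match hi : f i with
    | none =>
      rw [hi] at h
      obtain ⟨x, hx⟩ := hex i
      exact absurd hx (h x ((uX i).mem_elems x))
    | some y =>
      rw [hi] at h
      obtain ⟨_, _, h⟩ := h
      exact ⟨y, rfl, h⟩
  choose y hy hP using h
  exact ⟨y, hf.head.congr fun i => by rw [hy]; rfl, hP⟩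

end PolyTime

/-! ### Solving equations in finite Abelian groups -/

section Elimination

variable {M B : Type*} [CommGroup M] [Group B]

/-- The invariant of the elimination: `W` represents values of `χ` on `closure L`, `O` consists of
elements of the kernel of `χ`, and the elements of `P` are yet to be dealt with. -/
structure ElimInv (χ : M →* B) (L W P O : List M) : Prop where
  mem_W : ∀ w ∈ W, w ∈ Subgroup.closure {x | x ∈ L}
  mem_P : ∀ w ∈ P, w ∈ Subgroup.closure {x | x ∈ L}
  mem_O : ∀ w ∈ O, w ∈ Subgroup.closure {x | x ∈ L} ⊓ χ.ker
  nodup : (W.map χ).Nodup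
  one : 1 ∈ P ∨ ∃ w ∈ W, 1 / w ∈ Subgroup.closure {x | x ∈ O}
  gen : ∀ x ∈ L, x ∈ P ∨ ∃ w ∈ W, x / w ∈ Subgroup.closure {x | x ∈ O}
  mul : ∀ x ∈ W, ∀ y ∈ W, x * y ∈ P ∨ ∃ w ∈ W, x * y / w ∈ Subgroup.closure {x | x ∈ O}
  length : O.length + (P.length + (Nat.card B - W.length) * (Nat.card B + 1)) ≤
    L.length + 1 + Nat.card B * (Nat.card B + 1)

namespace ElimInv

variable {χ : M →* B} {L W P O : List M} {x w : M}

theorem init (χ : M →* B) (L : List M) : ElimInv χ L [] (1 :: L) [] where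
  mem_W := by simp
  mem_P := by
    rintro w hw
    rcases List.mem_cons.1 hw with rfl | hw
    exacts [one_mem _, Subgroup.subset_closure hw]
  mem_O := by simp
  nodup := by simp
  one := by simp
  gen := fun x hx => .inl (by simp [hx])
  mul := by simp
  length := by simp

/-- Here `x / w` is a Schreier generator of the kernel. In the bound `length` one unit moves from
the pending list to `O`. -/
theorem found (h : ElimInv χ L W (x :: P) O) (hw : w ∈ W) (hx : χ (x / w) = 1) :
    ElimInv χ L W P (x / w :: O) := by
  have le : Subgroup.closure {y | y ∈ O} ≤ Subgroup.closure {y | y ∈ x / w :: O} :=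
    Subgroup.closure_mono fun y hy => List.mem_cons_of_mem _ hy
  have key (y : M) (hy : y ∈ x :: P ∨ ∃ w ∈ W, y / w ∈ Subgroup.closure {x | x ∈ O}) :
      y ∈ P ∨ ∃ v ∈ W, y / v ∈ Subgroup.closure {y | y ∈ x / w :: O} := by
    rcases hy with hy | ⟨v, hv, hy⟩
    · rcases List.mem_cons.1 hy with rfl | hy
      · exact .inr ⟨w, hw, Subgroup.subset_closure (by simp)⟩
      · exact .inl hy
    · exact .inr ⟨v, hv, le hy⟩
  refine ⟨h.mem_W, fun v hv => h.mem_P v (List.mem_cons_of_mem _ hv), ?_, h.nodup, key _ h.one,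
    fun y hy => key _ (h.gen y hy), fun y hy v hv => key _ (h.mul y hy v hv), ?_⟩
  · intro v hv
    rcases List.mem_cons.1 hv with rfl | hv
    · exact Subgroup.mem_inf.2 ⟨div_mem (h.mem_P x (by simp)) (h.mem_W w hw), hx⟩
    · exact h.mem_O v hv
  · have := h.length
    simp only [List.length_cons] at *
    omega

theorem length_le [Finite B] (h : ElimInv χ L W P O) : W.length ≤ Nat.card B := by
  classical
  have := Fintype.ofFinite B
  rw [← List.length_map (f := χ), Nat.card_eq_fintype_card]
  exact h.nodup.length_le_card

theorem measure_new_lt [Finite B] (h : ElimInv χ L (x :: W) P O) (k : ℕ) :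
    W.length + 1 + k + (Nat.card B - (W.length + 1)) * (Nat.card B + 1) <
      k + 1 + (Nat.card B - W.length) * (Nat.card B + 1) := by
  have hc := h.length_le
  rw [List.length_cons] at hc
  obtain ⟨c, hc'⟩ := Nat.exists_eq_add_of_le hc
  rw [show Nat.card B - (W.length + 1) = c by omega, show Nat.card B - W.length = c + 1 by omega]
  simp only [add_mul, one_mul]
  omega

/-- As `M` is commutative, the products of `x` with `x :: W` on one side suffice for the closure of
`W` under multiplication. There are at most `Nat.card B` of them, fewer than the `Nat.card B + 1`
units released in `length` when `W` grows. -/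
theorem new [Finite B] (h : ElimInv χ L W (x :: P) O) (hx : ∀ w ∈ W, χ (x / w) ≠ 1) :
    ElimInv χ L (x :: W) ((x :: W).map (x * ·) ++ P) O := by
  have hxL := h.mem_P x (by simp)
  have key (y : M) (hy : y ∈ x :: P ∨ ∃ w ∈ W, y / w ∈ Subgroup.closure {x | x ∈ O}) :
      y ∈ (x :: W).map (x * ·) ++ P ∨ ∃ v ∈ x :: W, y / v ∈ Subgroup.closure {y | y ∈ O} := by
    rcases hy with hy | ⟨v, hv, hy⟩
    · rcases List.mem_cons.1 hy with rfl | hy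
      · exact .inr ⟨y, by simp, by simp⟩
      · exact .inl (List.mem_append_right _ hy)
    · exact .inr ⟨v, List.mem_cons_of_mem _ hv, hy⟩
  have hn : ((x :: W).map χ).Nodup := by
    rw [List.map_cons, List.nodup_cons]
    refine ⟨fun hm => ?_, h.nodup⟩
    obtain ⟨w, hw, e⟩ := List.mem_map.1 hm
    exact hx w hw (by rw [map_div, e, div_self'])
  have hW : ∀ w ∈ x :: W, w ∈ Subgroup.closure {x | x ∈ L} := by
    intro w hw
    rcases List.mem_cons.1 hw with rfl | hw
    exacts [hxL, h.mem_W w hw]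
  refine ⟨hW, ?_, h.mem_O, hn, key _ h.one, fun y hy => key _ (h.gen y hy), ?_, ?_⟩
  · intro w hw
    rcases List.mem_append.1 hw with hw | hw
    · obtain ⟨v, hv, rfl⟩ := List.mem_map.1 hw
      exact mul_mem hxL (hW v hv)
    · exact h.mem_P w (List.mem_cons_of_mem _ hw)
  · intro y hy v hv
    rcases List.mem_cons.1 hy with rfl | hy'
    · exact .inl (List.mem_append_left _ (List.mem_map_of_mem hv))
    · rcases List.mem_cons.1 hv with rfl | hv'
      · rw [mul_comm]
        exact .inl (List.mem_append_left _ (List.mem_map_of_mem hy))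
      · exact key _ (h.mul y hy' v hv')
  · classical
    have := Fintype.ofFinite B
    have hc : (x :: W).length ≤ Nat.card B := by
      rw [← List.length_map (f := χ), Nat.card_eq_fintype_card]
      exact hn.length_le_card
    have := h.length
    obtain ⟨c, hc'⟩ := Nat.exists_eq_add_of_le hc
    have e1 : Nat.card B - (x :: W).length = c := by omega
    have e2 : Nat.card B - W.length = c + 1 := by simp only [List.length_cons] at hc'; omega
    rw [e2] at this
    rw [e1]
    simp only [List.length_append, List.length_map, List.length_cons, add_mul, one_mul] at *
    omega

/-- With nothing pending, the translates of the closure of `O` by `W` contain `1` and the generators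
and are closed under products. Inverses are powers because `M` is finite. -/
theorem exists_div_mem [Finite M] (h : ElimInv χ L W [] O) {m : M}
    (hm : m ∈ Subgroup.closure {x | x ∈ L}) :
    ∃ w ∈ W, m / w ∈ Subgroup.closure {x | x ∈ O} := by
  have hone := h.one
  have hgen := h.gen
  have hmul := h.mul
  simp only [List.not_mem_nil, false_or] at hone hgen hmul
  have key (a b : M) (ha : ∃ w ∈ W, a / w ∈ Subgroup.closure {x | x ∈ O})
      (hb : ∃ w ∈ W, b / w ∈ Subgroup.closure {x | x ∈ O}) :
      ∃ w ∈ W, a * b / w ∈ Subgroup.closure {x | x ∈ O} := by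
    obtain ⟨v, hv, ha⟩ := ha
    obtain ⟨w, hw, hb⟩ := hb
    obtain ⟨y, hy, hvw⟩ := hmul v hv w hw
    refine ⟨y, hy, ?_⟩
    have : a * b / y = (a / v) * (b / w) * (v * w / y) := by
      simp only [div_eq_mul_inv]
      rw [mul_mul_mul_comm a, ← mul_inv, mul_assoc (a * b), inv_mul_cancel_left]
    rw [this]
    exact mul_mem (mul_mem ha hb) hvw
  have hpow (a : M) (k : ℕ) (ha : ∃ w ∈ W, a / w ∈ Subgroup.closure {x | x ∈ O}) :
      ∃ w ∈ W, a ^ k / w ∈ Subgroup.closure {x | x ∈ O} := by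
    induction k with
    | zero => simpa using hone
    | succ k ih => rw [pow_succ]; exact key _ _ ih ha
  induction hm using Subgroup.closure_induction with
  | mem x hx => exact hgen x hx
  | one => exact hone
  | mul a b _ _ ha hb => exact key a b ha hb
  | inv a _ ha =>
    rw [show a⁻¹ = a ^ (orderOf a - 1) from inv_eq_of_mul_eq_one_right (by
      rw [← pow_succ', Nat.sub_add_cancel (orderOf_pos a), pow_orderOf_eq_one])]
    exact hpow _ _ ha

/-- This is Schreier's lemma. For `m` in the kernel, the representatives of `m` and of `1` in `W`
both have the value `1` under `χ`; since `χ` separates `W` they coincide, and `m` is a quotient of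
two elements of the closure of `O`. -/
theorem closure_eq [Finite M] (h : ElimInv χ L W [] O) :
    Subgroup.closure {x | x ∈ O} = Subgroup.closure {x | x ∈ L} ⊓ χ.ker := by
  have hO : Subgroup.closure {x | x ∈ O} ≤ Subgroup.closure {x | x ∈ L} ⊓ χ.ker :=
    (Subgroup.closure_le _).2 h.mem_O
  refine le_antisymm hO fun m hm => ?_
  obtain ⟨w, hw, h1⟩ := h.exists_div_mem hm.1
  obtain ⟨v, hv, h2⟩ := h.exists_div_mem (one_mem _)
  have e1 : χ m = χ w := by
    have := (Subgroup.mem_inf.1 (hO h1)).2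
    rwa [MonoidHom.mem_ker, map_div, div_eq_one] at this
  have e2 : χ 1 = χ v := by
    have := (Subgroup.mem_inf.1 (hO h2)).2
    rwa [MonoidHom.mem_ker, map_div, div_eq_one] at this
  rw [map_one] at e2
  have e : w = v := List.inj_on_of_nodup_map h.nodup hw hv (by rw [← e1, ← e2]; exact hm.2)
  rw [e] at h1
  have := div_mem h1 h2
  simpa using this

theorem exists_map_eq [Finite M] (h : ElimInv χ L W [] O) {m : M}
    (hm : m ∈ Subgroup.closure {x | x ∈ L}) : ∃ w ∈ W, χ w = χ m := by
  obtain ⟨w, hw, h1⟩ := h.exists_div_mem hm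
  rw [h.closure_eq] at h1
  have := (Subgroup.mem_inf.1 h1).2
  rw [MonoidHom.mem_ker, map_div, div_eq_one] at this
  exact ⟨w, hw, this.symm⟩

end ElimInv

/-- The states of the elimination. -/
structure ElimState (χ : M →* B) (L : List M) where
  W : List M
  P : List M
  O : List M
  inv : ElimInv χ L W P O

/-- A bound on the number of steps that remain. -/
noncomputable def ElimState.measure {χ : M →* B} {L : List M} (s : ElimState χ L) : ℕ :=
  s.P.length + (Nat.card B - s.W.length) * (Nat.card B + 1)

/-- The states of the elimination as trees. -/
def ElimState.encode {χ : M →* B} {L : List M} (e : M → Val) (s : ElimState χ L) : Val :=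
  .cons (.ofList (s.W.map e)) (.cons (.ofList (s.P.map e)) (.ofList (s.O.map e)))

/-- The invariant of the solution of the equations `χ e m = c e` for `m ∈ K`: a solution of the
first equations `E` together with generators for the solutions of the homogeneous equations. -/
def SolveInv {I : Type*} (K : Subgroup M) (χ : I → M →* B) (c : I → B) (b : ℕ) (E : List I) :
    Option (M × List M) → Prop
  | none => ∀ m ∈ K, ∃ e ∈ E, χ e m ≠ c e
  | some (m, L) => m ∈ K ∧ (∀ e ∈ E, χ e m = c e) ∧
    (∀ x, x ∈ Subgroup.closure {x | x ∈ L} ↔ x ∈ K ∧ ∀ e ∈ E, χ e x = 1) ∧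
    L.length ≤ b + E.length * (1 + Nat.card B * (Nat.card B + 1))

namespace SolveInv

variable {I : Type*} {K : Subgroup M} {χ : I → M →* B} {c : I → B} {b : ℕ} {E : List I} {e : I}
  {m : M} {L W O : List M}

theorem none_append (h : SolveInv K χ c b E none) : SolveInv K χ c b (E ++ [e]) none := by
  intro m hm
  obtain ⟨e', he', h⟩ := h m hm
  exact ⟨e', by simp [he'], h⟩

/-- If `x` solved all equations, `x / m` would solve the old homogeneous ones, and `χ e` attains its
value at `x / m` already on `W`. Hence testing the candidates `w * m` with `w ∈ W` decides
solvability. -/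
theorem append_none [Finite M] (h : SolveInv K χ c b E (some (m, L))) (hW : ElimInv (χ e) L W [] O)
    (hw : ∀ w ∈ W, χ e (w * m) ≠ c e) : SolveInv K χ c b (E ++ [e]) none := by
  obtain ⟨hm, hE, hL, -⟩ := h
  intro x hx
  by_contra! hne
  obtain ⟨w, hw', e1⟩ := hW.exists_map_eq (m := x / m) ((hL _).2 ⟨div_mem hx hm, fun e' he' => by
    rw [map_div, hne e' (by simp [he']), hE e' he', div_self']⟩)
  exact hw w hw' (by rw [map_mul, e1, ← map_mul, div_mul_cancel, hne e (by simp)])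

theorem append_some [Finite M] (h : SolveInv K χ c b E (some (m, L)))
    (hW : ElimInv (χ e) L W [] O) {w : M} (hw : w ∈ W) (hwe : χ e (w * m) = c e) :
    SolveInv K χ c b (E ++ [e]) (some (w * m, O)) := by
  obtain ⟨hm, hE, hL, hl⟩ := h
  have hw := (hL _).1 (hW.mem_W w hw)
  refine ⟨mul_mem hw.1 hm, ?_, fun x => ?_, ?_⟩
  · intro e' he'
    rcases List.mem_append.1 he' with he' | he'
    · rw [map_mul, hw.2 e' he', one_mul, hE e' he']
    · rwa [List.mem_singleton.1 he']
  · rw [hW.closure_eq, Subgroup.mem_inf, hL, and_assoc, MonoidHom.mem_ker]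
    simp only [List.mem_append, List.mem_singleton, or_imp, forall_and, forall_eq]
  · have := hW.length
    simp only [List.length_append, List.length_singleton, add_mul, one_mul] at *
    omega

end SolveInv

end Elimination

/-! ### Computing with group tables -/

/-- The Cayley table. -/
def encodeCayley {G : Type*} [Group G] {m : ℕ} (e : G ≃ Fin m) : Val :=
  .ofList (List.ofFn fun i => encodeMap e e fun g => e.symm i * g)

/-- The tables of the groups `G i`, of the subgroups `A i` and of the quotients are computable. -/
structure GroupTables {ι : Type*} (n : ι → ℕ) (D : ι → Val) {G : ι → Type*} [∀ i, Group (G i)]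
    {A : ∀ i, Subgroup (G i)} (u : ∀ i, Enumeration (G i) (A i)) : Prop where
  cayley : PolyTime n D fun i => encodeCayley (u i).grp
  incl : PolyTime n D fun i => encodeMap (u i).sub (u i).grp fun a => (a : G i)
  proj : PolyTime n D fun i => encodeMap (u i).grp (u i).quo fun g => (g : G i ⧸ A i)
  elems_grp : PolyTime n D fun i => .ofElems (u i).grp
  elems_sub : PolyTime n D fun i => .ofElems (u i).sub
  elems_quo : PolyTime n D fun i => .ofElems (u i).quo

/-- The table of a map to a subgroup. -/
noncomputable def encodeCochain {G H : Type*} [Group G] [Group H] {A : Subgroup G} {B : Subgroup H}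
    (u : Enumeration G A) (v : Enumeration H B) (f : G → B) : Val :=
  encodeMap u.grp v.grp fun g => (f g : H)

theorem Val.size_encodeMap_le {X Y : Type*} {m n : ℕ} (eX : X ≃ Fin m) (eY : Y ≃ Fin n)
    (f : X → Y) : (encodeMap eX eY f).size ≤ 1 + m * (2 * n + 2) := by
  refine (Val.size_ofList_le (B := 2 * n + 1) ?_).trans (by simp)
  intro v hv
  obtain ⟨k, rfl⟩ := List.mem_ofFn.1 hv
  exact Val.size_ofElem_le _ _

namespace GroupTables

variable {ι κ : Type*} {n : ι → ℕ} {D : ι → Val} {G H : ι → Type*} [∀ i, Group (G i)]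
  [∀ i, Group (H i)] {A : ∀ i, Subgroup (G i)} {B : ∀ i, Subgroup (H i)}
  {u : ∀ i, Enumeration (G i) (A i)} {v : ∀ i, Enumeration (H i) (B i)}

theorem extend (T : GroupTables n D u) {e : κ → ι} {D' : κ → Val} (w : Extends n D e D') :
    GroupTables (fun k => n (e k)) D' fun k => u (e k) where
  cayley := w T.cayley
  incl := w T.incl
  proj := w T.proj
  elems_grp := w T.elems_grp
  elems_sub := w T.elems_sub
  elems_quo := w T.elems_quo

theorem polyBdd_card (T : GroupTables n D u) : PolyBdd n fun i => Nat.card (G i) :=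
  T.elems_grp.bdd.mono fun i => by
    simpa [Val.ofElems, Equiv.length_elems] using
      Val.length_le_size_ofList ((u i).grp.elems.map (Val.ofElem (u i).grp))

theorem polyBdd_card_sub (T : GroupTables n D u) : PolyBdd n fun i => Nat.card (A i) :=
  T.elems_sub.bdd.mono fun i => by
    simpa [Val.ofElems, Equiv.length_elems] using
      Val.length_le_size_ofList ((u i).sub.elems.map (Val.ofElem (u i).sub))

theorem mul (T : GroupTables n D u) {x y : ∀ i, G i}
    (hx : PolyTime n D fun i => .ofElem (u i).grp (x i))
    (hy : PolyTime n D fun i => .ofElem (u i).grp (y i)) :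
    PolyTime n D fun i => .ofElem (u i).grp (x i * y i) := by
  refine PolyTime.apply (uX := fun i => (u i).grp) (f := fun i g => x i * g) ?_ hy
  exact (PolyTime.getElem T.cayley hx).congr fun i => by simp

theorem cochain_apply {f : ∀ i, G i → B i} {g : ∀ i, G i}
    (hf : PolyTime n D fun i => encodeCochain (u i) (v i) (f i))
    (hg : PolyTime n D fun i => .ofElem (u i).grp (g i)) :
    PolyTime n D fun i => .ofElem (v i).grp (f i (g i) : H i) :=
  PolyTime.apply (f := fun i g => (f i g : H i)) hf hg

theorem cochain_mul (T : GroupTables n D u) (T' : GroupTables n D v) {f g : ∀ i, G i → B i}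
    (hf : PolyTime n D fun i => encodeCochain (u i) (v i) (f i))
    (hg : PolyTime n D fun i => encodeCochain (u i) (v i) (g i)) :
    PolyTime n D fun i => encodeCochain (u i) (v i) (f i * g i) :=
  PolyTime.map_of T.elems_grp fun _ w hx =>
    (T'.extend w).mul (cochain_apply (w hf) hx) (cochain_apply (w hg) hx)

/-- No table of inverses is given; each value of the quotient is found by searching the subgroup for
the solution of an equation between products. -/
theorem cochain_div (T : GroupTables n D u) (T' : GroupTables n D v) {f g : ∀ i, G i → B i}
    (hf : PolyTime n D fun i => encodeCochain (u i) (v i) (f i))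
    (hg : PolyTime n D fun i => encodeCochain (u i) (v i) (g i)) :
    PolyTime n D fun i => encodeCochain (u i) (v i) (f i / g i) := by
  refine PolyTime.map_of T.elems_grp fun D' w hx => ?_
  obtain ⟨b, hb, h⟩ := (w T'.elems_sub).find_elem
    (P := fun j b => (b * g j.i j.x : H j.i) = f j.i j.x)
    (fun D'' w' hb => ((T'.extend w).extend w').mul (PolyTime.apply (w' (w T'.incl)) hb)
      (cochain_apply (w' (w hg)) (w' hx)) |>.elem_eq (cochain_apply (w' (w hf)) (w' hx)))
    (fun j => ⟨f j.i j.x / g j.i j.x, by simp⟩)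
  refine (PolyTime.apply (w T'.incl) hb).congr fun j => ?_
  congr 1
  rw [Pi.div_apply, Subgroup.coe_div, ← h j, mul_div_cancel_right]

end GroupTables

/-! ### The obstruction of a map to be a homomorphism -/

section Boundary

variable {G H : Type*} [Group G] [Group H] (B : Subgroup H) [B.Normal] [IsMulCommutative B]

/-- The value of the coboundary of a 1-cochain at a pair of group elements, for the action of `G`
on `B` by conjugation through `z`. -/
def boundaryAt (z : G → H) (e : G × G) : (G → B) →* B where
  toFun f := f e.1 * MulAut.conjNormal (z e.1) (f e.2) * (f (e.1 * e.2))⁻¹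
  map_one' := by simp
  map_mul' f g := by
    simp only [Pi.mul_apply, map_mul, mul_inv]
    rw [mul_mul_mul_comm (f e.1), mul_mul_mul_comm]

variable {B}

/-- Clearing the inverses leaves a condition that can be tested with the Cayley tables alone. -/
theorem boundaryAt_eq_one_iff {z : G → H} {e : G × G} {f : G → B} :
    boundaryAt B z e f = 1 ↔ (f e.1 * (z e.1 * f e.2) : H) = f (e.1 * e.2) * z e.1 := by
  rw [boundaryAt, MonoidHom.coe_mk, OneHom.coe_mk, mul_inv_eq_one, Subtype.ext_iff]
  simp only [Subgroup.coe_mul, MulAut.conjNormal_apply]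
  rw [← mul_left_inj (z e.1)]
  simp only [mul_assoc, inv_mul_cancel, mul_one]

/-- The value of `boundaryAt B z e f` for which `fun g => f g * z g` is multiplicative at `e`. -/
def multTarget (z : G → H) (hz : ∀ g h, z (g * h) * (z g * z h)⁻¹ ∈ B) (e : G × G) : B :=
  ⟨z (e.1 * e.2) * (z e.1 * z e.2)⁻¹, hz e.1 e.2⟩

/-- This turns multiplicativity into linear equations: for each fixed pair `e` the left side is a
homomorphism in `f`, whether or not `z` is multiplicative. -/
theorem boundaryAt_eq_target_iff {z : G → H} (hz : ∀ g h, z (g * h) * (z g * z h)⁻¹ ∈ B)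
    {e : G × G} {f : G → B} : boundaryAt B z e f = multTarget z hz e ↔
      (f e.1 * z e.1) * (f e.2 * z e.2) = (f (e.1 * e.2) : H) * z (e.1 * e.2) := by
  rw [boundaryAt, MonoidHom.coe_mk, OneHom.coe_mk, mul_inv_eq_iff_eq_mul,
    mul_comm (multTarget z hz e), Subtype.ext_iff]
  simp only [Subgroup.coe_mul, MulAut.conjNormal_apply, multTarget]
  rw [← mul_left_inj (z e.1 * z e.2)]
  simp only [mul_assoc, inv_mul_cancel, mul_one, inv_mul_cancel_left]

end Boundary

/-! ### Elimination with tables of cochains in polynomial time -/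

namespace GroupTables

variable {ι κ : Type*} {n : ι → ℕ} {D : ι → Val} {G H : ι → Type*} [∀ i, Group (G i)]
  [∀ i, Group (H i)] {A : ∀ i, Subgroup (G i)} {B : ∀ i, Subgroup (H i)}
  {u : ∀ i, Enumeration (G i) (A i)} {v : ∀ i, Enumeration (H i) (B i)}
  [∀ i, (B i).Normal] [∀ i, IsMulCommutative (B i)]

theorem boundaryAt_eq_one (T : GroupTables n D u) (T' : GroupTables n D v) {z : ∀ i, G i → H i}
    (hz : PolyTime n D fun i => encodeMap (u i).grp (v i).grp (z i)) {p q : ∀ i, G i}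
    (hp : PolyTime n D fun i => .ofElem (u i).grp (p i))
    (hq : PolyTime n D fun i => .ofElem (u i).grp (q i)) {f : ∀ i, G i → B i}
    (hf : PolyTime n D fun i => encodeCochain (u i) (v i) (f i)) :
    PolyTime n D fun i => .ofProp (boundaryAt (B i) (z i) (p i, q i) (f i) = 1) := by
  refine PolyTime.congr (PolyTime.elem_eq (T'.mul (cochain_apply hf hp) (T'.mul (hz.apply hp)
    (cochain_apply hf hq))) (T'.mul (cochain_apply hf (T.mul hp hq)) (hz.apply hp))) fun i => ?_
  congr 1
  exact propext (boundaryAt_eq_one_iff (z := z i) (e := (p i, q i)) (f := f i)).symm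

variable [∀ i, Finite (H i)]

theorem eliminate_step (T : GroupTables n D u) (T' : GroupTables n D v) {z : ∀ i, G i → H i}
    (hz : PolyTime n D fun i => encodeMap (u i).grp (v i).grp (z i)) {p q : ∀ i, G i}
    (hp : PolyTime n D fun i => .ofElem (u i).grp (p i))
    (hq : PolyTime n D fun i => .ofElem (u i).grp (q i)) {L W P O : ∀ i, List (G i → B i)}
    {x : ∀ i, G i → B i}
    (hW : PolyTime n D fun i => .ofList ((W i).map (encodeCochain (u i) (v i))))
    (hx : PolyTime n D fun i => encodeCochain (u i) (v i) (x i))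
    (hP : PolyTime n D fun i => .ofList ((P i).map (encodeCochain (u i) (v i))))
    (hO : PolyTime n D fun i => .ofList ((O i).map (encodeCochain (u i) (v i))))
    (inv : ∀ i, ElimInv (boundaryAt (B i) (z i) (p i, q i)) (L i) (W i) (x i :: P i) (O i)) :
    ∃ f : ∀ i, ElimState (boundaryAt (B i) (z i) (p i, q i)) (L i),
      PolyTime n D (fun i => (f i).encode (encodeCochain (u i) (v i))) ∧
      ∀ i, (f i).P.length + (Nat.card (B i) - (f i).W.length) * (Nat.card (B i) + 1) <
        (P i).length + 1 + (Nat.card (B i) - (W i).length) * (Nat.card (B i) + 1) := by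
  -- The search looks for a member of `W` with the same value as `x`. Success leads to
  -- `ElimInv.found`, failure to `ElimInv.new`.
  obtain ⟨o, ho, ho'⟩ := hW.find_some (Y := fun i => G i → B i)
    (eY := fun i => encodeCochain (u i) (v i))
    (P := fun i w y => y = x i / w ∧ boundaryAt (B i) (z i) (p i, q i) (x i / w) = 1)
    (N := fun i w => boundaryAt (B i) (z i) (p i, q i) (x i / w) ≠ 1)
    (fun D' w hy => by
      classical
      have hd := (T.extend w).cochain_div (T'.extend w) (w hx) hy
      have ht := (T.extend w).boundaryAt_eq_one (T'.extend w) (w hz) (w hp) (w hq) hd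
      refine ⟨fun j => if boundaryAt (B j.i) (z j.i) (p j.i, q j.i) (x j.i / j.x) = 1
        then some (x j.i / j.x) else none,
        (ht.ite (hd.cons hd.nil) hd.nil).congr fun j => ?_, fun j => ?_⟩
      · dsimp only; split_ifs <;> rfl
      · dsimp only
        split_ifs with hb
        exacts [⟨rfl, hb⟩, hb])
  refine ho.option_cases (S := fun i => ElimState (boundaryAt (B i) (z i) (p i, q i)) (L i))
    (eS := fun i s => s.encode (encodeCochain (u i) (v i)))
    (P := fun i s => s.P.length + (Nat.card (B i) - s.W.length) * (Nat.card (B i) + 1) <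
        (P i).length + 1 + (Nat.card (B i) - (W i).length) * (Nat.card (B i) + 1)) ?_ ?_
  · intro D' w
    have hxW : PolyTime n D fun i => .ofList ((x i :: W i).map (encodeCochain (u i) (v i))) :=
      hx.cons hW
    have hxs := hxW.rev_map (g := fun i y => encodeCochain (u i) (v i) (x i * y)) fun D' w hy =>
      (T.extend w).cochain_mul (T'.extend w) (w hx) hy
    have hn (i : {i // o i = none}) := (inv i.1).new (by
      have := ho' i.1
      rw [i.2] at this
      exact this)
    refine ⟨fun i => ⟨_, _, _, hn i⟩, (w (hxW.cons ((hxs.rev_append hP).cons hO))).congr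
      fun i => ?_, fun i => ?_⟩
    · simp [ElimState.encode, Function.comp_def]
    · have := (hn i).measure_new_lt (P i.1).length
      simp only [List.length_append, List.length_map, List.length_cons]
      omega
  · intro D' w hy
    have hn (j : Σ i, {y // o i = some y}) :
        ElimInv (boundaryAt (B j.1) (z j.1) (p j.1, q j.1)) (L j.1) (W j.1) (P j.1)
          (j.2.1 :: O j.1) := by
      have := ho' j.1
      rw [j.2.2] at this
      obtain ⟨y, hy, e, hy'⟩ := this
      rw [e]
      exact (inv j.1).found hy hy'
    refine ⟨fun j => ⟨_, _, _, hn j⟩, (w hW).cons ((w hP).cons (hy.cons (w hO))), fun j => ?_⟩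
    simp

theorem eliminate (T : GroupTables n D u) (T' : GroupTables n D v) {z : ∀ i, G i → H i}
    (hz : PolyTime n D fun i => encodeMap (u i).grp (v i).grp (z i)) {p q : ∀ i, G i}
    (hp : PolyTime n D fun i => .ofElem (u i).grp (p i))
    (hq : PolyTime n D fun i => .ofElem (u i).grp (q i)) {L : ∀ i, List (G i → B i)}
    (hL : PolyTime n D fun i => .ofList ((L i).map (encodeCochain (u i) (v i)))) :
    ∃ W O : ∀ i, List (G i → B i),
      PolyTime n D (fun i => .ofList ((W i).map (encodeCochain (u i) (v i)))) ∧
      PolyTime n D (fun i => .ofList ((O i).map (encodeCochain (u i) (v i)))) ∧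
      ∀ i, ElimInv (boundaryAt (B i) (z i) (p i, q i)) (L i) (W i) [] (O i) := by
  let N (i : ι) : ℕ := (L i).length + 1 + Nat.card (B i) * (Nat.card (B i) + 1)
  have hN : PolyBdd n N := by
    refine ((hL.bdd.mono fun i => ?_).add (.const n 1)).add
      (T'.polyBdd_card_sub.mul (T'.polyBdd_card_sub.add (.const n 1)))
    simpa using Val.length_le_size_ofList ((L i).map (encodeCochain (u i) (v i)))
  -- `V` bounds the size of one table, and `N` the length of each of the three lists of a state.
  let V (i : ι) : ℕ := 1 + Nat.card (G i) * (2 * Nat.card (H i) + 2)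
  have hV : PolyBdd n V := (PolyBdd.const n 1).add
    (T.polyBdd_card.mul (((PolyBdd.const n 2).mul T'.polyBdd_card).add (.const n 2)))
  have hsize (i : ι) (l : List (G i → B i)) (h : l.length ≤ N i) :
      (Val.ofList (l.map (encodeCochain (u i) (v i)))).size ≤ 1 + N i * (V i + 1) := by
    refine (Val.size_ofList_le (B := V i) fun x hx => ?_).trans ?_
    · obtain ⟨f, _, rfl⟩ := List.mem_map.1 hx
      exact Val.size_encodeMap_le _ _ _
    · rw [List.length_map]
      gcongr
  have hl : PolyBdd n fun i => 1 + N i * (V i + 1) :=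
    (PolyBdd.const n 1).add (hN.mul (hV.add (.const n 1)))
  obtain ⟨r, hr, hr'⟩ := PolyTime.while_loop (n := n) (D := D)
    (S := fun i => ElimState (boundaryAt (B i) (z i) (p i, q i)) (L i))
    (fun i s => s.encode (encodeCochain (u i) (v i)))
    (fun i s => .ofList (s.P.map (encodeCochain (u i) (v i))))
    (fun i s => s.measure) (fun i => ⟨[], 1 :: L i, [], .init _ _⟩)
    (by
      have h1 : PolyTime n D fun i => encodeCochain (u i) (v i) 1 := by
        refine PolyTime.map_of T.elems_grp fun D' w hx => ?_
        obtain ⟨b, hb, h⟩ := (w T'.elems_grp).find_elem (P := fun j b => b * b = b)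
          (fun D'' w' hb => (((T'.extend w).extend w').mul hb hb).elem_eq hb)
          (fun j => ⟨1, by simp⟩)
        exact hb.congr fun j => by rw [mul_eq_left.1 (h j)]; rfl
      exact hL.nil.cons ((h1.cons hL).cons hL.nil))
    ((hl.add (hl.add hl)).add (.const n 2))
    (fun i s => by
      have h1 := hsize i s.W (by have := s.inv.length_le; simp only [N]; nlinarith)
      have h2 := s.inv.length
      have h3 := hsize i s.P (by simp only [N]; omega)
      have h4 := hsize i s.O (by simp only [N]; omega)
      simp only [ElimState.encode, Val.size]
      omega)
    hN
    (fun i s => by have h2 := s.inv.length; simp only [N, ElimState.measure]; omega)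
    (fun D' w h => h.snd.fst)
    (fun D' w h => by
      have key (j : LoopIndex fun i (s : ElimState (boundaryAt (B i) (z i) (p i, q i)) (L i)) =>
          .ofList (s.P.map (encodeCochain (u i) (v i)))) : ∃ x m, j.s.P = x :: m ∧
          ElimInv (boundaryAt (B j.i) (z j.i) (p j.i, q j.i)) (L j.i) j.s.W (x :: m) j.s.O := by
        obtain ⟨x, m, hxm⟩ := List.exists_cons_of_ne_nil (l := j.s.P) fun h =>
          j.ne_nil (by rw [h]; rfl)
        exact ⟨x, m, hxm, hxm ▸ j.s.inv⟩
      choose x m hxm inv using key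
      have hx : PolyTime _ D' fun j => encodeCochain (u j.i) (v j.i) (x j) :=
        h.snd.fst.head.congr fun j => by rw [hxm]; rfl
      have hm : PolyTime _ D' fun j => .ofList ((m j).map (encodeCochain (u j.i) (v j.i))) :=
        h.snd.fst.tail.congr fun j => by rw [hxm]; rfl
      obtain ⟨f, hf, hf'⟩ := (T.extend w).eliminate_step (T'.extend w) (w hz) (w hp) (w hq)
        h.fst hx hm h.snd.snd inv
      refine ⟨f, hf, fun j => ?_⟩
      rw [ElimState.measure, ElimState.measure, hxm, List.length_cons]
      exact hf' j)
  refine ⟨fun i => (r i).W, fun i => (r i).O, hr.fst, hr.snd.snd, fun i => ?_⟩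
  have := (r i).inv
  have h := hr' i
  rw [Val.ofList_eq_nil, List.map_eq_nil_iff] at h
  rwa [h] at this

end GroupTables

/-! ### Maps over an action compatibility -/

section IsOver

variable {G H I : Type*} [Group G] [Group H] [Group I] {A : Subgroup G} {B : Subgroup H}
  {C : Subgroup I} [A.Normal]

/-- The group of maps `G → B` that are constant on the cosets of `A`. -/
def cosetConst (A : Subgroup G) (B : Subgroup H) : Subgroup (G → B) where
  carrier := {f | ∀ g h : G, (g : G ⧸ A) = h → f g = f h}
  one_mem' _ _ _ := rfl
  mul_mem' hf hf' g h e := by simp only [Pi.mul_apply, hf g h e, hf' g h e]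
  inv_mem' hf g h e := by simp only [Pi.inv_apply, hf g h e]

theorem cosetConst_mul_left {f : G → B} (hf : f ∈ cosetConst A B) (a : A) (g : G) :
    f (a * g) = f g := by
  refine hf _ _ ?_
  rw [QuotientGroup.mk_mul, (QuotientGroup.eq_one_iff _).2 a.2, one_mul]

variable [B.Normal] [C.Normal]

/-- The map `r` is equivariant along the isomorphism `x.1 : A ≃* B` and induces the isomorphism
`x.2` of the quotients. -/
structure IsOver (x : (A ≃* B) × (G ⧸ A ≃* H ⧸ B)) (r : G → H) : Prop where
  map_mul : ∀ (a : A) (g : G), r (a * g) = x.1 a * r g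
  mk_apply : ∀ g : G, (r g : H ⧸ B) = x.2 g

namespace IsOver

variable {x : (A ≃* B) × (G ⧸ A ≃* H ⧸ B)} {r s : G → H}

theorem exists_mul_of_mk_eq {g h : G} (e : (g : G ⧸ A) = h) : ∃ a : A, h = a * g :=
  ⟨⟨h * g⁻¹, by rw [← QuotientGroup.eq_one_iff, QuotientGroup.mk_mul, QuotientGroup.mk_inv, e,
    mul_inv_cancel]⟩, by simp⟩

/-- The cosets are permuted bijectively by `x.2`, and within a coset the map is a translate of the
bijection `x.1`. -/
theorem bijective (h : IsOver x r) : Function.Bijective r := by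
  refine ⟨fun g g' e => ?_, fun y => ?_⟩
  · obtain ⟨a, rfl⟩ := exists_mul_of_mk_eq (A := A) (g := g) (h := g')
      (x.2.injective (by rw [← h.mk_apply, ← h.mk_apply, e]))
    rw [h.map_mul, right_eq_mul] at e
    have : x.1 a = 1 := Subtype.ext e
    rw [map_eq_one_iff _ x.1.injective] at this
    simp [this]
  · obtain ⟨g, hg⟩ := QuotientGroup.mk_surjective (x.2.symm (y : H ⧸ B))
    obtain ⟨b, rfl⟩ := exists_mul_of_mk_eq (A := B) (g := r g) (h := y)
      (by rw [h.mk_apply, hg, MulEquiv.apply_symm_apply])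
    exact ⟨x.1.symm b * g, by rw [h.map_mul, MulEquiv.apply_symm_apply]⟩

theorem comp {y : (B ≃* C) × (H ⧸ B ≃* I ⧸ C)} {s : H → I} (hr : IsOver x r) (hs : IsOver y s) :
    IsOver (x.1.trans y.1, x.2.trans y.2) (s ∘ r) where
  map_mul a g := by simp [hr.map_mul, hs.map_mul]
  mk_apply g := by simp [hr.mk_apply, hs.mk_apply]

theorem symm {r : G ≃ H} (hr : IsOver x r) : IsOver (x.1.symm, x.2.symm) r.symm where
  map_mul a g := by
    rw [Equiv.symm_apply_eq, hr.map_mul]; simp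
  mk_apply g := by
    obtain ⟨g, rfl⟩ := r.surjective g
    rw [hr.mk_apply]; simp

theorem id : IsOver ((1 : MulAut A), (1 : MulAut (G ⧸ A))) (fun g => g) where
  map_mul _ _ := rfl
  mk_apply _ := rfl

theorem mul_inv_mem (h : IsOver x r) (g g' : G) : r (g * g') * (r g * r g')⁻¹ ∈ B := by
  rw [← QuotientGroup.eq_one_iff]
  simp [h.mk_apply]

/-- The multiplicative maps over `x`. -/
theorem exists_mulEquiv {x : (A ≃* B) × (G ⧸ A ≃* H ⧸ B)} {r : G → H} (h : IsOver x r)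
    (hr : ∀ g g', r g * r g' = r (g * g')) : ∃ φ : G ≃* H, ⇑φ = r :=
  ⟨MulEquiv.ofBijective (MonoidHom.mk' r fun g g' => (hr g g').symm) h.bijective, rfl⟩

variable [IsMulCommutative B]

theorem mul_left (h : IsOver x r) {f : G → B} (hf : f ∈ cosetConst A B) :
    IsOver x fun g => f g * r g where
  map_mul a g := by
    rw [cosetConst_mul_left hf, h.map_mul, ← mul_assoc, ← mul_assoc]
    congr 1
    exact congrArg Subtype.val (mul_comm (f g) (x.1 a))
  mk_apply g := by
    rw [QuotientGroup.mk_mul, (QuotientGroup.eq_one_iff _).2 (f g).2, one_mul, h.mk_apply]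

/-- Together with `mul_left` this makes the maps over `x` a torsor under `cosetConst A B`.
Equivariance of both maps, with `B` commutative, forces the quotient to be constant on cosets. -/
theorem exists_eq_mul (hr : IsOver x r) (hs : IsOver x s) :
    ∃ f ∈ cosetConst A B, ∀ g, s g = f g * r g := by
  have key (g : G) : ∃ b : B, s g = b * r g :=
    exists_mul_of_mk_eq (A := B) (by rw [hr.mk_apply, hs.mk_apply])
  choose f hf using key
  refine ⟨f, fun g h e => ?_, hf⟩
  obtain ⟨a, rfl⟩ := exists_mul_of_mk_eq e
  have h1 := hf (a * g)
  rw [hs.map_mul, hf, hr.map_mul, ← mul_assoc, ← mul_assoc, mul_left_inj] at h1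
  have h2 : x.1 a * f g = f (a * g) * x.1 a := Subtype.ext h1
  rw [mul_comm, mul_left_inj] at h2
  exact h2

end IsOver

/-- The result of the search for isomorphisms over `x`: either there are none, or the
isomorphisms in the list generate all of them. -/
def LiftSpec (x : (A ≃* B) × (G ⧸ A ≃* H ⧸ B)) (b : ℕ) : Option (List (G → H)) → Prop
  | none => ∀ φ : G ≃* H, ¬IsOver x φ
  | some l => (∀ r ∈ l, ∃ φ : G ≃* H, ⇑φ = r ∧ IsOver x φ) ∧
    (∃ φ : G ≃* H, ⇑φ ∈ l ∧ ∀ ψ : G ≃* H, IsOver x ψ → φ.symm.trans ψ ∈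
      Subgroup.closure {γ : MulAut H | ∃ ψ' : G ≃* H, ⇑ψ' ∈ l ∧ γ = φ.symm.trans ψ'}) ∧
    l.length ≤ b

variable [IsMulCommutative B] {x : (A ≃* B) × (G ⧸ A ≃* H ⧸ B)} {z : G → H} {b : ℕ}
  {E : List (G × G)}

theorem SolveInv.liftSpec_none (hz : IsOver x z) {b' : ℕ}
    (h : SolveInv (cosetConst A B) (boundaryAt B z) (multTarget z hz.mul_inv_mem) b E none) :
    LiftSpec x b' none := by
  intro φ hφ
  obtain ⟨f, hf, e⟩ := hz.exists_eq_mul hφ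
  obtain ⟨p, -, hp⟩ := h f hf
  rw [Ne, boundaryAt_eq_target_iff hz.mul_inv_mem, ← e, ← e, ← e, map_mul] at hp
  exact hp rfl

theorem SolveInv.liftSpec_some (hE : ∀ e, e ∈ E) (hz : IsOver x z) {m : G → B} {L : List (G → B)}
    (h : SolveInv (cosetConst A B) (boundaryAt B z) (multTarget z hz.mul_inv_mem) b E
      (some (m, L))) : LiftSpec x (b + E.length * (1 + Nat.card B * (Nat.card B + 1)) + 1)
        (some ((fun g => m g * z g) :: (L.map fun f g => f g * (m g * z g)).reverse)) := by
  obtain ⟨hm, hmE, hL, hl⟩ := h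
  have hm' := hz.mul_left hm
  have hom (f : G → B) (hf : f ∈ Subgroup.closure {f | f ∈ L}) :
      ∃ ψ : G ≃* H, ⇑ψ = (fun g => f g * (m g * z g)) ∧ IsOver x ψ := by
    obtain ⟨hf1, hf2⟩ := (hL f).1 hf
    have h1 := hm'.mul_left hf1
    obtain ⟨ψ, hψ⟩ := h1.exists_mulEquiv fun g g' => by
      have := hf2 (g, g') (hE _)
      have h2 := hmE (g, g') (hE _)
      have h3 : boundaryAt B z (g, g') (f * m) = multTarget z hz.mul_inv_mem (g, g') := by
        rw [map_mul, this, one_mul, h2]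
      rw [boundaryAt_eq_target_iff] at h3
      simpa [mul_assoc] using h3
    exact ⟨ψ, hψ, hψ ▸ h1⟩
  obtain ⟨φ, hφ⟩ := hm'.exists_mulEquiv fun g g' =>
    (boundaryAt_eq_target_iff hz.mul_inv_mem).1 (hmE (g, g') (hE _))
  have hφx : IsOver x φ := hφ ▸ hm'
  have hφ' (g : G) : m g * z g = φ g := (congrFun hφ g).symm
  simp only [hφ'] at hom ⊢
  refine ⟨?_, ⟨φ, by simp, ?_⟩, ?_⟩
  · intro r hr
    rcases List.mem_cons.1 hr with rfl | hr
    · exact ⟨φ, rfl, hφx⟩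
    · rw [List.mem_reverse, List.mem_map] at hr
      obtain ⟨f, hf, rfl⟩ := hr
      exact hom f (Subgroup.subset_closure hf)
  -- Writing `ψ_f = f * φ`, the automorphism `ψ_f ∘ φ⁻¹` is multiplicative in `f`: pulled back along
  -- `φ`, the factor contributed by `f₂` lies in `A`, and `f₁` is constant on the cosets of `A`.
  -- Thus generators of the homogeneous solutions yield generators of the group of all `ψ ∘ φ⁻¹`.
  · have hmul (f₁ f₂ : G → B) (ψ₁ ψ₂ ψ : G ≃* H) (h₁ : ∀ g, ψ₁ g = f₁ g * φ g)
        (h₂ : ∀ g, ψ₂ g = f₂ g * φ g) (h₃ : ∀ g, ψ g = (f₁ * f₂) g * φ g)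
        (hf₁ : f₁ ∈ cosetConst A B) : (φ.symm.trans ψ : MulAut H) =
          (φ.symm.trans ψ₁ : MulAut H) * (φ.symm.trans ψ₂ : MulAut H) := by
      ext y
      obtain ⟨g, rfl⟩ := φ.surjective y
      have e : φ.symm (ψ₂ g) = x.1.symm (f₂ g) * g := by
        rw [MulEquiv.symm_apply_eq, hφx.map_mul, h₂, MulEquiv.apply_symm_apply]
      simp only [MulEquiv.trans_apply, MulEquiv.symm_apply_apply, MulAut.mul_apply]
      rw [e, h₁, cosetConst_mul_left hf₁, hφx.map_mul, MulEquiv.apply_symm_apply, h₃]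
      simp [mul_assoc]
    have hone (ψ : G ≃* H) (h : ∀ g, ψ g = (1 : G → B) g * φ g) :
        (φ.symm.trans ψ : MulAut H) = 1 := by
      ext y
      simp [h]
    have key (f : G → B) (hf : f ∈ Subgroup.closure {f | f ∈ L}) :
        ∀ ψ : G ≃* H, (∀ g, ψ g = f g * φ g) → φ.symm.trans ψ ∈
          Subgroup.closure {γ : MulAut H | ∃ ψ' : G ≃* H, ⇑ψ' ∈ ⇑φ ::
            (L.map fun f g => f g * φ g).reverse ∧ γ = φ.symm.trans ψ'} := by
      induction hf using Subgroup.closure_induction with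
      | mem f hf =>
        intro ψ hψ
        refine Subgroup.subset_closure ⟨ψ, List.mem_cons_of_mem _ ?_, rfl⟩
        rw [List.mem_reverse, List.mem_map]
        exact ⟨f, hf, (funext hψ).symm⟩
      | one => intro ψ hψ; rw [hone ψ hψ]; exact one_mem _
      | mul f₁ f₂ h₁ h₂ ih₁ ih₂ =>
        intro ψ hψ
        obtain ⟨ψ₁, e₁, -⟩ := hom f₁ h₁
        obtain ⟨ψ₂, e₂, -⟩ := hom f₂ h₂
        rw [hmul f₁ f₂ ψ₁ ψ₂ ψ (congrFun e₁) (congrFun e₂) hψ ((hL _).1 h₁).1]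
        exact mul_mem (ih₁ ψ₁ (congrFun e₁)) (ih₂ ψ₂ (congrFun e₂))
      | inv f hf ih =>
        intro ψ hψ
        obtain ⟨ψ', e', -⟩ := hom f hf
        have := hmul f⁻¹ f ψ ψ' φ hψ (congrFun e') (by simp) ((hL _).1 (inv_mem hf)).1
        rw [hone φ (by simp)] at this
        rw [eq_inv_of_mul_eq_one_left this.symm]
        exact inv_mem (ih ψ' (congrFun e'))
    intro ψ hψ
    obtain ⟨f, hf, e⟩ := hφx.exists_eq_mul hψ
    refine key f ?_ ψ e
    obtain ⟨f', hf', e'⟩ := hz.exists_eq_mul hψ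
    -- Relative to `z` the isomorphism `ψ` has the cochain `f * m`. Both `f * m` and `m` solve the
    -- inhomogeneous equations, so `f` solves the homogeneous ones.
    have : f' = f * m := by
      funext g
      have h1 := e g
      rw [e', ← hφ', ← mul_assoc, mul_left_inj] at h1
      exact Subtype.ext h1
    refine (hL f).2 ⟨hf, fun p hp => ?_⟩
    have h1 : boundaryAt B z p f' = multTarget z hz.mul_inv_mem p := by
      rw [boundaryAt_eq_target_iff, ← e', ← e', ← e', map_mul]
    rwa [this, map_mul, hmE p hp, mul_eq_right] at h1
  · simp only [List.length_cons, List.length_reverse, List.length_map]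
    omega

end IsOver

/-! ### Generators of the cochains that are constant on cosets -/

section CosetDelta

variable {G H : Type*} [Group G] [Group H] {A : Subgroup G} {B : Subgroup H}

open Classical in
/-- The map with value `b` on the coset of `h` and value `1` elsewhere. -/
noncomputable def cosetDelta (A : Subgroup G) (h : G) (b : B) : G → B :=
  fun g => if (g : G ⧸ A) = h then b else 1

/-- A map that is constant on cosets is the product over all cosets of its deltas. These generators
describe the solutions before any equation is imposed. -/
theorem mem_closure_cosetDelta [Finite G] [IsMulCommutative B] {L : List (G → B)}
    (hL : ∀ f, f ∈ L ↔ ∃ h b, f = cosetDelta A h b) {f : G → B} :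
    f ∈ Subgroup.closure {f | f ∈ L} ↔ f ∈ cosetConst A B := by
  classical
  constructor
  · intro hf
    refine (Subgroup.closure_le _).2 ?_ hf
    intro f hf
    obtain ⟨h, b, rfl⟩ := (hL f).1 hf
    intro g g' e
    simp only [cosetDelta, e]
  · intro hf
    have := Fintype.ofFinite (G ⧸ A)
    have e : f = ∏ q : G ⧸ A, cosetDelta A q.out (f q.out) := by
      funext g
      rw [Finset.prod_apply]
      simp only [cosetDelta, QuotientGroup.out_eq', Finset.prod_ite_eq, Finset.mem_univ, if_true]
      exact hf _ _ (by simp)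
    rw [e]
    exact prod_mem fun q _ => Subgroup.subset_closure ((hL _).2 ⟨_, _, rfl⟩)

end CosetDelta

/-- A solution together with generators for the solutions of the homogeneous equations. -/
noncomputable def encodeSolution {G H : Type*} [Group G] [Group H] {A : Subgroup G}
    {B : Subgroup H} (u : Enumeration G A) (v : Enumeration H B)
    (s : (G → B) × List (G → B)) : Val :=
  .cons (encodeCochain u v s.1) (.ofList (s.2.map (encodeCochain u v)))

/-! ### Solving the multiplicativity equations in polynomial time -/

namespace GroupTables

variable {ι κ : Type*} {n : ι → ℕ} {D : ι → Val} {G H : ι → Type*} [∀ i, Group (G i)]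
  [∀ i, Group (H i)] {A : ∀ i, Subgroup (G i)} {B : ∀ i, Subgroup (H i)}
  {u : ∀ i, Enumeration (G i) (A i)} {v : ∀ i, Enumeration (H i) (B i)}

/-- The identity is found as the only idempotent of the group. -/
theorem one (T : GroupTables n D u) : PolyTime n D fun i => .ofElem (u i).grp 1 := by
  obtain ⟨b, hb, h⟩ := T.elems_grp.find_elem (P := fun j b => b * b = b)
    (fun D' w hb => ((T.extend w).mul hb hb).elem_eq hb) (fun j => ⟨1, by simp⟩)
  exact hb.congr fun j => by rw [mul_eq_left.1 (h j)]

theorem exists_pairs (T : GroupTables n D u) : ∃ E : ∀ i, List (G i × G i),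
    PolyTime n D (fun i => .ofList ((E i).map fun e =>
      .cons (.ofElem (u i).grp e.1) (.ofElem (u i).grp e.2))) ∧
    (∀ i e, e ∈ E i) ∧ ∀ i, (E i).length = Nat.card (G i) * Nat.card (G i) := by
  refine ⟨_, PolyTime.flat_map T.elems_grp
    (g := fun i x => ((u i).grp.elems.map fun y => (x, y)).reverse) fun D' w hx => ?_, ?_, ?_⟩
  · refine (PolyTime.rev_map (w T.elems_grp) (g := fun j y => .cons (.ofElem (u j.i).grp j.x)
      (.ofElem (u j.i).grp y)) fun D'' w' hy => (w' hx).cons hy).congr fun j => ?_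
    simp [Function.comp_def]
  · intro i e
    simp [Equiv.mem_elems]
  · intro i
    simp [List.length_flatMap, Equiv.length_elems]

theorem exists_cosetDeltas (T : GroupTables n D u) (T' : GroupTables n D v) :
    ∃ L : ∀ i, List (G i → B i),
      PolyTime n D (fun i => .ofList ((L i).map (encodeCochain (u i) (v i)))) ∧
      (∀ i f, f ∈ L i ↔ ∃ h b, f = cosetDelta (A i) h b) ∧
      ∀ i, (L i).length = Nat.card (G i) * Nat.card (B i) := by
  refine ⟨_, PolyTime.flat_map T.elems_grp
    (g := fun i h => ((v i).sub.elems.map fun b => cosetDelta (A i) h b).reverse)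
    fun D' w hh => ?_, ?_, ?_⟩
  · refine (PolyTime.rev_map (w T'.elems_sub) (g := fun j b =>
      encodeCochain (u j.i) (v j.i) (cosetDelta (A j.i) j.x b)) fun D'' w' hb => ?_).congr
        fun j => ?_
    · refine PolyTime.map_of (w' (w T.elems_grp)) fun D₃ w₃ hg => ?_
      refine PolyTime.congr (PolyTime.ite (PolyTime.elem_eq
        (PolyTime.apply (w₃ (w' (w T.proj))) hg) (PolyTime.apply (w₃ (w' (w T.proj)))
          (w₃ (w' hh)))) (PolyTime.apply (w₃ (w' (w T'.incl))) (w₃ hb))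
            (w₃ (w' (w T'.one)))) fun j => ?_
      dsimp only [cosetDelta]
      split_ifs <;> simp
    · simp [Function.comp_def]
  · intro i f
    simp [Equiv.mem_elems, eq_comm]
  · intro i
    simp [List.length_flatMap, Equiv.length_elems]

variable [∀ i, (B i).Normal] [∀ i, IsMulCommutative (B i)] [∀ i, Finite (G i)] [∀ i, Finite (H i)]

theorem solve_step (T : GroupTables n D u) (T' : GroupTables n D v) {z : ∀ i, G i → H i}
    (hz : PolyTime n D fun i => encodeMap (u i).grp (v i).grp (z i))
    (hz' : ∀ i g h, z i (g * h) * (z i g * z i h)⁻¹ ∈ B i) {E : ∀ i, List (G i × G i)}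
    {e : ∀ i, G i × G i} (he₁ : PolyTime n D fun i => .ofElem (u i).grp (e i).1)
    (he₂ : PolyTime n D fun i => .ofElem (u i).grp (e i).2) {m : ∀ i, G i → B i}
    {L : ∀ i, List (G i → B i)} (hm : PolyTime n D fun i => encodeCochain (u i) (v i) (m i))
    (hL : PolyTime n D fun i => .ofList ((L i).map (encodeCochain (u i) (v i)))) {b : ι → ℕ}
    (inv : ∀ i, SolveInv (cosetConst (A i) (B i)) (boundaryAt (B i) (z i))
      (multTarget (z i) (hz' i)) (b i) (E i) (some (m i, L i))) :
    ∃ f : ∀ i, Option ((G i → B i) × List (G i → B i)),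
      PolyTime n D (fun i => encodeOption (encodeSolution (u i) (v i)) (f i)) ∧
      ∀ i, SolveInv (cosetConst (A i) (B i)) (boundaryAt (B i) (z i))
        (multTarget (z i) (hz' i)) (b i) (E i ++ [e i]) (f i) := by
  obtain ⟨W, O, hW, hO, hWO⟩ := T.eliminate T' hz he₁ he₂ hL
  obtain ⟨o, ho, ho'⟩ := hW.find_some (Y := fun i => (G i → B i) × List (G i → B i))
    (eY := fun i => encodeSolution (u i) (v i))
    (P := fun i w y => y = (w * m i, O i) ∧
      boundaryAt (B i) (z i) (e i) (w * m i) = multTarget (z i) (hz' i) (e i))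
    (N := fun i w => boundaryAt (B i) (z i) (e i) (w * m i) ≠ multTarget (z i) (hz' i) (e i))
    (fun D' w hx => by
      classical
      have hwm := (T.extend w).cochain_mul (T'.extend w) hx (w hm)
      have h₁ := (T'.extend w).mul (cochain_apply hwm (w he₁)) ((w hz).apply (w he₁))
      have h₂ := (T'.extend w).mul (cochain_apply hwm (w he₂)) ((w hz).apply (w he₂))
      have h₃ := (T.extend w).mul (w he₁) (w he₂)
      have h₄ := (T'.extend w).mul (cochain_apply hwm h₃) ((w hz).apply h₃)
      have ht : PolyTime _ D' fun j => .ofProp (boundaryAt (B j.i) (z j.i) (e j.i)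
          (j.x * m j.i) = multTarget (z j.i) (hz' j.i) (e j.i)) :=
        ((T'.extend w).mul h₁ h₂ |>.elem_eq h₄).congr fun j => by
          rw [boundaryAt_eq_target_iff]
      refine ⟨fun j => if boundaryAt (B j.i) (z j.i) (e j.i)
          (j.x * m j.i) = multTarget (z j.i) (hz' j.i) (e j.i)
        then some (j.x * m j.i, O j.i) else none,
        (ht.ite ((hwm.cons (w hO)).cons hx.nil) hx.nil).congr fun j => ?_, fun j => ?_⟩
      · dsimp only; split_ifs <;> rfl
      · dsimp only
        split_ifs with hb
        exacts [⟨rfl, hb⟩, hb])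
  refine ⟨o, ho, fun i => ?_⟩
  have h := ho' i
  match hi : o i with
  | none =>
    rw [hi] at h
    exact (inv i).append_none (hWO i) h
  | some y =>
    rw [hi] at h
    obtain ⟨w, hw, rfl, hwe⟩ := h
    exact (inv i).append_some (hWO i) hw hwe

theorem solve (T : GroupTables n D u) (T' : GroupTables n D v) {z : ∀ i, G i → H i}
    (hz : PolyTime n D fun i => encodeMap (u i).grp (v i).grp (z i))
    (hz' : ∀ i g h, z i (g * h) * (z i g * z i h)⁻¹ ∈ B i) {E : ∀ i, List (G i × G i)}
    (hE : PolyTime n D (fun i => .ofList ((E i).map fun e =>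
      .cons (.ofElem (u i).grp e.1) (.ofElem (u i).grp e.2)))) :
    ∃ f : ∀ i, Option ((G i → B i) × List (G i → B i)),
      PolyTime n D (fun i => encodeOption (encodeSolution (u i) (v i)) (f i)) ∧
      ∀ i, SolveInv (cosetConst (A i) (B i)) (boundaryAt (B i) (z i))
        (multTarget (z i) (hz' i)) (Nat.card (G i) * Nat.card (B i)) (E i) (f i) := by
  obtain ⟨L, hL, hLmem, hLlen⟩ := T.exists_cosetDeltas T'
  have h1 : PolyTime n D fun i => encodeCochain (u i) (v i) 1 :=
    PolyTime.map_of T.elems_grp fun D' w hx => w T'.one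
  -- `N` bounds the number of generators after any number of equations, and `V` the size of one
  -- table.
  let N (i : ι) : ℕ := Nat.card (G i) * Nat.card (B i) +
    (E i).length * (1 + Nat.card (B i) * (Nat.card (B i) + 1))
  let V (i : ι) : ℕ := 1 + Nat.card (G i) * (2 * Nat.card (H i) + 2)
  have hV : PolyBdd n V := (PolyBdd.const n 1).add
    (T.polyBdd_card.mul (((PolyBdd.const n 2).mul T'.polyBdd_card).add (.const n 2)))
  have hN : PolyBdd n N := (T.polyBdd_card.mul T'.polyBdd_card_sub).add
    ((hE.bdd.mono fun i => by
      simpa using Val.length_le_size_ofList ((E i).map fun e =>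
        .cons (.ofElem (u i).grp e.1) (.ofElem (u i).grp e.2))).mul ((PolyBdd.const n 1).add
          (T'.polyBdd_card_sub.mul (T'.polyBdd_card_sub.add (.const n 1)))))
  refine hE.fold (eS := fun i => encodeOption (encodeSolution (u i) (v i)))
    (fun i E s => SolveInv (cosetConst (A i) (B i)) (boundaryAt (B i) (z i))
      (multTarget (z i) (hz' i)) (Nat.card (G i) * Nat.card (B i)) E s)
    (s₀ := fun i => some (1, L i)) ((h1.cons hL).cons h1.nil) (fun i => ?_)
    (B := fun i => V i + (1 + N i * (V i + 1)) + 3)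
    ((hV.add ((PolyBdd.const n 1).add (hN.mul (hV.add (.const n 1))))).add (.const n 3)) ?_ ?_
  · refine ⟨one_mem _, by simp, fun x => ?_, ?_⟩
    · simpa using mem_closure_cosetDelta (hLmem i)
    · rw [hLlen]; simp
  · rintro i pre (_ | ⟨m, L⟩) hpre h
    · simp [encodeOption, Val.size]
    · have h1 := Val.size_encodeMap_le (u i).grp (v i).grp fun g => (m g : H i)
      have h2 := h.2.2.2
      have h3 : (Val.ofList (L.map (encodeCochain (u i) (v i)))).size ≤ 1 + N i * (V i + 1) := by
        refine (Val.size_ofList_le (B := V i) fun x hx => ?_).trans ?_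
        · obtain ⟨f, _, rfl⟩ := List.mem_map.1 hx
          exact Val.size_encodeMap_le _ _ _
        · rw [List.length_map]
          have : L.length ≤ N i :=
            h2.trans (Nat.add_le_add_left (Nat.mul_le_mul_right _ hpre.length_le) _)
          gcongr
      simp only [encodeOption, encodeSolution, Val.size, encodeCochain, V] at *
      omega
  · intro D' w he hs
    refine hs.option_cases (P := fun j s => SolveInv (cosetConst (A j.i) (B j.i))
      (boundaryAt (B j.i) (z j.i)) (multTarget (z j.i) (hz' j.i))
        (Nat.card (G j.i) * Nat.card (B j.i)) (j.pre ++ [j.x]) s) ?_ ?_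
    · intro D'' w'
      refine ⟨fun j => none, (w' hs).nil, fun j => ?_⟩
      have := j.1.inv
      rw [j.2] at this
      exact this.none_append
    · intro D'' w' hy
      exact ((T.extend w).extend w').solve_step ((T'.extend w).extend w') (w' (w hz))
        (fun j => hz' j.1.i) (w' he).fst (w' he).snd hy.fst hy.snd fun j => by
          have := j.1.inv
          rw [j.2.2] at this
          exact this

variable [∀ i, (A i).Normal]

/-- A bound for the number of isomorphisms that `GroupTables.lift` returns. -/
def _root_.liftBound (a b : ℕ) : ℕ := a * b + a * a * (1 + b * (b + 1)) + 1

/-- The isomorphisms over `x`, given any map over `x`, up to generation. -/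
theorem lift (T : GroupTables n D u) (T' : GroupTables n D v) {z : ∀ i, G i → H i}
    (hz : PolyTime n D fun i => encodeMap (u i).grp (v i).grp (z i))
    {x : ∀ i, (A i ≃* B i) × (G i ⧸ A i ≃* H i ⧸ B i)} (hx : ∀ i, IsOver (x i) (z i)) :
    ∃ f : ∀ i, Option (List (G i → H i)),
      PolyTime n D (fun i => encodeOption (fun l => .ofList
        (l.map (encodeMap (u i).grp (v i).grp))) (f i)) ∧
      ∀ i, LiftSpec (x i) (liftBound (Nat.card (G i)) (Nat.card (B i))) (f i) := by
  obtain ⟨E, hE, hEmem, hElen⟩ := T.exists_pairs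
  obtain ⟨f, hf, hf'⟩ := T.solve T' hz (fun i => (hx i).mul_inv_mem) hE
  refine hf.option_cases (P := fun i => LiftSpec (x i) (liftBound (Nat.card (G i))
    (Nat.card (B i)))) ?_ ?_
  · intro D' w
    refine ⟨fun i => none, (w hf).nil, fun i => ?_⟩
    have := hf' i.1
    rw [i.2] at this
    exact this.liftSpec_none (hx i)
  · intro D' w hy
    have hφ : PolyTime _ D' fun j => encodeMap (u j.1).grp (v j.1).grp
        fun g => j.2.1.1 g * z j.1 g :=
      PolyTime.map_of (w T.elems_grp) fun D'' w' hg => ((T'.extend w).extend w').mul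
        (cochain_apply (w' hy.fst) hg) (PolyTime.apply (w' (w hz)) hg)
    have hl := hy.snd.rev_map (g := fun j f => encodeMap (u j.1).grp (v j.1).grp
        fun g => f g * (j.2.1.1 g * z j.1 g)) fun (D'' : MemIndex _ → Val) w' hf =>
      PolyTime.map_of (w' (w T.elems_grp)) fun D₃ w₃ hg =>
        (((T'.extend w).extend w').extend w₃).mul (cochain_apply (w₃ hf) hg)
          (PolyTime.apply (f := fun j g => (j.i.i.2.1.1 g : H j.i.i.1) * z j.i.i.1 g)
            (w₃ (w' hφ)) hg)
    refine ⟨fun j => some ((fun g => j.2.1.1 g * z j.1 g) ::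
      (j.2.1.2.map fun f g => f g * (j.2.1.1 g * z j.1 g)).reverse),
      ((hφ.cons hl).cons hφ.nil).congr fun j => ?_, fun j => ?_⟩
    · simp [encodeOption, Val.ofList, Function.comp_def]
    · have := hf' j.1
      rw [j.2.2] at this
      -- The three terms of `liftBound` count the initial deltas, the generators added by the
      -- equations for all pairs of elements, and the particular solution.
      have := this.liftSpec_some (hEmem j.1) (hx j.1)
      rwa [hElen] at this

end GroupTables

/-! ### Factor sets and the lifting of action compatibilities -/

section FactorSet

variable {G : Type*} [Group G] (A : Subgroup G)

theorem eq_of_mul_out_eq {a b : A} {q : G ⧸ A} (h : (a * q.out : G) = b * q.out) : a = b :=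
  Subtype.ext (mul_right_cancel h)

variable [A.Normal]

/-- The factor set of the extension `A → G → G ⧸ A` for the section `Quotient.out`. -/
noncomputable def factorSet (p q : G ⧸ A) : A :=
  ⟨p.out * q.out * (p * q).out⁻¹, by
    rw [← QuotientGroup.eq_one_iff]; simp⟩

/-- The component in `A` of a group element. -/
noncomputable def subgroupPart (g : G) : A :=
  ⟨g * (g : G ⧸ A).out⁻¹, by rw [← QuotientGroup.eq_one_iff]; simp⟩

theorem subgroupPart_mul_out (g : G) : subgroupPart A g * (g : G ⧸ A).out = g := by
  simp [subgroupPart]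

variable [IsMulCommutative A]

theorem coe_conjAction_mk (g : G) (a : A) : (conjAction A (g : G ⧸ A) a : G) = g * a * g⁻¹ := rfl

theorem coe_conjAction (q : G ⧸ A) (a : A) :
    (conjAction A q a : G) = q.out * a * q.out⁻¹ := by
  conv_lhs => rw [← QuotientGroup.out_eq' q]
  exact coe_conjAction_mk A _ _

/-- This is the product of two elements in the normal form given by the section, from which the
cocycle identity and the rule for `subgroupPart` follow. -/
theorem mul_out_mul_out (a b : A) (p q : G ⧸ A) : (a * p.out) * (b * q.out) =
    (a * conjAction A p b * factorSet A p q : A) * (p * q).out := by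
  simp only [Subgroup.coe_mul, coe_conjAction, factorSet]
  group

theorem subgroupPart_mul (g h : G) : subgroupPart A (g * h) = subgroupPart A g *
    conjAction A g (subgroupPart A h) * factorSet A (g : G ⧸ A) h := by
  apply eq_of_mul_out_eq A (q := ((g * h : G) : G ⧸ A))
  rw [subgroupPart_mul_out, QuotientGroup.mk_mul, ← mul_out_mul_out, subgroupPart_mul_out,
    subgroupPart_mul_out]

/-- Associativity: the product `p.out * q.out * r.out` is brought to normal form in two ways. -/
theorem factorSet_mem_twoCocycles : factorSet A ∈ twoCocycles (conjAction A) := by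
  intro p q r
  apply eq_of_mul_out_eq A (q := p * q * r)
  have h1 := mul_out_mul_out A (factorSet A p q) 1 (p * q) r
  have h2 := mul_out_mul_out A 1 (factorSet A q r) p (q * r)
  have h3 := mul_out_mul_out A 1 1 p q
  have h4 := mul_out_mul_out A 1 1 q r
  simp only [map_one, one_mul, mul_one, Subgroup.coe_one] at h1 h2 h3 h4
  rw [← h3] at h1
  rw [← h4] at h2
  rw [← h1, mul_assoc p q r, ← h2, mul_assoc]

variable {A} {Q B : Type*} [Group Q] [CommGroup B] {θ : Q →* MulAut B}

/-- The cocycle obtained from the factor set along an action compatibility. -/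
noncomputable def transportFactorSet {x : (A ≃* B) × (G ⧸ A ≃* Q)}
    (hx : x ∈ actionCompatibilities (conjAction A) θ) : twoCocycles θ :=
  ⟨fun p q => x.1 (factorSet A (x.2.symm p) (x.2.symm q)), fun p q r => by
    have h := factorSet_mem_twoCocycles A (x.2.symm p) (x.2.symm q) (x.2.symm r)
    have h' := congrArg x.1 h
    rw [map_mul, map_mul, hx, MulEquiv.apply_symm_apply] at h'
    simpa only [map_mul] using h'⟩

/-- The map that transports both components of the normal form along `x` and back along `y` fails to
be multiplicative only by the difference of the two cocycles. If that difference is the coboundary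
of `v`, multiplying by the pullback of `v` corrects it. -/
theorem exists_isOver_of_mk_eq {x y : (A ≃* B) × (G ⧸ A ≃* Q)}
    (hx : x ∈ actionCompatibilities (conjAction A) θ)
    (hy : y ∈ actionCompatibilities (conjAction A) θ)
    (h : (transportFactorSet hx : secondCohomology θ) = transportFactorSet hy) :
    ∃ φ : G ≃* G, IsOver (x.1.trans y.1.symm, x.2.trans y.2.symm) φ := by
  rw [eq_comm, QuotientGroup.eq, Subgroup.mem_subgroupOf] at h
  obtain ⟨v, hv⟩ := h
  have hsymm (q : Q) (b : B) : y.1.symm (θ q b) = conjAction A (y.2.symm q) (y.1.symm b) := by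
    rw [MulEquiv.symm_apply_eq, hy, MulEquiv.apply_symm_apply, MulEquiv.apply_symm_apply]
  have hα (q : G ⧸ A) (a : A) : y.1.symm (x.1 (conjAction A q a)) =
      conjAction A (y.2.symm (x.2 q)) (y.1.symm (x.1 a)) := by
    rw [hx, hsymm]
  have hrel (p q : G ⧸ A) : y.1.symm (x.1 (factorSet A p q)) =
      factorSet A (y.2.symm (x.2 p)) (y.2.symm (x.2 q)) * (y.1.symm (v (x.2 p)) *
        conjAction A (y.2.symm (x.2 p)) (y.1.symm (v (x.2 q))) *
          (y.1.symm (v (x.2 (p * q))))⁻¹) := by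
    have h1 := hv (x.2 p) (x.2 q)
    simp only [transportFactorSet, Subgroup.coe_mul, Subgroup.coe_inv, Pi.mul_apply,
      Pi.inv_apply, MulEquiv.symm_apply_apply, inv_mul_eq_iff_eq_mul] at h1
    rw [h1]
    simp only [map_mul, map_inv, hsymm, MulEquiv.symm_apply_apply]
  let ψ (g : G) : G := (y.1.symm (x.1 (subgroupPart A g)) * y.1.symm (v (x.2 g)) : A) *
    (y.2.symm (x.2 (g : G ⧸ A))).out
  have hψ : IsOver (x.1.trans y.1.symm, x.2.trans y.2.symm) ψ := by
    refine ⟨fun a g => ?_, fun g => ?_⟩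
    · have e : ((a * g : G) : G ⧸ A) = g := by
        rw [QuotientGroup.mk_mul, (QuotientGroup.eq_one_iff _).2 a.2, one_mul]
      have e' : subgroupPart A (a * g) = a * subgroupPart A g := by
        apply Subtype.ext
        simp only [subgroupPart, e, Subgroup.coe_mul, mul_assoc]
      simp only [ψ, e, e', map_mul, MulEquiv.trans_apply, Subgroup.coe_mul, mul_assoc]
    · simp only [ψ, QuotientGroup.mk_mul, (QuotientGroup.eq_one_iff _).2 (Subtype.prop _), one_mul,
        QuotientGroup.out_eq', MulEquiv.trans_apply]
  obtain ⟨φ, hφ⟩ := hψ.exists_mulEquiv fun g h => by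
    simp only [ψ]
    rw [mul_out_mul_out, QuotientGroup.mk_mul, map_mul, map_mul]
    congr 2
    rotate_left
    · rw [map_mul]
    rw [subgroupPart_mul, map_mul, map_mul, map_mul, map_mul, hα, hrel, map_mul]
    apply Additive.ofMul.injective
    simp only [ofMul_mul, ofMul_inv]
    abel
  exact ⟨φ, hφ ▸ hψ⟩

/-- Compatibilities that represent different cosets of the liftable ones are no more numerous than
cohomology classes. -/
theorem length_le_card_secondCohomology [Finite (secondCohomology θ)]
    {w : (A ≃* B) × (G ⧸ A ≃* Q)} (hw : w ∈ actionCompatibilities (conjAction A) θ)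
    {R : List (MulAut A × MulAut (G ⧸ A))}
    (hR : ∀ r ∈ R, r ∈ actionCompatibilities (conjAction A) (conjAction A))
    (h : R.Pairwise fun y r => ∀ φ : MulAut G, ¬IsOver (y * r⁻¹) φ) :
    R.length ≤ Nat.card (secondCohomology θ) := by
  classical
  -- The class attached to `r` is that of the factor set transported along `r⁻¹` followed by `w`. If
  -- `y` and `r` had the same class, `y * r⁻¹` would lift.
  have hc (r : {r // r ∈ R}) : ((r.1.1.symm.trans w.1, r.1.2.symm.trans w.2) :
      (A ≃* B) × (G ⧸ A ≃* Q)) ∈ actionCompatibilities (conjAction A) θ := by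
    intro q a
    have h1 := hR r r.2 (r.1.2.symm q) (r.1.1.symm a)
    rw [MulEquiv.apply_symm_apply, MulEquiv.apply_symm_apply] at h1
    simp only [MulEquiv.trans_apply]
    rw [← h1, MulEquiv.symm_apply_apply, hw]
  have := Fintype.ofFinite (secondCohomology θ)
  rw [← List.length_attach, Nat.card_eq_fintype_card, ← List.length_map
    (f := fun r : {r // r ∈ R} => (transportFactorSet (hc r) : secondCohomology θ))]
  refine List.Nodup.length_le_card ?_
  rw [List.Nodup, List.pairwise_map]
  have h' : R.attach.Pairwise fun y r => ∀ φ : MulAut G, ¬IsOver (y.1 * r.1⁻¹) φ := by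
    rw [← List.pairwise_map (f := Subtype.val)
      (R := fun y r => ∀ φ : MulAut G, ¬IsOver (y * r⁻¹) φ)]
    rwa [List.attach_map_subtype_val]
  refine h'.imp fun {y r} hyr e => ?_
  obtain ⟨φ, hφ⟩ := exists_isOver_of_mk_eq (hc r) (hc y) e.symm
  refine hyr φ ?_
  convert hφ using 1
  refine Prod.ext (MulEquiv.ext fun a => ?_) (MulEquiv.ext fun a => ?_)
  · exact (congrArg y.1.1 (w.1.symm_apply_apply _)).symm
  · exact (congrArg y.1.2 (w.2.symm_apply_apply _)).symm

end FactorSet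

/-! ### Enumeration of cosets and Schreier generators -/

section Orbit

variable {Γ U : Type*} [Group Γ] [Group U]

/-- The invariant of the enumeration of the cosets of the projection of `K` to `Γ` in the group
generated by `S`: `R` are coset representatives, `H` contains the Schreier generators found, and
the elements of `P` are yet to be dealt with. -/
structure OrbitInv (K : Subgroup (Γ × U)) (S R P : List Γ) (H : Subgroup U) : Prop where
  mem_R : ∀ r ∈ R, r ∈ Subgroup.closure {s | s ∈ S}
  mem_P : ∀ r ∈ P, r ∈ Subgroup.closure {s | s ∈ S}
  pairwise : R.Pairwise fun y r => ∀ φ, (y * r⁻¹, φ) ∉ K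
  one : 1 ∈ P ∨ ∃ r ∈ R, (∃ φ, (1 * r⁻¹, φ) ∈ K) ∧ ∀ φ, (1 * r⁻¹, φ) ∈ K → φ ∈ H
  mul : ∀ x ∈ R, ∀ s ∈ S, x * s ∈ P ∨
    ∃ r ∈ R, (∃ φ, (x * s * r⁻¹, φ) ∈ K) ∧ ∀ φ, (x * s * r⁻¹, φ) ∈ K → φ ∈ H

namespace OrbitInv

variable {K : Subgroup (Γ × U)} {S R P : List Γ} {H H' : Subgroup U} {y : Γ}

theorem init (K : Subgroup (Γ × U)) (S : List Γ) (H : Subgroup U) : OrbitInv K S [] [1] H where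
  mem_R := by simp
  mem_P := by simp
  pairwise := by simp
  one := by simp
  mul := by simp

theorem found (h : OrbitInv K S R (y :: P) H) (hH : H ≤ H')
    (hy : ∃ r ∈ R, (∃ φ, (y * r⁻¹, φ) ∈ K) ∧ ∀ φ, (y * r⁻¹, φ) ∈ K → φ ∈ H') :
    OrbitInv K S R P H' := by
  have key (x : Γ) (hx : x ∈ y :: P ∨ ∃ r ∈ R, (∃ φ, (x * r⁻¹, φ) ∈ K) ∧
      ∀ φ, (x * r⁻¹, φ) ∈ K → φ ∈ H) : x ∈ P ∨ ∃ r ∈ R, (∃ φ, (x * r⁻¹, φ) ∈ K) ∧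
      ∀ φ, (x * r⁻¹, φ) ∈ K → φ ∈ H' := by
    rcases hx with hx | ⟨r, hr, h1, h2⟩
    · rcases List.mem_cons.1 hx with rfl | hx
      exacts [.inr hy, .inl hx]
    · exact .inr ⟨r, hr, h1, fun φ hφ => hH (h2 φ hφ)⟩
  exact ⟨h.mem_R, fun r hr => h.mem_P r (List.mem_cons_of_mem _ hr), h.pairwise, key _ h.one,
    fun x hx s hs => key _ (h.mul x hx s hs)⟩

/-- The element `y` stays pending. When it comes up again it is matched with a representative, and
the lifts of the quotient are collected; for `y = 1` these are the lifts of the identity. -/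
theorem new (h : OrbitInv K S R (y :: P) H) (hy : ∀ r ∈ R, ∀ φ, (y * r⁻¹, φ) ∉ K) :
    OrbitInv K S (y :: R) (y :: (S.map (y * ·) ++ P)) H := by
  have hyS := h.mem_P y (by simp)
  have key (x : Γ) (hx : x ∈ y :: P ∨ ∃ r ∈ R, (∃ φ, (x * r⁻¹, φ) ∈ K) ∧
      ∀ φ, (x * r⁻¹, φ) ∈ K → φ ∈ H) : x ∈ y :: (S.map (y * ·) ++ P) ∨
      ∃ r ∈ y :: R, (∃ φ, (x * r⁻¹, φ) ∈ K) ∧ ∀ φ, (x * r⁻¹, φ) ∈ K → φ ∈ H := by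
    rcases hx with hx | ⟨r, hr, h⟩
    · rcases List.mem_cons.1 hx with rfl | hx
      · exact .inl (by simp)
      · exact .inl (by simp [hx])
    · exact .inr ⟨r, List.mem_cons_of_mem _ hr, h⟩
  refine ⟨?_, ?_, List.pairwise_cons.2 ⟨hy, h.pairwise⟩, key _ h.one, fun x hx s hs => ?_⟩
  · intro r hr
    rcases List.mem_cons.1 hr with rfl | hr
    exacts [hyS, h.mem_R r hr]
  · intro r hr
    rcases List.mem_cons.1 hr with rfl | hr
    · exact hyS
    rcases List.mem_append.1 hr with hr | hr
    · obtain ⟨s, hs, rfl⟩ := List.mem_map.1 hr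
      exact mul_mem hyS (Subgroup.subset_closure hs)
    · exact h.mem_P r (List.mem_cons_of_mem _ hr)
  · rcases List.mem_cons.1 hx with rfl | hx
    · exact .inl (List.mem_cons_of_mem _ (List.mem_append_left _ (List.mem_map_of_mem hs)))
    · exact key _ (h.mul x hx s hs)

/-- A word in the generators is read from left to right. Each letter replaces the current
representative by another one, at the cost of a Schreier generator whose lifts lie in `H`. -/
theorem exists_mem [Finite Γ] (h : OrbitInv K S R [] H) {x : Γ}
    (hx : x ∈ Subgroup.closure {s | s ∈ S}) : ∃ r ∈ R, ∃ φ ∈ H, (x * r⁻¹, φ) ∈ K := by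
  have hmul := h.mul
  have hone := h.one
  simp only [List.not_mem_nil, false_or] at hmul hone
  have key (g : Γ) (hg : g ∈ Subgroup.closure {s | s ∈ S}) : ∀ x,
      (∃ r ∈ R, ∃ φ ∈ H, (x * r⁻¹, φ) ∈ K) → ∃ r ∈ R, ∃ φ ∈ H, (x * g * r⁻¹, φ) ∈ K := by
    induction hg using Subgroup.closure_induction with
    | mem s hs =>
      rintro x ⟨r, hr, φ, hφ, hx⟩
      obtain ⟨r', hr', ⟨ψ, hψ⟩, hall⟩ := hmul r hr s hs
      refine ⟨r', hr', φ * ψ, mul_mem hφ (hall ψ hψ), ?_⟩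
      have := mul_mem hx hψ
      rwa [Prod.mk_mul_mk, show x * r⁻¹ * (r * s * r'⁻¹) = x * s * r'⁻¹ by group] at this
    | one => simp
    | mul a b _ _ ha hb =>
      intro x hx
      rw [← mul_assoc]
      exact hb _ (ha _ hx)
    | inv a _ ha =>
      have hpow (k : ℕ) : ∀ x, (∃ r ∈ R, ∃ φ ∈ H, (x * r⁻¹, φ) ∈ K) →
          ∃ r ∈ R, ∃ φ ∈ H, (x * a ^ k * r⁻¹, φ) ∈ K := by
        induction k with
        | zero => simp
        | succ k ih => intro x hx; rw [pow_succ, ← mul_assoc]; exact ha _ (ih _ hx)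
      rw [show a⁻¹ = a ^ (orderOf a - 1) from inv_eq_of_mul_eq_one_right (by
        rw [← pow_succ', Nat.sub_add_cancel (orderOf_pos a), pow_orderOf_eq_one])]
      exact hpow _
  have := key x hx 1 (by
    obtain ⟨r, hr, ⟨φ, hφ⟩, hall⟩ := hone
    exact ⟨r, hr, φ, hall φ hφ, hφ⟩)
  simpa using this

theorem mem_of_mem [Finite Γ] (h : OrbitInv K S R [] H) {x : Γ} {φ : U}
    (hx : x ∈ Subgroup.closure {s | s ∈ S}) (hφ : (x, φ) ∈ K) : φ ∈ H := by
  have hone := h.one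
  simp only [List.not_mem_nil, false_or, one_mul] at hone
  obtain ⟨r₁, hr₁, ⟨ψ₁, hψ₁⟩, hall⟩ := hone
  obtain ⟨r, hr, ψ, hψ, hK⟩ := h.exists_mem hx
  -- Both represent the trivial coset: `x` and `x * r⁻¹` lift, and so does `r₁⁻¹`.
  have e : r = r₁ := by
    by_contra hne
    have : Std.Symm fun a b => ∀ φ, (a * b⁻¹, φ) ∉ K :=
      ⟨fun a b hab φ h => hab φ⁻¹ (by simpa using inv_mem h)⟩
    have h1 := mul_mem (mul_mem (inv_mem hK) hφ) hψ₁
    simp only [Prod.inv_mk, Prod.mk_mul_mk] at h1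
    rw [show (x * r⁻¹)⁻¹ * x * r₁⁻¹ = r * r₁⁻¹ by group] at h1
    exact h.pairwise.forall hr hr₁ hne _ h1
  rw [e] at hK
  have h1 := mul_mem (inv_mem hφ) hK
  simp only [Prod.inv_mk, Prod.mk_mul_mk, inv_mul_cancel_left] at h1
  have := mul_mem hψ (inv_mem (hall _ h1))
  simpa using this

end OrbitInv

end Orbit

/-! ### Enumerating the cosets of the liftable compatibilities -/

section OverPerm

variable {G : Type*} [Group G] (A : Subgroup G) [A.Normal]

/-- A permutation of `G` over a pair of automorphisms. -/
structure OverPerm where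
  type : MulAut A × MulAut (G ⧸ A)
  perm : Equiv.Perm G
  isOver : IsOver type perm

/-- The pairs of an automorphism and the pair of automorphisms that it induces. -/
def overSubgroup : Subgroup ((MulAut A × MulAut (G ⧸ A)) × MulAut G) where
  carrier := {p | IsOver p.1 p.2}
  one_mem' := IsOver.id
  mul_mem' {p q} (hp : IsOver p.1 p.2) (hq : IsOver q.1 q.2) := hq.comp hp
  inv_mem' {p} hp := IsOver.symm (r := p.2.toEquiv) hp

variable {A}

namespace OverPerm

/-- The identity. -/
def one : OverPerm A := ⟨1, 1, IsOver.id⟩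

/-- The composition. -/
def mul (y s : OverPerm A) : OverPerm A := ⟨y.type * s.type, y.perm * s.perm, s.isOver.comp y.isOver⟩

theorem isOver_mul_inv (y r : OverPerm A) :
    IsOver (y.type * r.type⁻¹) (y.perm ∘ r.perm.symm) :=
  r.isOver.symm.comp y.isOver

end OverPerm

/-- The group generated by the automorphisms in a list. -/
def autClosure (O : List (G → G)) : Subgroup (MulAut G) :=
  Subgroup.closure {φ : MulAut G | ⇑φ ∈ O}

theorem autClosure_mono {O O' : List (G → G)} (h : O ⊆ O') : autClosure O ≤ autClosure O' :=
  Subgroup.closure_mono fun _ hφ => h hφ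

theorem LiftSpec.mem_autClosure {x : MulAut A × MulAut (G ⧸ A)} {b : ℕ} {l : List (G → G)}
    (h : LiftSpec x b (some l)) {ψ : MulAut G} (hψ : IsOver x ψ) : ψ ∈ autClosure l := by
  obtain ⟨-, ⟨φ, hφ, hall⟩, -⟩ := h
  have hφ' : (φ : MulAut G) ∈ autClosure l := Subgroup.subset_closure hφ
  have h1 : (φ.symm.trans ψ : MulAut G) ∈ autClosure l := by
    refine (Subgroup.closure_le _).2 ?_ (hall ψ hψ)
    rintro _ ⟨ψ', hψ', rfl⟩
    exact mul_mem (Subgroup.subset_closure hψ' : (ψ' : MulAut G) ∈ autClosure l) (inv_mem hφ')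
  have h2 := mul_mem h1 hφ'
  convert h2 using 1
  ext g
  simp

/-- The states of the coset enumeration. The list `O` holds automorphisms of `G`. -/
structure OrbitState (S : List (OverPerm A)) (h b : ℕ) where
  R : List (OverPerm A)
  P : List (OverPerm A)
  O : List (G → G)
  inv : OrbitInv (overSubgroup A) (S.map OverPerm.type) (R.map OverPerm.type)
    (P.map OverPerm.type) (autClosure O)
  aut : ∀ f ∈ O, ∃ φ : MulAut G, ⇑φ = f
  length : O.length + (P.length + (h - R.length) * (S.length + 2)) * b ≤
    (1 + h * (S.length + 2)) * b

namespace OrbitState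

variable {S : List (OverPerm A)} {h b : ℕ}

/-- A bound on the number of steps that remain. -/
def measure (s : OrbitState S h b) : ℕ := s.P.length + (h - s.R.length) * (S.length + 2)

theorem measure_le (s : OrbitState S h b) (hb : 0 < b) : s.measure ≤ 1 + h * (S.length + 2) := by
  have := s.length
  exact Nat.le_of_mul_le_mul_right (by rw [measure]; omega) hb

/-- The states as trees. -/
noncomputable def encode (u : Enumeration G A) (s : OrbitState S h b) : Val :=
  .cons (.ofList (s.R.map fun r => encodeMap u.grp u.grp r.perm))
    (.cons (.ofList (s.P.map fun r => encodeMap u.grp u.grp r.perm))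
      (.ofList (s.O.map (encodeMap u.grp u.grp))))

/-- The initial state. -/
def init (S : List (OverPerm A)) (h b : ℕ) : OrbitState S h b where
  R := []
  P := [.one]
  O := []
  inv := .init _ _ _
  aut := by simp
  length := by simp

end OrbitState

end OverPerm

/-! ### Coset enumeration in polynomial time -/

namespace GroupTables

variable {ι κ : Type*} {n : ι → ℕ} {D : ι → Val} {G H : ι → Type*} [∀ i, Group (G i)]
  [∀ i, Group (H i)] {A : ∀ i, Subgroup (G i)} {B : ∀ i, Subgroup (H i)}
  {u : ∀ i, Enumeration (G i) (A i)} {v : ∀ i, Enumeration (H i) (B i)}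
  [∀ i, Finite (G i)] [∀ i, (A i).Normal] [∀ i, IsMulCommutative (A i)]

/-- The permutation `y.perm ∘ r.perm.symm` is the map over `y.type * r.type⁻¹` that `lift` needs as
a start. The types themselves are never computed. -/
theorem orbit_find (T : GroupTables n D u) {R : ∀ i, List (OverPerm (A i))}
    {y : ∀ i, OverPerm (A i)}
    (hR : PolyTime n D fun i => .ofList ((R i).map fun r => encodeMap (u i).grp (u i).grp r.perm))
    (hy : PolyTime n D fun i => encodeMap (u i).grp (u i).grp (y i).perm) :
    ∃ o : ∀ i, Option (List (G i → G i)),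
      PolyTime n D (fun i => encodeOption (fun l => .ofList
        (l.map (encodeMap (u i).grp (u i).grp))) (o i)) ∧
      ∀ i, (o i).elim (∀ r ∈ R i, ∀ φ : MulAut (G i), ¬IsOver ((y i).type * r.type⁻¹) φ)
        fun l => ∃ r ∈ R i, LiftSpec ((y i).type * r.type⁻¹)
          (liftBound (Nat.card (G i)) (Nat.card (A i))) (some l) := by
  refine hR.find_some (eY := fun i l => .ofList (l.map (encodeMap (u i).grp (u i).grp)))
    (P := fun i r l => LiftSpec ((y i).type * r.type⁻¹)
          (liftBound (Nat.card (G i)) (Nat.card (A i))) (some l))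
    (N := fun i r => ∀ φ : MulAut (G i), ¬IsOver ((y i).type * r.type⁻¹) φ) fun D' w hr => ?_
  have hz : PolyTime (fun j => n j.i) D' fun j => encodeMap (u j.i).grp (u j.i).grp
      ((y j.i).perm ∘ j.x.perm.symm) := by
    refine PolyTime.map_of (w T.elems_grp) fun D'' w' hg => ?_
    obtain ⟨b, hb, h⟩ := (w' (w T.elems_grp)).find_elem (P := fun j b => j.i.x.perm b = j.x)
      (fun D₃ w₃ hb => (PolyTime.apply (w₃ (w' hr)) hb).elem_eq (w₃ hg))
      (fun j => j.i.x.perm.surjective j.x)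
    refine (PolyTime.apply (w' (w hy)) hb).congr fun j => ?_
    rw [Function.comp_apply, ← h j, Equiv.symm_apply_apply]
  obtain ⟨f, hf, hf'⟩ := (T.extend w).lift (T.extend w) hz
    fun j => OverPerm.isOver_mul_inv (y j.i) j.x
  refine ⟨f, hf, fun j => ?_⟩
  have := hf' j
  match hj : f j with
  | none => rw [hj] at this; exact this
  | some l => rw [hj] at this; exact this

theorem orbit_step (T : GroupTables n D u) {S R P : ∀ i, List (OverPerm (A i))}
    {y : ∀ i, OverPerm (A i)} {O : ∀ i, List (G i → G i)} {h : ι → ℕ}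
    (hS : PolyTime n D fun i => .ofList ((S i).map fun r => encodeMap (u i).grp (u i).grp r.perm))
    (hR : PolyTime n D fun i => .ofList ((R i).map fun r => encodeMap (u i).grp (u i).grp r.perm))
    (hP : PolyTime n D fun i => .ofList ((P i).map fun r => encodeMap (u i).grp (u i).grp r.perm))
    (hy : PolyTime n D fun i => encodeMap (u i).grp (u i).grp (y i).perm)
    (hO : PolyTime n D fun i => .ofList ((O i).map (encodeMap (u i).grp (u i).grp)))
    (hh : ∀ i (R : List (MulAut (A i) × MulAut (G i ⧸ A i))),
      (∀ r ∈ R, r ∈ Subgroup.closure {s | s ∈ (S i).map OverPerm.type}) →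
      (R.Pairwise fun y r => ∀ φ : MulAut (G i), ¬IsOver (y * r⁻¹) φ) → R.length ≤ h i)
    (inv : ∀ i, OrbitInv (overSubgroup (A i)) ((S i).map OverPerm.type) ((R i).map OverPerm.type)
      ((y i).type :: (P i).map OverPerm.type) (autClosure (O i)))
    (aut : ∀ i, ∀ f ∈ O i, ∃ φ : MulAut (G i), ⇑φ = f)
    (length : ∀ i, (O i).length + ((P i).length + 1 + (h i - (R i).length) * ((S i).length + 2)) *
      liftBound (Nat.card (G i)) (Nat.card (A i)) ≤
        (1 + h i * ((S i).length + 2)) * liftBound (Nat.card (G i)) (Nat.card (A i))) :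
    ∃ f : ∀ i, OrbitState (S i) (h i) (liftBound (Nat.card (G i)) (Nat.card (A i))),
      PolyTime n D (fun i => (f i).encode (u i)) ∧
      ∀ i, (f i).measure < (P i).length + 1 + (h i - (R i).length) * ((S i).length + 2) := by
  obtain ⟨o, ho, ho'⟩ := T.orbit_find hR hy
  refine ho.option_cases (eS := fun i s => s.encode (u i))
    (S := fun i => OrbitState (S i) (h i) (liftBound (Nat.card (G i)) (Nat.card (A i))))
    (P := fun i s => s.measure < (P i).length + 1 +
      (h i - (R i).length) * ((S i).length + 2)) ?_ ?_
  · intro D' w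
    have hSy := hS.rev_map (g := fun i s => encodeMap (u i).grp (u i).grp ((y i).mul s).perm)
      fun D' w hs => PolyTime.map_of (w T.elems_grp) fun D'' w' hg =>
        PolyTime.congr (PolyTime.apply (w' (w hy)) (PolyTime.apply (w' hs) hg)) fun j => rfl
    have hn (i : {i // o i = none}) := (inv i.1).new (by
      have := ho' i.1
      rw [i.2] at this
      intro r hr
      obtain ⟨r, hr', rfl⟩ := List.mem_map.1 hr
      exact this r hr')
    -- The new pending products are paid for by the `(S i).length + 2` units released when `R`
    -- grows. By `hh` there is room for one more representative, so the subtraction is not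
    -- truncated.
    have hlt (i : {i // o i = none}) : (P i.1).length + 1 + (S i.1).length +
        (h i - ((R i).length + 1)) * ((S i).length + 2) <
        (P i.1).length + 1 + (h i - (R i).length) * ((S i).length + 2) := by
      have h1 := hh i.1 _ (hn i).mem_R (hn i).pairwise
      rw [List.length_cons, List.length_map] at h1
      obtain ⟨c, hc⟩ := Nat.exists_eq_add_of_le h1
      rw [show h i - ((R i).length + 1) = c by omega, show h i - (R i).length = c + 1 by omega,
        add_mul c 1]
      omega
    refine ⟨fun i => ⟨y i :: R i, y i :: ((S i).map (y i).mul ++ P i), O i, ?_, aut i, ?_⟩,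
      (w ((hy.cons hR).cons ((hy.cons (hSy.rev_append hP)).cons hO))).congr fun i => ?_,
      fun i => ?_⟩
    · have := hn i
      rw [List.map_map] at this
      rw [List.map_cons, List.map_cons, List.map_append, List.map_map]
      exact this
    · refine le_trans (Nat.add_le_add_left (Nat.mul_le_mul_right _ ?_) _) (length i)
      have := hlt i
      simp only [List.length_cons, List.length_append, List.length_map]
      omega
    · simp [OrbitState.encode, Val.ofList, Function.comp_def]
    · have := hlt i
      simp only [OrbitState.measure, List.length_cons, List.length_append, List.length_map]
      omega
  · intro D' w hl
    have hspec (j : Σ i, {l // o i = some l}) : ∃ r ∈ R j.1,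
        LiftSpec ((y j.1).type * r.type⁻¹) (liftBound (Nat.card (G j.1)) (Nat.card (A j.1)))
          (some j.2.1) := by
      have := ho' j.1
      rwa [j.2.2] at this
    refine ⟨fun j => ⟨R j.1, P j.1, j.2.1.reverse ++ O j.1, ?_, ?_, ?_⟩,
      ((w hR).cons ((w hP).cons (hl.rev_append (w hO)))).congr fun j => ?_, fun j => ?_⟩
    · obtain ⟨r, hr, hs⟩ := hspec j
      refine (inv j.1).found (autClosure_mono (List.subset_append_right _ _))
        ⟨r.type, List.mem_map_of_mem hr, ?_, fun φ hφ => ?_⟩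
      · obtain ⟨φ, hφ, -⟩ := hs.2.1
        obtain ⟨φ', hφ', hov⟩ := hs.1 _ hφ
        exact ⟨φ', hov⟩
      · exact autClosure_mono (fun f hf => by simp [hf]) (hs.mem_autClosure hφ)
    · intro f hf
      rcases List.mem_append.1 hf with hf | hf
      · obtain ⟨r, hr, hs⟩ := hspec j
        obtain ⟨φ, hφ, -⟩ := hs.1 f (List.mem_reverse.1 hf)
        exact ⟨φ, hφ⟩
      · exact aut j.1 f hf
    · obtain ⟨r, hr, hs⟩ := hspec j
      have h1 := hs.2.2
      have h2 := length j.1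
      rw [add_right_comm, add_mul _ 1, one_mul] at h2
      rw [List.length_append, List.length_reverse]
      omega
    · simp [OrbitState.encode]
    · simp only [OrbitState.measure]
      omega

/-- The group generated by `S` may be exponentially large, but `hh` limits the number of cosets met,
and the enumeration ends after at most `1 + h * (S.length + 2)` rounds. -/
theorem orbit (T : GroupTables n D u) {S : ∀ i, List (OverPerm (A i))} {h : ι → ℕ}
    (hS : PolyTime n D fun i => .ofList ((S i).map fun r => encodeMap (u i).grp (u i).grp r.perm))
    (hbdd : PolyBdd n h)
    (hh : ∀ i (R : List (MulAut (A i) × MulAut (G i ⧸ A i))),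
      (∀ r ∈ R, r ∈ Subgroup.closure {s | s ∈ (S i).map OverPerm.type}) →
      (R.Pairwise fun y r => ∀ φ : MulAut (G i), ¬IsOver (y * r⁻¹) φ) → R.length ≤ h i) :
    ∃ (R : ∀ i, List (OverPerm (A i))) (O : ∀ i, List (G i → G i)),
      PolyTime n D (fun i => .ofList ((R i).map fun r =>
        encodeMap (u i).grp (u i).grp r.perm)) ∧
      PolyTime n D (fun i => .ofList ((O i).map (encodeMap (u i).grp (u i).grp))) ∧
      (∀ i, OrbitInv (overSubgroup (A i)) ((S i).map OverPerm.type) ((R i).map OverPerm.type)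
        [] (autClosure (O i))) ∧ ∀ i, ∀ f ∈ O i, ∃ φ : MulAut (G i), ⇑φ = f := by
  let b (i : ι) : ℕ := liftBound (Nat.card (G i)) (Nat.card (A i))
  have hb0 (i : ι) : 0 < b i := Nat.succ_pos _
  have hb : PolyBdd n b := ((T.polyBdd_card.mul T.polyBdd_card_sub).add
    ((T.polyBdd_card.mul T.polyBdd_card).mul ((PolyBdd.const n 1).add
      (T.polyBdd_card_sub.mul (T.polyBdd_card_sub.add (.const n 1)))))).add (.const n 1)
  have hSl : PolyBdd n fun i => (S i).length := hS.bdd.mono fun i => by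
    simpa using Val.length_le_size_ofList ((S i).map fun r =>
      encodeMap (u i).grp (u i).grp r.perm)
  let M (i : ι) : ℕ := 1 + h i * ((S i).length + 2)
  have hM : PolyBdd n M := (PolyBdd.const n 1).add (hbdd.mul (hSl.add (.const n 2)))
  let V (i : ι) : ℕ := 1 + Nat.card (G i) * (2 * Nat.card (G i) + 2)
  have hV : PolyBdd n V := (PolyBdd.const n 1).add
    (T.polyBdd_card.mul (((PolyBdd.const n 2).mul T.polyBdd_card).add (.const n 2)))
  have hsize (i : ι) {X : Type _} (f : X → G i → G i) (l : List X) (k : ℕ) (h : l.length ≤ k) :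
      (Val.ofList (l.map fun x => encodeMap (u i).grp (u i).grp (f x))).size ≤
        1 + k * (V i + 1) := by
    refine (Val.size_ofList_le (B := V i) fun x hx => ?_).trans ?_
    · obtain ⟨f, _, rfl⟩ := List.mem_map.1 hx
      exact Val.size_encodeMap_le _ _ _
    · rw [List.length_map]
      gcongr
  have hl {f : ι → ℕ} (hf : PolyBdd n f) : PolyBdd n fun i => 1 + f i * (V i + 1) :=
    (PolyBdd.const n 1).add (hf.mul (hV.add (.const n 1)))
  obtain ⟨r, hr, hr'⟩ := PolyTime.while_loop (n := n) (D := D)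
    (S := fun i => OrbitState (S i) (h i) (b i)) (fun i s => s.encode (u i))
    (fun i s => .ofList (s.P.map fun r => encodeMap (u i).grp (u i).grp r.perm))
    (fun i s => s.measure) (fun i => .init _ _ _)
    (by
      have h1 : PolyTime n D fun i => encodeMap (u i).grp (u i).grp
          (OverPerm.one (A := A i)).perm :=
        PolyTime.map_of T.elems_grp fun D' w hx => hx.congr fun j => rfl
      exact hS.nil.cons ((h1.cons hS.nil).cons hS.nil))
    (((hl hbdd).add ((hl hM).add (hl (hM.mul hb)))).add (.const n 2))
    (fun i s => by
      have h0 := s.measure_le (hb0 i)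
      rw [OrbitState.measure] at h0
      have h1 := hsize i (fun r : OverPerm (A i) => ⇑r.perm) s.R (h i) (by
        simpa using hh i _ s.inv.mem_R s.inv.pairwise)
      have h2 := hsize i (fun r : OverPerm (A i) => ⇑r.perm) s.P (M i) (by
        simp only [M]; omega)
      have h3 : (Val.ofList (s.O.map (encodeMap (u i).grp (u i).grp))).size ≤ _ :=
        hsize i (fun f : G i → G i => f) s.O (M i * b i) (le_trans (Nat.le_add_right _ _) s.length)
      simp only [OrbitState.encode, Val.size] at *
      omega)
    hM (fun i s => s.measure_le (hb0 i)) (fun D' w hs => hs.snd.fst)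
    (fun D' w hs => by
      have key (j : LoopIndex fun i (s : OrbitState (S i) (h i) (b i)) =>
          .ofList (s.P.map fun r => encodeMap (u i).grp (u i).grp r.perm)) :
          ∃ y P, j.s.P = y :: P ∧ OrbitInv (overSubgroup (A j.i)) ((S j.i).map OverPerm.type)
            (j.s.R.map OverPerm.type) (y.type :: P.map OverPerm.type) (autClosure j.s.O) ∧
            j.s.O.length + (P.length + 1 + (h j.i - j.s.R.length) * ((S j.i).length + 2)) *
              b j.i ≤ (1 + h j.i * ((S j.i).length + 2)) * b j.i := by
        obtain ⟨y, P, hP⟩ := List.exists_cons_of_ne_nil (l := j.s.P) fun h =>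
          j.ne_nil (by rw [h]; rfl)
        refine ⟨y, P, hP, ?_, ?_⟩
        · simpa only [hP, List.map_cons] using j.s.inv
        · simpa only [hP, List.length_cons] using j.s.length
      choose y P hP inv length using key
      obtain ⟨f, hf, hf'⟩ := (T.extend w).orbit_step (w hS) hs.fst
        (hs.snd.fst.tail.congr fun j => by rw [hP]; rfl)
        (hs.snd.fst.head.congr fun j => by rw [hP]; rfl) hs.snd.snd
        (fun j => hh j.i) inv (fun j => j.s.aut) length
      refine ⟨f, hf, fun j => ?_⟩
      rw [OrbitState.measure.eq_1 j.s, hP, List.length_cons]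
      exact hf' j)
  refine ⟨fun i => (r i).R, fun i => (r i).O, hr.fst, hr.snd.snd, fun i => ?_,
    fun i => (r i).aut⟩
  have := (r i).inv
  have h := hr' i
  rw [Val.ofList_eq_nil, List.map_eq_nil_iff] at h
  rwa [h] at this

end GroupTables

/-! ### Maps over pairs of isomorphisms -/

theorem PolyTime.exists_list {ι : Type*} {n : ι → ℕ} {D : ι → Val} {X Y : ι → Type*}
    {eX : ∀ i, X i → Val} {eY : ∀ i, Y i → Val} {l : ∀ i, List (X i)}
    (hl : PolyTime n D fun i => .ofList ((l i).map (eX i))) {P : ∀ i, X i → Y i → Prop}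
    (hg : ∀ D' : MemIndex l → Val, Extends n D MemIndex.i D' →
      PolyTime (fun j => n j.i) D' (fun j => eX j.i j.x) → ∃ y : ∀ j : MemIndex l, Y j.i,
        PolyTime (fun j => n j.i) D' (fun j => eY j.i (y j)) ∧ ∀ j, P j.i j.x (y j)) :
    ∃ m : ∀ i, List (Y i), PolyTime n D (fun i => .ofList ((m i).map (eY i))) ∧
      ∀ i, (∀ x ∈ l i, ∃ y ∈ m i, P i x y) ∧ ∀ y ∈ m i, ∃ x ∈ l i, P i x y := by
  classical
  obtain ⟨y, hy, hP⟩ := hg _ hl.mem_extends hl.mem_context.fst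
  refine ⟨fun i => ((l i).attach.map fun x => y ⟨i, x.1, x.2⟩).reverse, ?_, fun i => ⟨?_, ?_⟩⟩
  · refine (hl.rev_map (g := fun i x => if h : x ∈ l i then eY i (y ⟨i, x, h⟩) else .nil)
      fun D' w hx => ?_).congr fun i => ?_
    · refine ((hx.cons (w hl.id_of)).trans hy).congr fun j => ?_
      rw [dif_pos j.mem]
    · rw [List.map_reverse, List.map_map]
      congr 2
      exact List.ext_getElem (by simp) fun k h h' => by simp
  · intro x hx
    exact ⟨y ⟨i, x, hx⟩, by simpa using ⟨x, hx, rfl⟩, hP ⟨i, x, hx⟩⟩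
  · intro y' hy'
    simp only [List.mem_reverse, List.mem_map, List.mem_attach, true_and] at hy'
    obtain ⟨x, rfl⟩ := hy'
    exact ⟨x.1, x.2, hP ⟨i, x.1, x.2⟩⟩

namespace GroupTables

variable {ι κ : Type*} {n : ι → ℕ} {D : ι → Val} {G H : ι → Type*} [∀ i, Group (G i)]
  [∀ i, Group (H i)] {A : ∀ i, Subgroup (G i)} {B : ∀ i, Subgroup (H i)}
  {u : ∀ i, Enumeration (G i) (A i)} {v : ∀ i, Enumeration (H i) (B i)}

theorem of_encode (h : PolyTime n D fun i => (u i).encode)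
    (hq : PolyTime n D fun i => .ofElems (u i).quo) : GroupTables n D u where
  cayley := h.fst
  incl := h.snd.fst
  proj := h.snd.snd
  elems_grp := PolyTime.elems h.fst fun _ => List.length_ofFn
  elems_sub := PolyTime.elems h.snd.fst fun _ => List.length_ofFn
  elems_quo := hq

theorem exists_section (T : GroupTables n D u) : ∃ σ : ∀ i, G i ⧸ A i → G i,
    PolyTime n D (fun i => encodeMap (u i).quo (u i).grp (σ i)) ∧
      ∀ i q, (σ i q : G i ⧸ A i) = q :=
  PolyTime.build_map T.elems_quo (P := fun i q (g : G i) => (g : G i ⧸ A i) = q) fun _ w hq =>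
    (w T.elems_grp).find_elem (P := fun j (g : G j.i) => (g : G j.i ⧸ A j.i) = j.x)
      (fun _ w' hg => (PolyTime.apply (w' (w T.proj)) hg).elem_eq (w' hq))
      fun j => QuotientGroup.mk_surjective j.x

variable [∀ i, (A i).Normal] [∀ i, (B i).Normal]

/-- With sections `σ` and `τ` of the projections, `a * σ q` is sent to `x.1 a * τ (x.2 q)`. -/
theorem exists_isOver (T : GroupTables n D u) (T' : GroupTables n D v)
    {x : ∀ i, (A i ≃* B i) × (G i ⧸ A i ≃* H i ⧸ B i)}
    (hx : PolyTime n D fun i => .cons (encodeMap (u i).sub (v i).sub (x i).1)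
      (encodeMap (u i).quo (v i).quo (x i).2)) :
    ∃ z : ∀ i, G i → H i, PolyTime n D (fun i => encodeMap (u i).grp (v i).grp (z i)) ∧
      ∀ i, IsOver (x i) (z i) := by
  obtain ⟨σ, hσ, hσ'⟩ := T.exists_section
  obtain ⟨τ, hτ, hτ'⟩ := T'.exists_section
  obtain ⟨z, hz, hz'⟩ := PolyTime.build_map (uY := fun i => (v i).grp) T.elems_grp
    (P := fun i g h => ∃ a : A i, (a : G i) * σ i g = g ∧
      h = (x i).1 a * τ i ((x i).2 g)) fun D' w hg => by
    have hq := PolyTime.apply (w T.proj) hg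
    obtain ⟨a, ha, ha'⟩ := (w T.elems_sub).find_elem (P := fun j a => (a : G j.i) * σ j.i j.x = j.x)
      (fun D'' w' ha => ((T.extend w).extend w').mul (PolyTime.apply (w' (w T.incl)) ha)
        (PolyTime.apply (w' (w hσ)) (w' hq)) |>.elem_eq (w' hg))
      (fun j => by
        obtain ⟨a, ha⟩ := IsOver.exists_mul_of_mk_eq (hσ' j.i j.x)
        exact ⟨a, ha.symm⟩)
    exact ⟨_, (T'.extend w).mul (PolyTime.apply (w T'.incl) (PolyTime.apply (w hx.fst) ha))
      (PolyTime.apply (w hτ) (PolyTime.apply (w hx.snd) hq)), fun j => ⟨a j, ha' j, rfl⟩⟩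
  refine ⟨z, hz, fun i => ⟨fun a g => ?_, fun g => ?_⟩⟩
  · obtain ⟨b, hb, e⟩ := hz' i g
    obtain ⟨c, hc, e'⟩ := hz' i (a * g)
    have hq : ((a * g : G i) : G i ⧸ A i) = g := by
      rw [QuotientGroup.mk_mul, (QuotientGroup.eq_one_iff _).2 a.2, one_mul]
    rw [hq] at hc e'
    have h : c = a * b := by
      apply Subtype.ext
      rw [Subgroup.coe_mul]
      apply mul_right_cancel (b := σ i g)
      rw [hc, mul_assoc, hb]
    rw [e, e', h, map_mul, Subgroup.coe_mul, mul_assoc]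
  · obtain ⟨b, hb, e⟩ := hz' i g
    rw [e, QuotientGroup.mk_mul, (QuotientGroup.eq_one_iff _).2 ((x i).1 b).2, one_mul, hτ']

theorem exists_overPerm (T : GroupTables n D u) [∀ i, Finite (G i)]
    {l : ∀ i, List (MulAut (A i) × MulAut (G i ⧸ A i))}
    (hl : PolyTime n D fun i => .ofList ((l i).map fun γ =>
      .cons (encodeMap (u i).sub (u i).sub γ.1) (encodeMap (u i).quo (u i).quo γ.2))) :
    ∃ S : ∀ i, List (OverPerm (A i)),
      PolyTime n D (fun i => .ofList ((S i).map fun r =>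
        encodeMap (u i).grp (u i).grp r.perm)) ∧
      ∀ i γ, γ ∈ (S i).map OverPerm.type ↔ γ ∈ l i := by
  obtain ⟨S, hS, hS'⟩ := hl.exists_list (P := fun i γ (r : OverPerm (A i)) => r.type = γ)
    (eY := fun i r => encodeMap (u i).grp (u i).grp r.perm) fun D' w hγ => by
    obtain ⟨z, hz, hz'⟩ := (T.extend w).exists_isOver (T.extend w)
      (x := fun j : MemIndex l => j.x) hγ
    exact ⟨fun j => ⟨j.x, .ofBijective (z j) (hz' j).bijective, hz' j⟩, hz, fun j => rfl⟩
  refine ⟨S, hS, fun i γ => ?_⟩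
  rw [List.mem_map]
  constructor
  · rintro ⟨r, hr, rfl⟩
    obtain ⟨γ, hγ, rfl⟩ := (hS' i).2 r hr
    exact hγ
  · exact fun hγ => (hS' i).1 γ hγ

/-! ### The coset of isomorphisms -/

variable [∀ i, Finite (G i)] [∀ i, Finite (H i)] [∀ i, IsMulCommutative (B i)]

theorem search_isomorphism (T : GroupTables n D u) (T' : GroupTables n D v)
    {x : ∀ i, (A i ≃* B i) × (G i ⧸ A i ≃* H i ⧸ B i)} {z : ∀ i, G i → H i}
    (hz : PolyTime n D fun i => encodeMap (u i).grp (v i).grp (z i)) (hx : ∀ i, IsOver (x i) (z i))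
    {R : ∀ i, List (OverPerm (B i))}
    (hR : PolyTime n D fun i => .ofList ((R i).map fun r =>
      encodeMap (v i).grp (v i).grp r.perm)) :
    ∃ o : ∀ i, Option (G i ≃* H i),
      PolyTime n D (fun i => encodeOption (fun φ : G i ≃* H i => encodeMap (u i).grp (v i).grp φ) (o i)) ∧
      ∀ i, o i = none → ∀ r ∈ R i, ∀ φ : G i ≃* H i,
        ¬IsOver ((x i).1.trans r.type.1, (x i).2.trans r.type.2) φ := by
  obtain ⟨o, ho, ho'⟩ := hR.find_some (Y := fun i => G i ≃* H i)
    (eY := fun i (φ : G i ≃* H i) => encodeMap (u i).grp (v i).grp φ) (P := fun _ _ _ => True)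
    (N := fun i r => ∀ φ : G i ≃* H i,
      ¬IsOver ((x i).1.trans r.type.1, (x i).2.trans r.type.2) φ) fun D' w hr => by
    obtain ⟨f, hf, hf'⟩ := (T.extend w).lift (T'.extend w)
      (z := fun j => j.x.perm ∘ z j.i)
      (PolyTime.map_of (w T.elems_grp) fun D'' w' hg =>
        PolyTime.congr (PolyTime.apply (w' hr) (PolyTime.apply (w' (w hz)) hg)) fun j => rfl)
      fun j => (hx j.i).comp j.x.isOver
    refine hf.option_cases (S := fun j => Option (G j.i ≃* H j.i))
      (eS := fun j => encodeOption fun φ : G j.i ≃* H j.i => encodeMap (u j.i).grp (v j.i).grp φ)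
      (P := fun j o => o.elim (∀ φ : G j.i ≃* H j.i,
        ¬IsOver ((x j.i).1.trans j.x.type.1, (x j.i).2.trans j.x.type.2) φ) fun _ => True)
      (fun D'' w' => ⟨fun _ => none, (w' hf).nil, fun j => ?_⟩) fun D'' w' hl => ?_
    · have := hf' j.1
      rw [j.2] at this
      exact this
    -- `LiftSpec` excludes the empty list, so the head of the list is an isomorphism.
    · have key (j : Σ j, {l // f j = some l}) :
          ∃ (φ : G j.1.i ≃* H j.1.i) (t : List (G j.1.i → H j.1.i)), j.2.1 = ⇑φ :: t := by
        have h := hf' j.1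
        rw [j.2.2] at h
        obtain ⟨h1, ⟨φ, h2, -⟩, -⟩ := h
        match hj : j.2.1 with
        | [] => rw [hj] at h2; cases h2
        | r :: t =>
          obtain ⟨ψ, e, -⟩ := h1 r (by rw [hj]; exact List.mem_cons_self)
          exact ⟨ψ, t, by rw [e]⟩
      choose φ t hφ using key
      refine ⟨fun j => some (φ j), (hl.head.cons hl.nil).congr fun j => ?_, fun j => trivial⟩
      rw [hφ]
      rfl
  refine ⟨o, ho, fun i hi => ?_⟩
  have := ho' i
  rwa [hi] at this

/-- Coset representatives and generators of the automorphism group come from the same enumeration in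
the second group. By `hiso` and `haut`, no isomorphism or automorphism lies outside the range that
the enumeration covers. -/
theorem exists_isomorphisms (T : GroupTables n D u) (T' : GroupTables n D v)
    {x : ∀ i, (A i ≃* B i) × (G i ⧸ A i ≃* H i ⧸ B i)}
    (hx : PolyTime n D fun i => .cons (encodeMap (u i).sub (v i).sub (x i).1)
      (encodeMap (u i).quo (v i).quo (x i).2))
    {l : ∀ i, List (MulAut (B i) × MulAut (H i ⧸ B i))}
    (hl : PolyTime n D fun i => .ofList ((l i).map fun γ =>
      .cons (encodeMap (v i).sub (v i).sub γ.1) (encodeMap (v i).quo (v i).quo γ.2)))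
    {h : ι → ℕ} (hbdd : PolyBdd n h)
    (hh : ∀ i (R : List (MulAut (B i) × MulAut (H i ⧸ B i))),
      (∀ r ∈ R, r ∈ Subgroup.closure {γ | γ ∈ l i}) →
      (R.Pairwise fun y r => ∀ φ : MulAut (H i), ¬IsOver (y * r⁻¹) φ) → R.length ≤ h i)
    (hiso : ∀ i (φ : G i ≃* H i), ∃ γ ∈ Subgroup.closure {γ | γ ∈ l i},
      IsOver ((x i).1.trans γ.1, (x i).2.trans γ.2) φ)
    (haut : ∀ i (φ : MulAut (H i)), ∃ γ ∈ Subgroup.closure {γ | γ ∈ l i}, IsOver γ φ) :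
    ∃ c : ∀ i, CosetData (G i ≃* H i) (MulAut (H i)),
      PolyTime n D (fun i => encodeIso (u i) (v i) (c i)) ∧ ∀ i, RepresentsIso (c i) := by
  obtain ⟨z, hz, hz'⟩ := T.exists_isOver T' hx
  obtain ⟨S, hS, hS'⟩ := T'.exists_overPerm hl
  have hS'' (i : ι) : {γ | γ ∈ (S i).map OverPerm.type} = {γ | γ ∈ l i} := Set.ext (hS' i)
  obtain ⟨R, O, hR, hO, inv, aut⟩ := T'.orbit hS hbdd (by simpa only [hS''] using hh)
  have hlift (i : ι) : ∃ m : List (MulAut (H i)), m.map (fun φ : MulAut (H i) => (φ : H i → H i)) = O i := by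
    have : O i ∈ Set.range (List.map fun φ : MulAut (H i) => (φ : H i → H i)) := by
      rw [Set.range_list_map]
      exact aut i
    exact this
  choose m hm using hlift
  obtain ⟨o, ho, ho'⟩ := T.search_isomorphism T' hz hz' hR
  refine ho.option_cases (S := fun i => CosetData (G i ≃* H i) (MulAut (H i)))
    (eS := fun i => encodeIso (u i) (v i)) (P := fun i c => RepresentsIso c)
    (fun D' w => ⟨fun i => none, (w ho).nil, fun i => ?_⟩)
    fun D' w hφ => ⟨fun j => some (j.2.1, m j.1), (hφ.cons (w hO)).congr fun j => ?_, fun j => ?_⟩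
  · refine Set.eq_empty_of_forall_notMem fun φ _ => ?_
    obtain ⟨γ, hγ, hov⟩ := hiso i φ
    rw [← hS''] at hγ
    obtain ⟨r, hr, ψ, -, hψ⟩ := (inv i).exists_mem hγ
    obtain ⟨r, hr', rfl⟩ := List.mem_map.1 hr
    -- If `φ` lies over `x` followed by `γ`, and `ψ` lifts `γ * r⁻¹`, then `ψ⁻¹ ∘ φ` lies over `x`
    -- followed by `r`. So it suffices to try the representatives.
    have h1 := hov.comp (IsOver.symm (r := ψ.toEquiv) hψ)
    refine ho' i i.2 r hr' (φ.trans ψ.symm) ?_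
    convert h1 using 1
    swap
    · rfl
    refine Prod.ext (MulEquiv.ext fun a => ?_) (MulEquiv.ext fun a => ?_)
    · exact (congrArg r.type.1 (γ.1.symm_apply_apply _)).symm
    · exact (congrArg r.type.2 (γ.2.symm_apply_apply _)).symm
  · rw [← hm, List.map_map]
    rfl
  · refine (Set.eq_univ_of_forall fun ψ => ?_).symm
    refine ⟨j.2.1.symm.trans ψ, ?_, MulEquiv.ext fun g => ?_⟩
    · obtain ⟨γ, hγ, hov⟩ := haut j.1 (j.2.1.symm.trans ψ)
      rw [← hS''] at hγ
      have h1 := (inv j.1).mem_of_mem hγ hov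
      have h2 : {φ : MulAut (H j.1) | ⇑φ ∈ O j.1} = {φ | φ ∈ m j.1} := by
        ext φ
        simp [← hm]
      rwa [autClosure, h2] at h1
    · exact congrArg ψ (j.2.1.symm_apply_apply g)

end GroupTables

/-! ### Instances of the isomorphism problem -/

/-- An isomorphism induces an action compatibility. -/
theorem AbelianCharSubgroupFunctor.exists_isOver (S : AbelianCharSubgroupFunctor.{u})
    {G H : Type u} [Group G] [Finite G] [Group H] [Finite H] (φ : G ≃* H) :
    ∃ x ∈ actionCompatibilities (S.action G) (S.action H), IsOver x φ := by
  have h := S.map_obj G H φ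
  refine ⟨((φ.subgroupMap (S.obj G)).trans (MulEquiv.subgroupCongr h),
    QuotientGroup.congr (S.obj G) (S.obj H) φ h), fun q a => ?_, fun a g => map_mul φ _ _,
    fun g => rfl⟩
  obtain ⟨g, rfl⟩ := QuotientGroup.mk_surjective q
  apply Subtype.ext
  change φ (g * a * g⁻¹) = φ g * φ a * (φ g)⁻¹
  simp

/-- The inputs of the algorithm. -/
structure IsoInstance where
  S : AbelianCharSubgroupFunctor.{u}
  G₁ : Type u
  G₂ : Type u
  [group₁ : Group G₁]
  [finite₁ : Finite G₁]
  [group₂ : Group G₂]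
  [finite₂ : Finite G₂]
  E₁ : Enumeration G₁ (S.obj G₁)
  E₂ : Enumeration G₂ (S.obj G₂)
  compat : CosetData ((S.obj G₁ ≃* S.obj G₂) × (G₁ ⧸ S.obj G₁ ≃* G₂ ⧸ S.obj G₂))
    (MulAut (S.obj G₂) × MulAut (G₂ ⧸ S.obj G₂))
  represents : RepresentsCompat (S.action G₁) (S.action G₂) compat

namespace IsoInstance

attribute [instance] group₁ finite₁ group₂ finite₂

/-- The smaller one of the two cohomology groups. -/
noncomputable def cohomologyCard (I : IsoInstance.{u}) : ℕ :=
  min (Nat.card (secondCohomology (I.S.action I.G₁)))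
    (Nat.card (secondCohomology (I.S.action I.G₂)))

/-- The parameter that bounds the running time. -/
noncomputable def param (I : IsoInstance.{u}) : ℕ :=
  Nat.card I.G₁ + Nat.card I.G₂ + I.compat.numGens + I.cohomologyCard

/-- The input as a tree. -/
noncomputable def input (I : IsoInstance.{u}) : Val :=
  encodeInput I.E₁ I.E₂ I.compat

/-! ### Polynomial bounds for the size of the input -/

theorem size_encode_le {G : Type*} [Group G] [Finite G] {A : Subgroup G} (E : Enumeration G A)
    {m : ℕ} (hm : Nat.card G ≤ m) :
    E.encode.size ≤ (1 + m * ((1 + m * (2 * m + 2)) + 1)) +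
      (1 + m * (2 * m + 2) + (1 + m * (2 * m + 2)) + 1) + 1 := by
  have hA : Nat.card A ≤ m := A.card_le_card_group.trans hm
  have hQ : Nat.card (G ⧸ A) ≤ m :=
    (Nat.card_le_card_of_surjective _ (QuotientGroup.mk_surjective (s := A))).trans hm
  have h {X Y : Type _} {a b : ℕ} (eX : X ≃ Fin a) (eY : Y ≃ Fin b) (f : X → Y) (ha : a ≤ m)
      (hb : b ≤ m) : (encodeMap eX eY f).size ≤ 1 + m * (2 * m + 2) :=
    (Val.size_encodeMap_le eX eY f).trans (by gcongr)
  simp only [Enumeration.encode, Val.size]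
  gcongr
  · refine (Val.size_ofList_le (B := 1 + m * (2 * m + 2)) fun y hy => ?_).trans ?_
    · obtain ⟨k, rfl⟩ := List.mem_ofFn.1 hy
      exact h _ _ _ hm hm
    · rw [List.length_ofFn]
      gcongr
  · exact h _ _ _ hA hm
  · exact h _ _ _ hm hQ

theorem size_compat_le (I : IsoInstance.{u}) {m : ℕ} (h₁ : Nat.card I.G₁ ≤ m)
    (h₂ : Nat.card I.G₂ ≤ m) (hl : I.compat.numGens ≤ m) :
    (encodeCompat I.E₁ I.E₂ I.compat).size ≤
      (1 + m * (2 * m + 2) + (1 + m * (2 * m + 2)) + 1) +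
        (1 + m * ((1 + m * (2 * m + 2) + (1 + m * (2 * m + 2)) + 1) + 1)) + 1 := by
  have hA {G : Type u} [Group G] [Finite G] (A : Subgroup G) (hm : Nat.card G ≤ m) :
      Nat.card A ≤ m := A.card_le_card_group.trans hm
  have hQ {G : Type u} [Group G] [Finite G] (A : Subgroup G) (hm : Nat.card G ≤ m) :
      Nat.card (G ⧸ A) ≤ m :=
    (Nat.card_le_card_of_surjective _ (QuotientGroup.mk_surjective (s := A))).trans hm
  have h {X Y : Type u} {a b : ℕ} (eX : X ≃ Fin a) (eY : Y ≃ Fin b) (f : X → Y) (ha : a ≤ m)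
      (hb : b ≤ m) : (encodeMap eX eY f).size ≤ 1 + m * (2 * m + 2) :=
    (Val.size_encodeMap_le eX eY f).trans (by gcongr)
  match hc : I.compat with
  | none => simp [encodeCompat, encodeCoset, Val.size]
  | some (x, l) =>
    rw [hc] at hl
    simp only [encodeCompat, encodeCoset, Val.size]
    gcongr
    · exact h _ _ _ (hA _ h₁) (hA _ h₂)
    · exact h _ _ _ (hQ _ h₁) (hQ _ h₂)
    · refine (Val.size_ofList_le (B := 1 + m * (2 * m + 2) + (1 + m * (2 * m + 2)) + 1)
        fun y hy => ?_).trans ?_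
      · obtain ⟨γ, -, rfl⟩ := List.mem_map.1 hy
        simp only [Val.size]
        gcongr
        · exact h _ _ _ (hA _ h₂) (hA _ h₂)
        · exact h _ _ _ (hQ _ h₂) (hQ _ h₂)
      · rw [List.length_map]
        gcongr
        exact hl

theorem polyBdd_size_input : PolyBdd param.{u} fun I => I.input.size := by
  have hm := PolyBdd.self param.{u}
  have h1 := PolyBdd.const param.{u} 1
  have h2 := PolyBdd.const param.{u} 2
  have hmap := h1.add (hm.mul ((h2.mul hm).add h2))
  have henc := ((h1.add (hm.mul (hmap.add h1))).add ((hmap.add hmap).add h1)).add h1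
  have hpair := (hmap.add hmap).add h1
  have hcompat := (hpair.add (h1.add (hm.mul (hpair.add h1)))).add h1
  refine ((henc.add ((henc.add hcompat).add h1)).add h1).mono fun I => ?_
  have h₁ : Nat.card I.G₁ ≤ I.param := by rw [param]; omega
  have h₂ : Nat.card I.G₂ ≤ I.param := by rw [param]; omega
  have h₃ : I.compat.numGens ≤ I.param := by rw [param]; omega
  simp only [input, encodeInput, Val.size]
  gcongr
  · exact size_encode_le I.E₁ h₁
  · exact size_encode_le I.E₂ h₂
  · exact I.size_compat_le h₁ h₂ h₃

theorem mem_actionCompatibilities_iff (I : IsoInstance.{u}) {x l} (h : I.compat = some (x, l)) {y} :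
    y ∈ actionCompatibilities (I.S.action I.G₁) (I.S.action I.G₂) ↔
      ∃ γ ∈ Subgroup.closure {γ | γ ∈ l}, (x.1.trans γ.1, x.2.trans γ.2) = y := by
  have := I.represents
  rw [RepresentsCompat, h] at this
  exact Set.ext_iff.1 this y

/-- The factor set of `G₂` can be transported to cocycles for `θ₁` along the inverse of `x`, or left
in place as a cocycle for `θ₂`. The number of cosets is thus bounded by either cohomology group. -/
theorem length_le_cohomologyCard (I : IsoInstance.{u}) {x l} (h : I.compat = some (x, l))
    {R : List (MulAut (I.S.obj I.G₂) × MulAut (I.G₂ ⧸ I.S.obj I.G₂))}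
    (hR : ∀ r ∈ R, r ∈ Subgroup.closure {γ | γ ∈ l})
    (hp : R.Pairwise fun y r => ∀ φ : MulAut I.G₂, ¬IsOver (y * r⁻¹) φ) :
    R.length ≤ I.cohomologyCard := by
  have hx : x ∈ actionCompatibilities (I.S.action I.G₁) (I.S.action I.G₂) :=
    (I.mem_actionCompatibilities_iff h).2 ⟨1, one_mem _, rfl⟩
  have hx' : (x.1.symm, x.2.symm) ∈
      actionCompatibilities (I.S.action I.G₂) (I.S.action I.G₁) := by
    intro q a
    apply x.1.injective
    rw [hx, MulEquiv.apply_symm_apply, MulEquiv.apply_symm_apply, MulEquiv.apply_symm_apply]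
  have hR' (r) (hr : r ∈ R) :
      r ∈ actionCompatibilities (I.S.action I.G₂) (I.S.action I.G₂) := by
    intro q a
    have h1 := (I.mem_actionCompatibilities_iff h).2 ⟨r, hR r hr, rfl⟩ (x.2.symm q) (x.1.symm a)
    simpa only [hx _ _, MulEquiv.trans_apply, MulEquiv.apply_symm_apply] using h1
  refine le_min (length_le_card_secondCohomology hx' hR' hp)
    (length_le_card_secondCohomology (θ := I.S.action I.G₂) (w := (MulEquiv.refl _, MulEquiv.refl _))
      (fun q a => rfl) hR' hp)

theorem exists_coset : ∃ c : ∀ I : IsoInstance.{u}, CosetData (I.G₁ ≃* I.G₂) (MulAut I.G₂),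
    PolyTime param input (fun I => encodeIso I.E₁ I.E₂ (c I)) ∧ ∀ I, RepresentsIso (c I) := by
  have hI : PolyTime param.{u} input input := .refl polyBdd_size_input
  refine (hI.snd.snd).eq_nil.cases (S := fun I => CosetData (I.G₁ ≃* I.G₂) (MulAut I.G₂))
    (enc := fun I => encodeIso I.E₁ I.E₂) (P := fun I c => RepresentsIso c)
    (fun D' w => ⟨fun _ => none, (w hI).nil, fun J => ?_⟩) fun D' w => ?_
  · obtain ⟨I, hJ⟩ := J
    refine Set.eq_empty_of_forall_notMem fun φ _ => ?_
    obtain ⟨y, hy, -⟩ := I.S.exists_isOver φ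
    have hr := I.represents
    match hc : I.compat with
    | none =>
      rw [hc] at hr
      rw [RepresentsCompat, CosetData.Represents] at hr
      rw [hr] at hy
      exact hy
    | some (x, l) =>
      rw [hc] at hJ
      cases hJ
  · have key (J : {I : IsoInstance.{u} // ¬encodeCompat I.E₁ I.E₂ I.compat = .nil}) :
        ∃ x l, J.1.compat = some (x, l) := by
      obtain ⟨I, hJ⟩ := J
      match hc : I.compat with
      | none => exact absurd (by rw [hc]; rfl) hJ
      | some (x, l) => exact ⟨x, l, rfl⟩
    choose x l h using key
    have hc := (w hI.snd.snd).congr fun J => by rw [h J]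
    -- No table in the encoding of a single group is indexed by the quotient. Its order is read off
    -- from the length of the table of `β`, which serves for both quotients because they are
    -- isomorphic.
    have hβ := hc.fst.snd
    have T₁ := GroupTables.of_encode (u := fun J => J.1.E₁) (w hI.fst)
      (PolyTime.elems hβ fun J => List.length_ofFn)
    have T₂ := GroupTables.of_encode (u := fun J => J.1.E₂) (w hI.snd.fst)
      (PolyTime.elems hβ fun J => by
        rw [List.length_ofFn]
        exact Nat.card_congr (x J).2.toEquiv)
    exact T₁.exists_isomorphisms T₂ (x := x) (l := l) hc.fst hc.snd
      (h := fun J => J.1.cohomologyCard)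
      ((PolyBdd.self _).mono fun J => Nat.le_add_left _ _)
      (fun J R hR hp => J.1.length_le_cohomologyCard (h J) hR hp)
      (fun J φ => by
        obtain ⟨y, hy, hov⟩ := J.1.S.exists_isOver φ
        obtain ⟨γ, hγ, rfl⟩ := (J.1.mem_actionCompatibilities_iff (h J)).1 hy
        exact ⟨γ, hγ, hov⟩)
      (fun J φ => by
        obtain ⟨t, ht, hov⟩ := J.1.S.exists_isOver φ
        have hx : x J ∈ _ := (J.1.mem_actionCompatibilities_iff (h J)).2 ⟨1, one_mem _, rfl⟩
        obtain ⟨γ, hγ, e⟩ := (J.1.mem_actionCompatibilities_iff (h J)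
          (y := ((x J).1.trans t.1, (x J).2.trans t.2))).1 fun q a => by
            have h1 := ht ((x J).2 q) ((x J).1 a)
            rw [← hx] at h1
            exact h1
        have e' : γ = t := by
          refine Prod.ext (MulEquiv.ext fun a => ?_) (MulEquiv.ext fun a => ?_)
          · have := DFunLike.congr_fun (congrArg Prod.fst e) ((x J).1.symm a)
            simpa using this
          · have := DFunLike.congr_fun (congrArg Prod.snd e) ((x J).2.symm a)
            simpa using this
        exact ⟨t, e' ▸ hγ, hov⟩)

end IsoInstance

/-- Monotonicity allows the minimum in `IsoInstance.param` to be replaced by the order of either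
cohomology group. -/
theorem Polynomial.eval_mono_nat (p : Polynomial ℕ) : Monotone fun k => p.eval k := by
  intro a b hab
  simp only [Polynomial.eval_eq_sum, Polynomial.sum]
  gcongr

theorem mainTheorem6 :
    ∃ (P : Prog) (p : Polynomial ℕ),
      ∀ (S : AbelianCharSubgroupFunctor.{u}) (G₁ G₂ : Type u)
        [Group G₁] [Finite G₁] [Group G₂] [Finite G₂]
        (E₁ : Enumeration G₁ (S.obj G₁)) (E₂ : Enumeration G₂ (S.obj G₂))
        (compat : CosetData
          ((S.obj G₁ ≃* S.obj G₂) × (G₁ ⧸ S.obj G₁ ≃* G₂ ⧸ S.obj G₂))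
          (MulAut (S.obj G₂) × MulAut (G₂ ⧸ S.obj G₂))),
        RepresentsCompat (S.action G₁) (S.action G₂) compat →
          ∃ (iso : CosetData (G₁ ≃* G₂) (MulAut G₂)) (t : ℕ),
            RepresentsIso iso ∧
            Runs P (encodeInput E₁ E₂ compat) (encodeIso E₁ E₂ iso) t ∧
            t ≤ p.eval (Nat.card G₁ + Nat.card G₂ + compat.numGens
              + Nat.card (secondCohomology (S.action G₁))) ∧
            t ≤ p.eval (Nat.card G₁ + Nat.card G₂ + compat.numGens
              + Nat.card (secondCohomology (S.action G₂))) := by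
  obtain ⟨c, ⟨P, t, ⟨p, hp⟩, hP⟩, hc⟩ := IsoInstance.exists_coset.{u}
  refine ⟨P, p, fun S G₁ G₂ _ _ _ _ E₁ E₂ compat h => ?_⟩
  let I : IsoInstance := ⟨S, G₁, G₂, E₁, E₂, compat, h⟩
  refine ⟨c I, t I, hc I, hP I, (hp I).trans ?_, (hp I).trans ?_⟩
  · exact Polynomial.eval_mono_nat p (Nat.add_le_add_left (min_le_left _ _) _)
  · exact Polynomial.eval_mono_nat p (Nat.add_le_add_left (min_le_right _ _) _)
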